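/- **Setup.** Let $g\ge 2$, let $\mathbb D$ be the Poincaré disk and $\mathbb S=\partial\mathbb D$. Indices $i$ are taken mod $8g-4$. Let $\Gamma$ be a group of orientation-preserving Möbius transformations of $\mathbb D$ acting freely, with $\Gamma\backslash\mathbb D$ a closed surface of genus $g$, and let $\mathcal F$ be a convex $(8g-4)$-sided fundamental polygon of $\Gamma$ whose vertices $V_i\in\mathbb D$ are labelled counterclockwise, side $i$ joining $V_i$ to $V_{i+1}$. Let $P_i$ and $Q_{i+1}$ be the initial and final endpoints on $\mathbb S$ of the oriented geodesic extending side $i$; their counterclockwise order is $P_1,Q_1,P_2,Q_2,\dots,P_{8g-4},Q_{8g-4}$. Assume the extension condition: the geodesics extending the sides never meet the interior of $\gamma\mathcal F$, $\gamma\in\Gamma$. Put $\sigma(i)=4g-i$ for $i$ odd, $\sigma(i)=2-i$ for $i$ even, $\rho(i)=\sigma(i)+1$, $\tau(i)=i+4g-2$ (all mod $8g-4$). The sides are paired by $T_i\in\Gamma$ with $T_i(V_i)=V_{\rho(i)}$, $T_{\sigma(i)}T_i=\mathrm{Id}$ and $T_{\rho^3(i)}T_{\rho^2(i)}T_{\rho(i)}T_i=\mathrm{Id}$.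 Arcs $[x,y]$, $[x,y)$ of $\mathbb S$ run counterclockwise from $x$ to $y$. Let $A=(A_i)$ be extremal, i.e. $A_i\in\{P_i,Q_i\}$ for every $i$, and let $F_A(u,w)=(T_iu,T_iw)$ if $w\in[A_i,A_{i+1})$, for $(u,w)\in\mathbb S\times\mathbb S$. **Theorem.** There is exactly one family $G_1,\dots,G_{8g-4}\in\mathbb S$ such that for all $i$: $G_i\in[P_i,P_{i+1}]$; $G_{\sigma(i)}=T_iG_{i-2}$ if $A_i=P_i$; and $G_{\sigma(i)}=T_{\tau(i)+1}G_{\tau(i)}$ if $A_i=Q_i$. For this family put $H_i=T_{\sigma(i-1)}T_{\tau(i)}G_{\tau(i)-1}$ and $$\Omega_A=\bigcup_{i}\ [H_{i+1},G_{i-2}]\times[P_i,Q_i]\ \cup\ [H_{i+1},G_{i-1}]\times[Q_i,P_{i+1}],$$ $$\Omega_A^{\circ}=\bigcup_{i}\ [H_{i+1},G_{i-2})\times[P_i,Q_i)\ \cup\ [H_{i+1},G_{i-1})\times[Q_i,P_{i+1}).$$ Then $\Omega_A$ is a bijectivity domain for $F_A$, up to its boundary, in the following sense. 1. $F_A(\Omega_A)\subseteq\Omega_A$,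 $\overline{F_A(\Omega_A)}=\Omega_A$, $\operatorname{int}\Omega_A\subseteq F_A(\Omega_A)$, and $F_A$ is injective on $\operatorname{int}\Omega_A$. 2. $F_A$ maps $\Omega_A^{\circ}$ bijectively onto $\Omega_A^{\circ}$, so $F_A(\Omega_A^{\circ})=\Omega_A^{\circ}$. 3. $\operatorname{int}\Omega_A\subseteq\Omega_A^{\circ}$, $\overline{\Omega_A^{\circ}}=\Omega_A$, and $\Omega_A\setminus\Omega_A^{\circ}$ is contained in $\partial\Omega_A$ and in the union of the finitely many lines $\{G_i\}\times\mathbb S$, $\mathbb S\times\{P_i\}$, $\mathbb S\times\{Q_i\}$. -/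

import Mathlib

open Set

/-- The group `SU(1,1)` of complex matrices `(a b; conj b, conj a)` with `|a|^2 - |b|^2 = 1`. Its
elements induce the orientation-preserving isometries of the Poincare disk. -/
@[ext]
structure SU11 where
  a : ℂ
  b : ℂ
  det_eq : Complex.normSq a - Complex.normSq b = 1

namespace SU11

instance : One SU11 := ⟨⟨1, 0, by simp⟩⟩

/-- Matrix multiplication. -/
instance : Mul SU11 :=
  ⟨fun X Y =>
    ⟨X.a * Y.a + X.b * (starRingEnd ℂ) Y.b, X.a * Y.b + X.b * (starRingEnd ℂ) Y.a, by
      have hX := X.det_eq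
      have hY := Y.det_eq
      simp only [Complex.normSq_apply, Complex.add_re, Complex.add_im, Complex.mul_re,
        Complex.mul_im, Complex.conj_re, Complex.conj_im] at *
      linear_combination (Y.a.re * Y.a.re + Y.a.im * Y.a.im - (Y.b.re * Y.b.re + Y.b.im * Y.b.im))
        * hX + hY⟩⟩

/-- The inverse matrix `(conj a, -b; -conj b, a)`. -/
instance : Inv SU11 :=
  ⟨fun X => ⟨(starRingEnd ℂ) X.a, -X.b, by simpa using X.det_eq⟩⟩

theorem one_a : (1 : SU11).a = 1 := rfl
theorem one_b : (1 : SU11).b = 0 := rfl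
theorem mul_a (X Y : SU11) : (X * Y).a = X.a * Y.a + X.b * (starRingEnd ℂ) Y.b := rfl
theorem mul_b (X Y : SU11) : (X * Y).b = X.a * Y.b + X.b * (starRingEnd ℂ) Y.a := rfl
theorem inv_a (X : SU11) : (X⁻¹).a = (starRingEnd ℂ) X.a := rfl
theorem inv_b (X : SU11) : (X⁻¹).b = -X.b := rfl

instance : Group SU11 :=
  Group.ofLeftAxioms
    (by
      intro X Y Z
      ext1
      · simp only [mul_a, mul_b, map_add, map_mul, Complex.conj_conj]
        ring
      · simp only [mul_a, mul_b, map_add, map_mul, Complex.conj_conj]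
        ring)
    (by
      intro X
      ext1
      · simp [mul_a, one_a, one_b]
      · simp [mul_b, one_a, one_b])
    (by
      intro X
      have h : X.a * (starRingEnd ℂ) X.a - X.b * (starRingEnd ℂ) X.b = 1 := by
        rw [Complex.mul_conj, Complex.mul_conj]
        exact_mod_cast X.det_eq
      ext1
      · simp only [mul_a, inv_a, inv_b, one_a]
        linear_combination h
      · simp only [mul_b, inv_a, inv_b, one_b]
        ring)

/-- The Moebius transformation `z ↦ (a z + b) / (conj b z + conj a)`; the denominator does not
vanish on the closed unit disk. -/
noncomputable def mob (X : SU11) (z : ℂ) : ℂ :=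
  (X.a * z + X.b) / ((starRingEnd ℂ) X.b * z + (starRingEnd ℂ) X.a)

theorem norm_mob_circle (X : SU11) (x : Circle) : ‖X.mob (x : ℂ)‖ = 1 := by
  have hx : ‖(x : ℂ)‖ = 1 := Circle.norm_coe x
  have hxx : (x : ℂ) * (starRingEnd ℂ) (x : ℂ) = 1 := by
    rw [Complex.mul_conj, Complex.normSq_eq_norm_sq, hx]
    norm_num
  have hden : (starRingEnd ℂ) X.b * (x : ℂ) + (starRingEnd ℂ) X.a
      = (x : ℂ) * (starRingEnd ℂ) (X.a * x + X.b) := by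
    rw [map_add, map_mul]
    linear_combination -(starRingEnd ℂ) X.a * hxx
  have hne : X.a * (x : ℂ) + X.b ≠ 0 := by
    intro h0
    have h1 : ‖X.a‖ = ‖X.b‖ := by
      have h2 : X.b = -(X.a * (x : ℂ)) := by linear_combination h0
      rw [h2, norm_neg, norm_mul, hx, mul_one]
    have h3 := X.det_eq
    rw [Complex.normSq_eq_norm_sq, Complex.normSq_eq_norm_sq, h1] at h3
    norm_num at h3
  rw [mob, hden, norm_div, norm_mul, hx, one_mul, Complex.norm_conj]
  exact div_self (norm_ne_zero_iff.mpr hne)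

/-- The action of a Moebius transformation on the circle at infinity. -/
noncomputable def onCircle (X : SU11) (x : Circle) : Circle :=
  ⟨X.mob x, mem_sphere_zero_iff_norm.mpr (X.norm_mob_circle x)⟩

/-- The matrix (which is then `1` or `-1`) induces the identity transformation of the disk. -/
def ActsTrivially (X : SU11) : Prop := ∀ z : ℂ, ‖z‖ < 1 → X.mob z = z

end SU11

/-- `x, y, z` are distinct points of the circle and are met in this order when the circle is
traversed counterclockwise (the triangle `x y z` is positively oriented). -/
def Ccw (x y z : Circle) : Prop :=
  0 < ((starRingEnd ℂ) ((y : ℂ) - x) * ((z : ℂ) - x)).im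

/-- The closed arc `[x, y]`, running counterclockwise from `x` to `y`. -/
def arcCC (x y : Circle) : Set Circle := {z | z = x ∨ z = y ∨ Ccw x z y}

/-- The half-open arc `[x, y)`, running counterclockwise from `x` to `y`. -/
def arcCO (x y : Circle) : Set Circle := {z | z ∈ arcCC x y ∧ z ≠ y}

/-- For `x ≠ y` on the unit circle, `geodesicSide x y z = 0` is the equation of the circle or line
through `x` and `y` orthogonal to the unit circle. (If `x = exp (i (m - d))` and
`y = exp (i (m + d))`, it reads `cos d * (|z|^2 + 1) = 2 * Re (z * exp (-i m))`, up to the factor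
`2 * sin d`.) For `z` in the disk it is positive to the left of the geodesic oriented from `x` to
`y`, and negative to the right. -/
noncomputable def geodesicSide (x y : Circle) (z : ℂ) : ℝ :=
  ((starRingEnd ℂ) (x : ℂ) * y).im * (‖z‖ ^ 2 + 1)
    - 2 * ((starRingEnd ℂ) z * ((y : ℂ) - x)).im

/-- The geodesic of the Poincare disk with ideal endpoints `x ≠ y`. -/
def geodesic (x y : Circle) : Set ℂ := {z | ‖z‖ < 1 ∧ geodesicSide x y z = 0}

/-- Index set of the sides of an `(8g-4)`-gon, with indices mod `8g-4`. -/
abbrev SideIndex (g : ℕ) : Type := ZMod (8 * g - 4)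

/-- The side pairing rule: `4g - i` for odd `i`, `2 - i` for even `i`, mod `8g-4`. -/
def sidePairing (g : ℕ) (i : SideIndex g) : SideIndex g :=
  if Odd i.val then ((4 * g : ℕ) : SideIndex g) - i else 2 - i

/-- `ρ(i) = σ(i) + 1`. -/
def vertexMap (g : ℕ) (i : SideIndex g) : SideIndex g := sidePairing g i + 1

/-- `τ(i) = i + (4g - 2)` mod `8g-4`. -/
def oppositeSide (g : ℕ) (i : SideIndex g) : SideIndex g := i + ((4 * g - 2 : ℕ) : SideIndex g)

/-- The endpoints in the order `P 0, Q 0, P 1, Q 1, …`, the indices being mod `8g-4`. -/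
def interlace {g : ℕ} (P Q : SideIndex g → Circle) (m : ℕ) : Circle :=
  if Even m then P ((m / 2 : ℕ) : SideIndex g) else Q ((m / 2 : ℕ) : SideIndex g)

/-- The convex polygon bounded by the geodesics from `P i` to `Q (i + 1)`, each of which has the
polygon on its left. -/
def sidePolygon {g : ℕ} (P Q : SideIndex g → Circle) : Set ℂ :=
  {z | ‖z‖ < 1 ∧ ∀ i, 0 ≤ geodesicSide (P i) (Q (i + 1)) z}

/-- A group `Γ` of Moebius transformations acting freely on the disk, with an `(8g-4)`-sided
fundamental polygon satisfying the extension condition and paired by the rule above. Such a polygon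
exists for every closed oriented hyperbolic surface `Γ \ 𝔻` of genus `g`. -/
structure SurfacePolygon (g : ℕ) where
  /-- The group; two opposite matrices are the same transformation. -/
  Γ : Subgroup SU11
  /-- The initial ideal endpoint of the oriented geodesic extending side `i`. -/
  P : SideIndex g → Circle
  /-- `Q (i + 1)` is the final ideal endpoint of the oriented geodesic extending side `i`. -/
  Q : SideIndex g → Circle
  /-- The vertices; side `i` connects `V i` to `V (i + 1)`. -/
  V : SideIndex g → ℂ
  /-- The side pairing transformations. -/
  T : SideIndex g → SU11
  /-- The counterclockwise order of the endpoints is `P 0, Q 0, P 1, Q 1, …`. -/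
  order : ∀ a b c : ℕ, a < b → b < c → c < 2 * (8 * g - 4) →
    Ccw (interlace P Q a) (interlace P Q b) (interlace P Q c)
  vertex_left : ∀ i, V i ∈ geodesic (P i) (Q (i + 1))
  vertex_right : ∀ i, V (i + 1) ∈ geodesic (P i) (Q (i + 1))
  acts_freely : ∀ X ∈ Γ, ∀ z : ℂ, ‖z‖ < 1 → X.mob z = z → X.ActsTrivially
  /-- The images of the polygon cover the disk. -/
  cover : ∀ z : ℂ, ‖z‖ < 1 → ∃ X ∈ Γ, X.mob z ∈ sidePolygon P Q
  /-- Different images of the polygon have disjoint interiors. -/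
  tile : ∀ X ∈ Γ, ∀ z ∈ interior (sidePolygon P Q), X.mob z ∈ interior (sidePolygon P Q) →
    X.ActsTrivially
  /-- Extension condition: the geodesics extending the sides do not meet the interior of any image
  of the polygon. -/
  extension : ∀ i, ∀ X ∈ Γ, ∀ z ∈ interior (sidePolygon P Q),
    X.mob z ∉ geodesic (P i) (Q (i + 1))
  T_mem : ∀ i, T i ∈ Γ
  T_vertex : ∀ i, (T i).mob (V i) = V (vertexMap g i)
  T_pairing : ∀ i, (T (sidePairing g i) * T i).ActsTrivially
  T_cycle : ∀ i, (T (vertexMap g (vertexMap g (vertexMap g i))) * T (vertexMap g (vertexMap g i))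
    * T (vertexMap g i) * T i).ActsTrivially

namespace SurfacePolygon

variable {g : ℕ}

/-- Extremal parameters. -/
def IsExtremal (M : SurfacePolygon g) (A : SideIndex g → Circle) : Prop :=
  ∀ i, A i = M.P i ∨ A i = M.Q i

/-- An index `i` with `w ∈ [A i, A (i+1))`. For `A i ∈ [P i, Q i]` these arcs partition the circle,
so there is exactly one such index. -/
noncomputable def arcIndex (A : SideIndex g → Circle) (w : Circle) : SideIndex g :=
  Classical.epsilon fun i => w ∈ arcCO (A i) (A (i + 1))

/-- The natural extension map `F_A (u, w) = (T i u, T i w)` if `w ∈ [A i, A (i+1))`. -/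
noncomputable def natExt (M : SurfacePolygon g) (A : SideIndex g → Circle)
    (p : Circle × Circle) : Circle × Circle :=
  ((M.T (arcIndex A p.2)).onCircle p.1, (M.T (arcIndex A p.2)).onCircle p.2)

/-- The system of equations and range conditions that determines the corner values `G i`. -/
def IsCornerSolution (M : SurfacePolygon g) (A G : SideIndex g → Circle) : Prop :=
  ∀ i, G i ∈ arcCC (M.P i) (M.P (i + 1)) ∧
    (A i = M.P i → G (sidePairing g i) = (M.T i).onCircle (G (i - 2))) ∧
    (A i = M.Q i →
      G (sidePairing g i) = (M.T (oppositeSide g i + 1)).onCircle (G (oppositeSide g i)))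

/-- `U i = T (σ (i-1)) ∘ T (τ i)`. -/
def cornerMap (M : SurfacePolygon g) (i : SideIndex g) : SU11 :=
  M.T (sidePairing g (i - 1)) * M.T (oppositeSide g i)

/-- `H i = U i (G (τ i - 1))`. -/
noncomputable def lowerCorner (M : SurfacePolygon g) (G : SideIndex g → Circle)
    (i : SideIndex g) : Circle :=
  (M.cornerMap i).onCircle (G (oppositeSide g i - 1))

/-- The union over `i` of `[H (i+1), G (i-2)] × [P i, Q i]` and
`[H (i+1), G (i-1)] × [Q i, P (i+1)]`. -/
def domain (M : SurfacePolygon g) (G : SideIndex g → Circle) : Set (Circle × Circle) :=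
  ⋃ i : SideIndex g,
    (arcCC (M.lowerCorner G (i + 1)) (G (i - 2)) ×ˢ arcCC (M.P i) (M.Q i)) ∪
    (arcCC (M.lowerCorner G (i + 1)) (G (i - 1)) ×ˢ arcCC (M.Q i) (M.P (i + 1)))

/-- The same union of rectangles, with all arcs half-open. -/
def halfOpenDomain (M : SurfacePolygon g) (G : SideIndex g → Circle) : Set (Circle × Circle) :=
  ⋃ i : SideIndex g,
    (arcCO (M.lowerCorner G (i + 1)) (G (i - 2)) ×ˢ arcCO (M.P i) (M.Q i)) ∪
    (arcCO (M.lowerCorner G (i + 1)) (G (i - 1)) ×ˢ arcCO (M.Q i) (M.P (i + 1)))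

/-- The finitely many vertical circles `{G i} × 𝕊` and horizontal circles `𝕊 × {P i}`,
`𝕊 × {Q i}`. -/
def gridLines (M : SurfacePolygon g) (G : SideIndex g → Circle) : Set (Circle × Circle) :=
  {p | (∃ i, p.1 = G i) ∨ ∃ i, p.2 = M.P i ∨ p.2 = M.Q i}

end SurfacePolygon

/-! The proof has a geometric half, which determines how the side pairings act on the points `P i`,
`Q i`, and a combinatorial half, which uses only that action, the cyclic order of the points and the
group relations.

Geometry. Let α be the interior angle of the polygon at `V j` and α' the one at `V (ρ j)`. After `T
j`, the image polygon meets the polygon along side `σ j` at `V (ρ j)`, and the extension condition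
forces α + α' ≤ π: otherwise the geodesic of side `ρ j`, continued backwards, would enter the image
(`im_dir_nonneg`). The cycle relation makes the four angles along an orbit of `ρ` add up to 0 mod
2π, so both pairs of neighbours add up to exactly π (`dir_mul_dir`). Hence `T i` carries the
extended sides at its two vertices to extended sides, and with σ = σ(i) it maps P_{i-1}, P_i, Q_i,
P_{i+1}, Q_{i+1}, Q_{i+2} to P_{σ+1}, Q_{σ+1}, Q_{σ+2}, P_{σ-1}, P_σ, Q_σ.

Corner values. Each equation expresses one G_j as the image of one other G_{s(j)} under a Möbius
transformation that maps [P_{s(j)}, P_{s(j)+1}] into [P_j, P_{j+1}]. Such maps are monotone in real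
coordinates, so a solution exists by the Knaster–Tarski theorem. Iterating `s` leads into a cycle,
where G_j is a fixed point of a composition; two fixed points in the arc and a third one outside
would make the composition the identity, which it is not. This gives uniqueness
(`existsUnique_isCornerSolution`).

Bijectivity. Put B_{σ(i)+1} = T_i G_{i-1} (`stripCorner`). The half-open domain is cut into
horizontal strips by the points A_i and into vertical strips by the points B_j. Each strip consists
of at most three rectangles, and `T i` takes horizontal strip i exactly onto vertical strip σ(i):
the corner equations say that the rectangles match, a rectangle absent on one side being empty on
the other (`strip_iff`). Since σ is a bijection of the indices, F_A is bijective on the half-open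
domain. The closed domain is its closure, and its invariance follows by continuity of each branch,
except at some points with w = P_i = A_i, where the closed rectangle below the cut is acted on by
the branch above it; these are treated directly in `mapsTo_natExt_domain`. -/

/-! ### Möbius transformations, the Hermitian form and the sides of a geodesic -/

open ComplexConjugate in
/-- The Hermitian form of signature `(1, 1)` on affine coordinates. -/
noncomputable def hermForm (z w : ℂ) : ℂ := z * conj w - 1

namespace SU11

open ComplexConjugate

/-- The denominator of the Moebius transformation. -/
noncomputable def den (X : SU11) (z : ℂ) : ℂ := conj X.b * z + conj X.a

theorem mob_eq (X : SU11) (z : ℂ) : X.mob z = (X.a * z + X.b) / X.den z := rfl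

theorem det_eq' (X : SU11) : X.a * conj X.a - X.b * conj X.b = 1 := by
  rw [Complex.mul_conj, Complex.mul_conj]
  exact_mod_cast X.det_eq

theorem den_ne_zero (X : SU11) {z : ℂ} (hz : ‖z‖ ≤ 1) : X.den z ≠ 0 := by
  intro h
  have h1 : ‖X.a‖ ≤ ‖X.b‖ := by
    have h2 : conj X.a = -(conj X.b * z) := by
      unfold den at h
      linear_combination h
    calc ‖X.a‖ = ‖conj X.a‖ := (Complex.norm_conj _).symm
      _ = ‖X.b‖ * ‖z‖ := by rw [h2, norm_neg, norm_mul, Complex.norm_conj]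
      _ ≤ ‖X.b‖ := mul_le_of_le_one_right (norm_nonneg _) hz
  have h3 := X.det_eq
  rw [Complex.normSq_eq_norm_sq, Complex.normSq_eq_norm_sq] at h3
  nlinarith [norm_nonneg X.a, norm_nonneg X.b]

/-- SU(1,1) preserves the Hermitian form on homogeneous coordinates; passing to affine coordinates
divides by the two denominators. All invariance statements below come from this identity. -/
theorem hermForm_mob (X : SU11) {z w : ℂ} (hz : ‖z‖ ≤ 1) (hw : ‖w‖ ≤ 1) :
    hermForm (X.mob z) (X.mob w) = hermForm z w / (X.den z * conj (X.den w)) := by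
  have h1 := X.den_ne_zero hz
  have h2 : conj (X.den w) ≠ 0 := by simpa using X.den_ne_zero hw
  have h3 := X.det_eq'
  rw [hermForm, mob_eq, mob_eq, map_div₀, div_mul_div_comm, hermForm, eq_div_iff (mul_ne_zero h1 h2),
    sub_mul, div_mul_cancel₀ _ (mul_ne_zero h1 h2)]
  simp only [den, map_add, map_mul, Complex.conj_conj]
  linear_combination (z * conj w - 1) * h3

theorem one_sub_normSq_mob (X : SU11) {z : ℂ} (hz : ‖z‖ ≤ 1) :
    1 - Complex.normSq (X.mob z) = (1 - Complex.normSq z) / Complex.normSq (X.den z) := by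
  have h := X.hermForm_mob hz hz
  rw [hermForm, hermForm, Complex.mul_conj, Complex.mul_conj, Complex.mul_conj] at h
  have h' : Complex.normSq (X.mob z) - 1
      = (Complex.normSq z - 1) / Complex.normSq (X.den z) := by exact_mod_cast h
  rw [← neg_sub, h', ← neg_div, neg_sub]

theorem norm_mob_lt_one (X : SU11) {z : ℂ} (hz : ‖z‖ < 1) : ‖X.mob z‖ < 1 := by
  have h := X.one_sub_normSq_mob hz.le
  have h1 : 0 < Complex.normSq (X.den z) := Complex.normSq_pos.2 (X.den_ne_zero hz.le)
  have h2 : 0 < 1 - Complex.normSq z := by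
    rw [Complex.normSq_eq_norm_sq]
    nlinarith [norm_nonneg z]
  have h3 := div_pos h2 h1
  rw [← h, Complex.normSq_eq_norm_sq] at h3
  nlinarith [norm_nonneg (X.mob z)]

theorem mob_mul (X Y : SU11) {z : ℂ} (hz : ‖z‖ ≤ 1) : (X * Y).mob z = X.mob (Y.mob z) := by
  have h1 := Y.den_ne_zero hz
  rw [mob_eq Y, mob, mob]
  have e1 : X.a * ((Y.a * z + Y.b) / Y.den z) + X.b
      = ((X * Y).a * z + (X * Y).b) / Y.den z := by
    rw [eq_div_iff h1, add_mul, mul_assoc, div_mul_cancel₀ _ h1, mul_a, mul_b, den]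
    ring
  have e2 : conj X.b * ((Y.a * z + Y.b) / Y.den z) + conj X.a
      = (conj (X * Y).b * z + conj (X * Y).a) / Y.den z := by
    rw [eq_div_iff h1, add_mul, mul_assoc, div_mul_cancel₀ _ h1, mul_a, mul_b, den]
    simp only [map_add, map_mul, Complex.conj_conj]
    ring
  rw [e1, e2, div_div_div_cancel_right₀ h1]

@[simp] theorem one_mob (z : ℂ) : (1 : SU11).mob z = z := by
  simp [mob, one_a, one_b]

theorem coe_onCircle (X : SU11) (x : Circle) : (X.onCircle x : ℂ) = X.mob x := rfl

theorem norm_coe_le (x : Circle) : ‖(x : ℂ)‖ ≤ 1 := (Circle.norm_coe x).le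

theorem onCircle_mul (X Y : SU11) (x : Circle) :
    (X * Y).onCircle x = X.onCircle (Y.onCircle x) :=
  Circle.ext (X.mob_mul Y (norm_coe_le x))

@[simp] theorem one_onCircle (x : Circle) : (1 : SU11).onCircle x = x :=
  Circle.ext (one_mob _)

@[simp] theorem inv_onCircle_onCircle (X : SU11) (x : Circle) :
    X⁻¹.onCircle (X.onCircle x) = x := by
  rw [← onCircle_mul, inv_mul_cancel, one_onCircle]

@[simp] theorem onCircle_inv_onCircle (X : SU11) (x : Circle) :
    X.onCircle (X⁻¹.onCircle x) = x := by
  rw [← onCircle_mul, mul_inv_cancel, one_onCircle]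

theorem inv_mob_mob (X : SU11) {z : ℂ} (hz : ‖z‖ ≤ 1) : X⁻¹.mob (X.mob z) = z := by
  rw [← mob_mul _ _ hz, inv_mul_cancel, one_mob]

theorem mob_inv_mob (X : SU11) {z : ℂ} (hz : ‖z‖ ≤ 1) : X.mob (X⁻¹.mob z) = z := by
  rw [← mob_mul _ _ hz, mul_inv_cancel, one_mob]

theorem onCircle_injective (X : SU11) : Function.Injective X.onCircle :=
  Function.LeftInverse.injective X.inv_onCircle_onCircle

theorem onCircle_inj (X : SU11) {x y : Circle} : X.onCircle x = X.onCircle y ↔ x = y :=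
  X.onCircle_injective.eq_iff

theorem continuous_onCircle (X : SU11) : Continuous X.onCircle := by
  refine Continuous.subtype_mk ?_ _
  refine Continuous.div (by fun_prop) (by fun_prop) fun x => X.den_ne_zero (norm_coe_le x)

theorem continuousOn_mob (X : SU11) : ContinuousOn X.mob {z | ‖z‖ ≤ 1} :=
  ContinuousOn.div (by fun_prop) (by fun_prop) fun _ hz => X.den_ne_zero hz

theorem eq_zero_of_actsTrivially {X : SU11} (h : X.ActsTrivially) : X.b = 0 ∧ conj X.a = X.a := by
  have h0 := h 0 (by simp)
  have hd : conj X.a ≠ 0 := by simpa [den] using X.den_ne_zero (z := 0) (by simp)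
  have hb : X.b = 0 := by simpa [mob, hd] using h0
  have h1 := h (1 / 2) (by norm_num)
  rw [mob, hb, map_zero, zero_mul, zero_add, add_zero, div_eq_iff hd] at h1
  exact ⟨hb, by linear_combination -2 * h1⟩

theorem ActsTrivially.onCircle {X : SU11} (h : X.ActsTrivially) (x : Circle) :
    X.onCircle x = x := by
  obtain ⟨hb, ha⟩ := eq_zero_of_actsTrivially h
  have hd : conj X.a ≠ 0 := by simpa [den] using X.den_ne_zero (z := 0) (by simp)
  apply Circle.ext
  rw [coe_onCircle, mob, hb, map_zero, zero_mul, zero_add, add_zero, ha, mul_div_cancel_left₀]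
  rwa [ha] at hd

/-- A Moebius transformation with three fixed points on the circle is the identity. -/
theorem onCircle_eq_self_of_three {X : SU11} {x y z : Circle} (hx : X.onCircle x = x)
    (hy : X.onCircle y = y) (hz : X.onCircle z = z) (hxy : x ≠ y) (hxz : x ≠ z) (hyz : y ≠ z)
    (w : Circle) : X.onCircle w = w := by
  -- Fixed points are roots of a polynomial of degree at most two; three distinct roots make all its
  -- coefficients vanish.
  have key : ∀ t : Circle, X.onCircle t = t →
      conj X.b * (t : ℂ) ^ 2 + (conj X.a - X.a) * t - X.b = 0 := by
    intro t ht
    have h := congrArg (fun s : Circle => (s : ℂ)) ht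
    simp only [coe_onCircle] at h
    rw [mob_eq, div_eq_iff (X.den_ne_zero (norm_coe_le t)), den] at h
    linear_combination -h
  have h1 := key x hx
  have h2 := key y hy
  have h3 := key z hz
  have nxy : (x : ℂ) - y ≠ 0 := sub_ne_zero.2 fun h => hxy (Circle.ext h)
  have nxz : (x : ℂ) - z ≠ 0 := sub_ne_zero.2 fun h => hxz (Circle.ext h)
  have nyz : (y : ℂ) - z ≠ 0 := sub_ne_zero.2 fun h => hyz (Circle.ext h)
  have e1 : conj X.b * ((x : ℂ) + y) + (conj X.a - X.a) = 0 :=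
    mul_left_cancel₀ nxy (by linear_combination h1 - h2)
  have e2 : conj X.b * ((x : ℂ) + z) + (conj X.a - X.a) = 0 :=
    mul_left_cancel₀ nxz (by linear_combination h1 - h3)
  have e3 : conj X.b = 0 := mul_left_cancel₀ nyz (by linear_combination e1 - e2)
  have e4 : X.b = 0 := by simpa using e3
  have e5 : conj X.a = X.a := by linear_combination e1 - ((x : ℂ) + y) * e3
  apply Circle.ext
  rw [coe_onCircle, mob_eq, div_eq_iff (X.den_ne_zero (norm_coe_le w)), den, e3, e4, e5]
  ring

end SU11

-- In the triple product every point occurs once in each slot of the form, so under a Möbius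
-- transformation the denominators combine to positive real factors and the sign of the imaginary
-- part is invariant.
open ComplexConjugate in
theorem geodesicSide_eq_hermForm (x y : Circle) (z : ℂ) :
    geodesicSide x y z = (hermForm x z * hermForm z y * hermForm y x).im := by
  have hx := Circle.normSq_coe x
  have hy := Circle.normSq_coe y
  rw [geodesicSide, ← Complex.normSq_eq_norm_sq]
  have hx' : (x : ℂ) * conj (x : ℂ) = 1 := by rw [Complex.mul_conj, hx]; simp
  have hy' : (y : ℂ) * conj (y : ℂ) = 1 := by rw [Complex.mul_conj, hy]; simp
  have hz' : z * conj z = (Complex.normSq z : ℂ) := Complex.mul_conj z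
  have e : hermForm x z * hermForm z y * hermForm y x
      = Complex.normSq z - conj z * y - z * conj (x : ℂ) + y * conj (x : ℂ)
        - x * conj (y : ℂ) * Complex.normSq z + x * conj z + z * conj (y : ℂ) - 1 := by
    rw [← hz']
    simp only [hermForm]
    linear_combination (z * conj z * y * conj (y : ℂ) - conj z * y) * hx'
      + (z * conj z - z * conj (x : ℂ)) * hy'
  rw [e]
  simp only [Complex.sub_im, Complex.add_im, Complex.mul_im, Complex.mul_re, Complex.conj_re,
    Complex.conj_im, Complex.ofReal_re, Complex.ofReal_im, Complex.one_im, Complex.sub_re]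
  ring

/-- Cyclic order on the circle is the boundary case of being to the left of a geodesic, so one
invariance statement serves both. -/
theorem ccw_iff_geodesicSide_pos (x y z : Circle) : Ccw x y z ↔ 0 < geodesicSide x y z := by
  have hx := Circle.normSq_coe x
  have h : geodesicSide x y z = 2 * ((starRingEnd ℂ) ((y : ℂ) - x) * ((z : ℂ) - x)).im := by
    rw [Complex.normSq_apply] at hx
    rw [geodesicSide, Circle.norm_coe]
    simp only [Complex.sub_im, Complex.mul_im, Complex.conj_re, map_sub,
      Complex.conj_im, Complex.sub_re]
    ring
  rw [h, Ccw]
  constructor <;> intro h <;> linarith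

theorem SU11.geodesicSide_mob (X : SU11) (x y : Circle) {z : ℂ} (hz : ‖z‖ ≤ 1) :
    geodesicSide (X.onCircle x) (X.onCircle y) (X.mob z) = geodesicSide x y z /
      (Complex.normSq (X.den x) * Complex.normSq (X.den y) * Complex.normSq (X.den z)) := by
  rw [geodesicSide_eq_hermForm, geodesicSide_eq_hermForm, ← Complex.div_ofReal_im]
  congr 1
  rw [coe_onCircle, coe_onCircle, X.hermForm_mob (norm_coe_le x) hz,
    X.hermForm_mob hz (norm_coe_le y), X.hermForm_mob (norm_coe_le y) (norm_coe_le x)]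
  rw [div_mul_div_comm, div_mul_div_comm]
  congr 1
  push_cast
  rw [← Complex.mul_conj, ← Complex.mul_conj, ← Complex.mul_conj]
  ring

theorem SU11.exists_pos_geodesicSide_mob (X : SU11) (x y : Circle) {z : ℂ} (hz : ‖z‖ ≤ 1) :
    ∃ c : ℝ, 0 < c ∧ geodesicSide (X.onCircle x) (X.onCircle y) (X.mob z)
      = c * geodesicSide x y z := by
  refine ⟨_, ?_, (X.geodesicSide_mob x y hz).trans (div_eq_inv_mul _ _)⟩
  have h1 := Complex.normSq_pos.2 (X.den_ne_zero (norm_coe_le x))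
  have h2 := Complex.normSq_pos.2 (X.den_ne_zero (norm_coe_le y))
  have h3 := Complex.normSq_pos.2 (X.den_ne_zero hz)
  positivity

theorem SU11.geodesicSide_mob_pos (X : SU11) (x y : Circle) {z : ℂ} (hz : ‖z‖ ≤ 1) :
    0 < geodesicSide (X.onCircle x) (X.onCircle y) (X.mob z) ↔ 0 < geodesicSide x y z := by
  obtain ⟨c, hc, h⟩ := X.exists_pos_geodesicSide_mob x y hz
  rw [h, mul_pos_iff_of_pos_left hc]

theorem SU11.geodesicSide_mob_eq_zero (X : SU11) (x y : Circle) {z : ℂ} (hz : ‖z‖ ≤ 1) :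
    geodesicSide (X.onCircle x) (X.onCircle y) (X.mob z) = 0 ↔ geodesicSide x y z = 0 := by
  obtain ⟨c, hc, h⟩ := X.exists_pos_geodesicSide_mob x y hz
  rw [h, mul_eq_zero, or_iff_right hc.ne']

theorem SU11.ccw_onCircle (X : SU11) (x y z : Circle) :
    Ccw (X.onCircle x) (X.onCircle y) (X.onCircle z) ↔ Ccw x y z := by
  rw [ccw_iff_geodesicSide_pos, ccw_iff_geodesicSide_pos, coe_onCircle,
    X.geodesicSide_mob_pos x y (norm_coe_le z)]

theorem SU11.onCircle_mem_arcCC (X : SU11) {x y z : Circle} :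
    X.onCircle z ∈ arcCC (X.onCircle x) (X.onCircle y) ↔ z ∈ arcCC x y := by
  simp only [arcCC, mem_ofPred_eq, X.onCircle_inj, X.ccw_onCircle]

theorem SU11.onCircle_mem_arcCO (X : SU11) {x y z : Circle} :
    X.onCircle z ∈ arcCO (X.onCircle x) (X.onCircle y) ↔ z ∈ arcCO x y := by
  simp only [arcCO, mem_ofPred_eq, ne_eq, X.onCircle_inj, X.onCircle_mem_arcCC]

/-! ### Arcs of the circle as intervals of real arguments -/

/-- The factorization into sines turns the sign of the orientation into inequalities between real
arguments, since each half-difference stays within [-π, π]. -/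
theorem geodesicSide_exp (a b c : ℝ) :
    geodesicSide (Circle.exp a) (Circle.exp b) (Circle.exp c)
      = 8 * (Real.sin ((b - a) / 2) * Real.sin ((c - b) / 2) * Real.sin ((c - a) / 2)) := by
  have h1 : geodesicSide (Circle.exp a) (Circle.exp b) (Circle.exp c)
      = 2 * Real.sin (b - a) + 2 * Real.sin (c - b) - 2 * Real.sin (c - a) := by
    rw [geodesicSide, Circle.norm_coe, Real.sin_sub, Real.sin_sub, Real.sin_sub]
    simp only [Circle.coe_exp, Complex.sub_im, Complex.mul_im, Complex.conj_re,
      Complex.conj_im, Complex.sub_re, Complex.exp_ofReal_mul_I_re, Complex.exp_ofReal_mul_I_im]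
    ring
  have e1 : b - a = 2 * ((b - a) / 2) := by ring
  have e2 : c - b = 2 * ((c - b) / 2) := by ring
  have e3 : c - a = 2 * ((b - a) / 2 + (c - b) / 2) := by ring
  have e4 : (c - a) / 2 = (b - a) / 2 + (c - b) / 2 := by ring
  rw [h1, e4, e3]
  conv_lhs => rw [e1, e2]
  generalize (b - a) / 2 = x
  generalize (c - b) / 2 = y
  rw [show (2 * (2 * x / 2 + 2 * y / 2)) = 2 * (x + y) by ring, Real.sin_two_mul, Real.sin_two_mul,
    Real.sin_two_mul, Real.sin_add, Real.cos_add]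
  linear_combination -4 * Real.sin x * Real.cos x * Real.sin_sq_add_cos_sq y
    - 4 * Real.sin y * Real.cos y * Real.sin_sq_add_cos_sq x

theorem ccw_exp {a b c : ℝ} (hab : a < b) (hbc : b < c) (hca : c < a + 2 * Real.pi) :
    Ccw (Circle.exp a) (Circle.exp b) (Circle.exp c) := by
  rw [ccw_iff_geodesicSide_pos, geodesicSide_exp]
  have h1 := Real.sin_pos_of_pos_of_lt_pi (x := (b - a) / 2) (by linarith) (by linarith)
  have h2 := Real.sin_pos_of_pos_of_lt_pi (x := (c - b) / 2) (by linarith) (by linarith)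
  have h3 := Real.sin_pos_of_pos_of_lt_pi (x := (c - a) / 2) (by linarith) (by linarith)
  positivity

/-- The argument of a point of the circle that lies in `[a, a + 2π)`. -/
noncomputable def lift (a : ℝ) (x : Circle) : ℝ := toIcoMod Real.two_pi_pos a (Complex.arg x)

@[simp] theorem exp_lift (a : ℝ) (x : Circle) : Circle.exp (lift a x) = x := by
  conv_rhs => rw [← Circle.exp_arg x]
  rw [Circle.exp_eq_exp]
  refine ⟨-toIcoDiv Real.two_pi_pos a (Complex.arg x), ?_⟩
  rw [lift, toIcoMod, zsmul_eq_mul]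
  push_cast
  ring

theorem le_lift (a : ℝ) (x : Circle) : a ≤ lift a x := left_le_toIcoMod _ _ _

theorem lift_lt (a : ℝ) (x : Circle) : lift a x < a + 2 * Real.pi := toIcoMod_lt_right _ _ _

/-- Two real numbers at distance less than `2π` with the same exponential are equal. -/
theorem eq_of_exp_eq {t u c : ℝ} (h : Circle.exp t = Circle.exp u) (ht : c ≤ t)
    (htc : t < c + 2 * Real.pi) (hu : c ≤ u) (huc : u < c + 2 * Real.pi) : t = u :=
  Circle.exp_injOn_Ico (a := c) (b := c + 2 * Real.pi) (by linarith) ⟨ht, htc⟩ ⟨hu, huc⟩ h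

theorem lift_exp {a t : ℝ} (h : a ≤ t) (h' : t < a + 2 * Real.pi) : lift a (Circle.exp t) = t :=
  eq_of_exp_eq (c := a) (exp_lift _ _) (le_lift _ _) (lift_lt _ _) h h'

theorem lift_add_two_pi (a : ℝ) (x : Circle) :
    lift (a + 2 * Real.pi) x = lift a x + 2 * Real.pi := by
  refine eq_of_exp_eq (c := a + 2 * Real.pi) ?_ (le_lift _ _) (lift_lt _ _) ?_ ?_
  · rw [Circle.exp_add_two_pi, exp_lift, exp_lift]
  · linarith [le_lift a x]
  · linarith [lift_lt a x]

theorem ccw_exp_iff {a b c : ℝ} (hac : a ≤ c) (hca : c < a + 2 * Real.pi) (hab : a ≤ b)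
    (hba : b < a + 2 * Real.pi) :
    Ccw (Circle.exp a) (Circle.exp b) (Circle.exp c) ↔ a < b ∧ b < c := by
  refine ⟨fun h => ?_, fun h => ccw_exp h.1 h.2 hca⟩
  rw [ccw_iff_geodesicSide_pos, geodesicSide_exp] at h
  have h1 : 0 ≤ Real.sin ((b - a) / 2) :=
    Real.sin_nonneg_of_nonneg_of_le_pi (by linarith) (by linarith)
  have h3 : 0 ≤ Real.sin ((c - a) / 2) :=
    Real.sin_nonneg_of_nonneg_of_le_pi (by linarith) (by linarith)
  constructor
  · refine lt_of_le_of_ne hab ?_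
    rintro rfl
    simp at h
  · by_contra hbc
    have h2 : Real.sin ((c - b) / 2) ≤ 0 :=
      Real.sin_nonpos_of_nonpos_of_neg_pi_le (by linarith) (by linarith)
    have := mul_nonneg h1 h3
    nlinarith [mul_nonpos_of_nonneg_of_nonpos this h2]

theorem mem_arcCC_iff_lift {a b : ℝ} (hab : a ≤ b) (hba : b < a + 2 * Real.pi) {z : Circle} :
    z ∈ arcCC (Circle.exp a) (Circle.exp b) ↔ lift a z ≤ b := by
  have h1 := le_lift a z
  have h2 := lift_lt a z
  have h3 := exp_lift a z
  generalize lift a z = t at *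
  subst h3
  simp only [arcCC, mem_ofPred_eq]
  rw [ccw_exp_iff hab hba h1 h2]
  constructor
  · rintro (h | h | h)
    · rw [eq_of_exp_eq (c := a) h h1 h2 le_rfl (by linarith [Real.pi_pos])]
      exact hab
    · rw [eq_of_exp_eq (c := a) h h1 h2 hab hba]
    · exact h.2.le
  · intro h
    rcases h1.eq_or_lt with rfl | h1
    · exact Or.inl rfl
    rcases h.eq_or_lt with rfl | h
    · exact Or.inr (Or.inl rfl)
    exact Or.inr (Or.inr ⟨h1, h⟩)

theorem mem_arcCO_iff_lift {a b : ℝ} (hab : a ≤ b) (hba : b < a + 2 * Real.pi) {z : Circle} :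
    z ∈ arcCO (Circle.exp a) (Circle.exp b) ↔ lift a z < b := by
  rw [arcCO, mem_ofPred_eq, mem_arcCC_iff_lift hab hba, lt_iff_le_and_ne]
  refine and_congr_right fun _ => not_congr ⟨?_, ?_⟩
  · rintro rfl
    exact lift_exp hab hba
  · intro h
    rw [← h, exp_lift]

/-- Membership in a half-open arc, all points being measured in the window `[c, c + 2π]`. -/
theorem exp_mem_arcCO_iff {a b c t : ℝ} (hca : c ≤ a) (hab : a ≤ b) (hbc : b ≤ c + 2 * Real.pi)
    (hba : b < a + 2 * Real.pi) (hct : c ≤ t) (htc : t < c + 2 * Real.pi) :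
    Circle.exp t ∈ arcCO (Circle.exp a) (Circle.exp b) ↔ a ≤ t ∧ t < b := by
  rw [mem_arcCO_iff_lift hab hba]
  rcases le_or_gt a t with h | h
  · rw [lift_exp h (by linarith)]
    simp [h]
  · rw [← Circle.exp_add_two_pi, lift_exp (by linarith) (by linarith)]
    exact ⟨fun h' => by linarith, fun h' => by linarith [h'.1]⟩

theorem exp_mem_arcCO {a b t : ℝ} (hba : b < a + 2 * Real.pi) (hat : a ≤ t) (htb : t < b) :
    Circle.exp t ∈ arcCO (Circle.exp a) (Circle.exp b) := by
  rw [mem_arcCO_iff_lift (by linarith) hba, lift_exp hat (by linarith)]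
  exact htb

theorem exp_mem_arcCC {a b t : ℝ} (hba : b < a + 2 * Real.pi) (hat : a ≤ t) (htb : t ≤ b) :
    Circle.exp t ∈ arcCC (Circle.exp a) (Circle.exp b) := by
  rw [mem_arcCC_iff_lift (by linarith) hba, lift_exp hat (by linarith)]
  exact htb

theorem arcCC_exp {a b : ℝ} (hab : a ≤ b) (hba : b < a + 2 * Real.pi) :
    arcCC (Circle.exp a) (Circle.exp b) = Circle.exp '' Icc a b := by
  ext z
  constructor
  · intro h
    exact ⟨lift a z, ⟨le_lift a z, (mem_arcCC_iff_lift hab hba).1 h⟩, exp_lift a z⟩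
  · rintro ⟨t, ht, rfl⟩
    exact exp_mem_arcCC hba ht.1 ht.2

theorem arcCO_exp {a b : ℝ} (hab : a ≤ b) (hba : b < a + 2 * Real.pi) :
    arcCO (Circle.exp a) (Circle.exp b) = Circle.exp '' Ico a b := by
  ext z
  constructor
  · intro h
    exact ⟨lift a z, ⟨le_lift a z, (mem_arcCO_iff_lift hab hba).1 h⟩, exp_lift a z⟩
  · rintro ⟨t, ht, rfl⟩
    exact exp_mem_arcCO hba ht.1 ht.2

theorem left_mem_arcCC (x y : Circle) : x ∈ arcCC x y := Or.inl rfl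

theorem right_mem_arcCC (x y : Circle) : y ∈ arcCC x y := Or.inr (Or.inl rfl)

theorem arcCO_subset_arcCC (x y : Circle) : arcCO x y ⊆ arcCC x y := fun _ h => h.1

theorem left_mem_arcCO {x y : Circle} (h : x ≠ y) : x ∈ arcCO x y := ⟨left_mem_arcCC x y, h⟩

theorem mem_arcCC_iff_eq_or {x y z : Circle} : z ∈ arcCC x y ↔ z = y ∨ z ∈ arcCO x y := by
  by_cases h : z = y
  · simp [h, right_mem_arcCC]
  · simp [h, arcCO]

theorem exists_exp_of_arcCC (x y : Circle) :
    ∃ a b : ℝ, a ≤ b ∧ b < a + 2 * Real.pi ∧ Circle.exp a = x ∧ Circle.exp b = y :=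
  ⟨Complex.arg x, lift (Complex.arg x) y, le_lift _ _, lift_lt _ _, Circle.exp_arg x, exp_lift _ _⟩

theorem isClosed_arcCC (x y : Circle) : IsClosed (arcCC x y) := by
  obtain ⟨a, b, hab, hba, rfl, rfl⟩ := exists_exp_of_arcCC x y
  rw [arcCC_exp hab hba]
  exact (isCompact_Icc.image (by fun_prop)).isClosed

theorem closure_arcCO {x y : Circle} (h : x ≠ y) : closure (arcCO x y) = arcCC x y := by
  refine ((isClosed_arcCC x y).closure_subset_iff.2 (arcCO_subset_arcCC x y)).antisymm ?_
  obtain ⟨a, b, hab, hba, rfl, rfl⟩ := exists_exp_of_arcCC x y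
  have hne : a ≠ b := fun h' => h (by rw [h'])
  rw [arcCC_exp hab hba, arcCO_exp hab hba, ← closure_Ico hne]
  exact image_closure_subset_closure_image (by fun_prop)

theorem arcCO_self (x : Circle) : arcCO x x = ∅ := by
  ext z
  simp only [arcCO, arcCC, Ccw, mem_ofPred_eq]
  simp

/-! ### Real lifts of cyclic families of points -/

/-- `x` is a real lift of the cyclic family `X`. -/
structure IsCyclicLift {N : ℕ} (X : ZMod N → Circle) (x : ℤ → ℝ) : Prop where
  exp_eq : ∀ s : ℤ, Circle.exp (x s) = X s
  add_period : ∀ s : ℤ, x (s + N) = x s + 2 * Real.pi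

namespace IsCyclicLift

variable {N : ℕ} {X : ZMod N → Circle} {x : ℤ → ℝ}

theorem add_mul_period (h : IsCyclicLift X x) (s k : ℤ) :
    x (s + k * N) = x s + k * (2 * Real.pi) := by
  induction k using Int.induction_on with
  | zero => simp
  | succ k ih =>
    rw [show s + ((k : ℤ) + 1) * N = (s + k * N) + N by ring, h.add_period, ih]
    push_cast
    ring
  | pred k ih =>
    have := h.add_period (s + (-(k : ℤ) - 1) * N)
    rw [show s + (-(k : ℤ) - 1) * N + N = s + (-(k : ℤ)) * N by ring, ih] at this
    push_cast at this ⊢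
    linarith

theorem exists_mem_Ico (h : IsCyclicLift X x) (hx : Monotone x) (t : ℝ) :
    ∃ s : ℤ, x s ≤ t ∧ t < x (s + 1) := by
  have hub : ∃ k : ℤ, t < x (0 + k * N) := by
    obtain ⟨k, hk⟩ := exists_int_gt ((t - x 0) / (2 * Real.pi))
    refine ⟨k, ?_⟩
    rw [h.add_mul_period]
    rw [div_lt_iff₀ Real.two_pi_pos] at hk
    linarith
  have hlb : ∃ k : ℤ, x (0 + k * N) ≤ t := by
    obtain ⟨k, hk⟩ := exists_int_lt ((t - x 0) / (2 * Real.pi))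
    refine ⟨k, ?_⟩
    rw [h.add_mul_period]
    rw [lt_div_iff₀ Real.two_pi_pos] at hk
    linarith
  obtain ⟨k, hk⟩ := hub
  obtain ⟨l, hl⟩ := hlb
  obtain ⟨s, hs, hmax⟩ := Int.exists_greatest_of_bdd (P := fun s => x s ≤ t)
    ⟨0 + k * N, fun z hz => not_lt.1 fun hlt => by linarith [hx hlt.le]⟩ ⟨_, hl⟩
  refine ⟨s, hs, not_le.1 fun hle => ?_⟩
  have := hmax _ hle
  omega

theorem exists_mem_Ico_exp (h : IsCyclicLift X x) (hx : Monotone x) (w : Circle) :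
    ∃ (s : ℤ) (t : ℝ), Circle.exp t = w ∧ x s ≤ t ∧ t < x (s + 1) := by
  obtain ⟨s, hs⟩ := h.exists_mem_Ico hx (lift 0 w)
  exact ⟨s, _, exp_lift 0 w, hs⟩

theorem exists_mem_arcCO (h : IsCyclicLift X x) (hx : Monotone x)
    (hgap : ∀ s, x (s + 1) < x s + 2 * Real.pi) (w : Circle) :
    ∃ i : ZMod N, w ∈ arcCO (X i) (X (i + 1)) := by
  obtain ⟨s, t, rfl, h1, h2⟩ := h.exists_mem_Ico_exp hx w
  refine ⟨s, ?_⟩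
  have := exp_mem_arcCO (hgap s) h1 h2
  rw [h.exp_eq, h.exp_eq] at this
  exact_mod_cast this

theorem exists_lift_of_mem_arcCO (h : IsCyclicLift X x) (hx : Monotone x)
    (hgap : ∀ s, x (s + 1) < x s + 2 * Real.pi) {w : Circle} {s : ℤ}
    (hw : w ∈ arcCO (X s) (X (s + 1))) : ∃ t, Circle.exp t = w ∧ x s ≤ t ∧ t < x (s + 1) := by
  have e : X ((s : ZMod N) + 1) = Circle.exp (x (s + 1)) := by
    rw [h.exp_eq]
    push_cast
    rfl
  rw [e, ← h.exp_eq, arcCO_exp (hx (by omega)) (hgap s)] at hw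
  obtain ⟨t, ht, rfl⟩ := hw
  exact ⟨t, rfl, ht.1, ht.2⟩

/-- The intervals [x s, x (s+1)) are disjoint on the line; two lifts of `w` differ by k full turns,
and shifting by k periods identifies the two intervals up to a multiple of `N`. -/
theorem eq_of_mem_arcCO (h : IsCyclicLift X x) (hx : Monotone x)
    (hgap : ∀ s, x (s + 1) < x s + 2 * Real.pi) {w : Circle} {i j : ZMod N}
    (hi : w ∈ arcCO (X i) (X (i + 1))) (hj : w ∈ arcCO (X j) (X (j + 1))) : i = j := by
  obtain ⟨s, rfl⟩ := ZMod.intCast_surjective i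
  obtain ⟨r, rfl⟩ := ZMod.intCast_surjective j
  obtain ⟨t, rfl, h1, h2⟩ := h.exists_lift_of_mem_arcCO hx hgap hi
  obtain ⟨u, hu, h3, h4⟩ := h.exists_lift_of_mem_arcCO hx hgap hj
  obtain ⟨k, rfl⟩ := Circle.exp_eq_exp.1 hu
  have h5 := h.add_mul_period s k
  have h6 := h.add_mul_period (s + 1) k
  have h7 : r = s + k * N := by
    apply le_antisymm
    · by_contra hlt
      have := hx (show s + 1 + k * N ≤ r by omega)
      linarith
    · by_contra hlt
      have := hx (show r + 1 ≤ s + k * N by omega)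
      linarith
  rw [h7]
  simp

end IsCyclicLift

namespace SurfacePolygon

variable {g : ℕ}

theorem interlace_two_mul (P Q : SideIndex g → Circle) (k : ℕ) :
    interlace P Q (2 * k) = P (k : SideIndex g) := by
  simp [interlace]

theorem interlace_two_mul_add_one (P Q : SideIndex g → Circle) (k : ℕ) :
    interlace P Q (2 * k + 1) = Q (k : SideIndex g) := by
  have h : (2 * k + 1) / 2 = k := by omega
  simp [interlace, h]

/-- A real lift of a cyclic family, cut at the argument of `M.P 0`. -/
noncomputable def cutLift (M : SurfacePolygon g) (X : SideIndex g → Circle) (s : ℤ) : ℝ :=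
  lift (Complex.arg (M.P 0) + (s / (8 * g - 4 : ℕ) : ℤ) * (2 * Real.pi)) (X s)

theorem isCyclicLift_cutLift (hg : 2 ≤ g) (M : SurfacePolygon g) (X : SideIndex g → Circle) :
    IsCyclicLift X (M.cutLift X) where
  exp_eq s := exp_lift _ _
  add_period s := by
    have h : (s + (8 * g - 4 : ℕ)) / ((8 * g - 4 : ℕ) : ℤ) = s / ((8 * g - 4 : ℕ) : ℤ) + 1 :=
      Int.add_ediv_of_dvd_right (dvd_refl _) |>.trans
        (by rw [Int.ediv_self (by omega)])
    rw [cutLift, cutLift, h, ← lift_add_two_pi]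
    congr 1
    · push_cast
      ring
    · simp

theorem cutLift_natCast (M : SurfacePolygon g) (X : SideIndex g → Circle) {k : ℕ}
    (hk : k < 8 * g - 4) : M.cutLift X k = lift (Complex.arg (M.P 0)) (X k) := by
  have h : ((k : ℤ) / (8 * g - 4 : ℕ) : ℤ) = 0 :=
    Int.ediv_eq_zero_of_lt (by omega) (by exact_mod_cast hk)
  simp [cutLift, h]

theorem lift_lt_lift_of_ccw {x y z : Circle} (h : Ccw x y z) :
    Complex.arg x < lift (Complex.arg x) y ∧
      lift (Complex.arg x) y < lift (Complex.arg x) z := by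
  have hx := Circle.exp_arg x
  generalize Complex.arg (x : ℂ) = a at *
  subst hx
  rw [← exp_lift a y, ← exp_lift a z,
    ccw_exp_iff (le_lift _ _) (lift_lt _ _) (le_lift _ _) (lift_lt _ _)] at h
  simpa using h

theorem cutLift_step (hg : 2 ≤ g) (M : SurfacePolygon g) (s : ℤ) :
    M.cutLift M.P s < M.cutLift M.Q s ∧ M.cutLift M.Q s < M.cutLift M.P (s + 1) := by
  have hN : 0 < ((8 * g - 4 : ℕ) : ℤ) := by omega
  have hP := isCyclicLift_cutLift hg M M.P
  have hQ := isCyclicLift_cutLift hg M M.Q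
  suffices h : ∀ k : ℕ, k < 8 * g - 4 → M.cutLift M.P k < M.cutLift M.Q k ∧
      M.cutLift M.Q k < M.cutLift M.P (k + 1) by
    have h1 := Int.emod_nonneg s hN.ne'
    have h2 := Int.emod_lt_of_pos s hN
    have h3 := Int.emod_add_ediv_mul s ((8 * g - 4 : ℕ) : ℤ)
    obtain ⟨k, hk⟩ := Int.eq_ofNat_of_zero_le h1
    obtain ⟨h4, h5⟩ := h k (by omega)
    rw [← h3, show s % ((8 * g - 4 : ℕ) : ℤ) + s / ((8 * g - 4 : ℕ) : ℤ) * ((8 * g - 4 : ℕ) : ℤ) + 1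
      = (s % ((8 * g - 4 : ℕ) : ℤ) + 1) + s / ((8 * g - 4 : ℕ) : ℤ) * ((8 * g - 4 : ℕ) : ℤ) by ring,
      hk, hP.add_mul_period, hQ.add_mul_period, hP.add_mul_period]
    exact ⟨by linarith, by linarith⟩
  intro k hk
  rw [cutLift_natCast _ _ hk, cutLift_natCast _ _ hk]
  have ord := fun a b (h1 : 0 < a) (h2 : a < b) hb => M.order 0 a b h1 h2 hb
  have e0 : interlace M.P M.Q 0 = M.P 0 := by simpa using interlace_two_mul M.P M.Q 0
  simp only [e0] at ord
  constructor
  · rcases Nat.eq_zero_or_pos k with rfl | hk0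
    · have h := lift_lt_lift_of_ccw (ord (2 * 0 + 1) (2 * 1) (by omega) (by omega) (by omega))
      rw [interlace_two_mul_add_one, interlace_two_mul] at h
      rw [Nat.cast_zero] at h ⊢
      have e := lift_exp (a := Complex.arg (M.P 0)) le_rfl (by linarith [Real.pi_pos])
      rw [Circle.exp_arg] at e
      rw [e]
      exact h.1
    · have h := lift_lt_lift_of_ccw (ord (2 * k) (2 * k + 1) (by omega) (by omega) (by omega))
      rw [interlace_two_mul_add_one, interlace_two_mul] at h
      exact h.2
  · rcases Nat.lt_or_ge (k + 1) (8 * g - 4) with hk1 | hk1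
    · have h := lift_lt_lift_of_ccw (ord (2 * k + 1) (2 * (k + 1)) (by omega) (by omega) (by omega))
      rw [interlace_two_mul_add_one, interlace_two_mul] at h
      have e := cutLift_natCast M M.P hk1
      rw [Nat.cast_succ] at e
      rw [e]
      exact h.2
    · have e : ((k : ℤ) + 1) = 0 + (8 * g - 4 : ℕ) := by omega
      rw [e, hP.add_period]
      have := cutLift_natCast M M.P (k := 0) (by omega)
      simp only [Nat.cast_zero] at this
      rw [this]
      have h1 := le_lift (Complex.arg (M.P 0)) (M.P 0)
      have h2 := lift_lt (Complex.arg (M.P 0)) (M.Q k)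
      linarith

end SurfacePolygon

/-- Real lifts of two interlaced cyclic families `P 0, Q 0, P 1, Q 1, …`. -/
structure IsInterlacedLift {N : ℕ} (P Q : ZMod N → Circle) (p q : ℤ → ℝ) : Prop where
  liftP : IsCyclicLift P p
  liftQ : IsCyclicLift Q q
  p_lt_q : ∀ s, p s < q s
  q_lt_p : ∀ s, q s < p (s + 1)

namespace IsInterlacedLift

variable {N : ℕ} {P Q : ZMod N → Circle} {p q : ℤ → ℝ}

theorem strictMono_p (h : IsInterlacedLift P Q p q) : StrictMono p :=
  strictMono_int_of_lt_succ fun s => (h.p_lt_q s).trans (h.q_lt_p s)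

theorem strictMono_q (h : IsInterlacedLift P Q p q) : StrictMono q :=
  strictMono_int_of_lt_succ fun s => (h.q_lt_p s).trans (h.p_lt_q (s + 1))

theorem q_lt_p_of_lt (h : IsInterlacedLift P Q p q) {s t : ℤ} (hst : s < t) : q s < p t :=
  (h.q_lt_p s).trans_le (h.strictMono_p.monotone (by omega))

theorem p_lt_q_of_le (h : IsInterlacedLift P Q p q) {s t : ℤ} (hst : s ≤ t) : p s < q t :=
  (h.p_lt_q s).trans_le (h.strictMono_q.monotone hst)

end IsInterlacedLift

theorem SurfacePolygon.isInterlacedLift {g : ℕ} (hg : 2 ≤ g) (M : SurfacePolygon g) :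
    IsInterlacedLift M.P M.Q (M.cutLift M.P) (M.cutLift M.Q) :=
  ⟨M.isCyclicLift_cutLift hg _, M.isCyclicLift_cutLift hg _,
    fun s => (M.cutLift_step hg s).1, fun s => (M.cutLift_step hg s).2⟩

/-! ### Arithmetic of σ, ρ and τ mod 8g-4 -/

section IndexArithmetic

variable {g : ℕ}

/-- Reduction of an index mod `2`. -/
def sideParity (g : ℕ) : SideIndex g →+* ZMod 2 :=
  ZMod.castHom (show 2 ∣ 8 * g - 4 by omega) (ZMod 2)

theorem odd_val_iff (hg : 2 ≤ g) (i : SideIndex g) : Odd i.val ↔ sideParity g i = 1 := by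
  have : NeZero (8 * g - 4) := ⟨by omega⟩
  have h : sideParity g i = (i.val : ZMod 2) := by
    conv_lhs => rw [← ZMod.natCast_zmod_val i]
    simp only [map_natCast]
  rw [h, ZMod.natCast_eq_one_iff_odd]

theorem half_add_half (hg : 2 ≤ g) :
    ((4 * g - 2 : ℕ) : SideIndex g) + ((4 * g - 2 : ℕ) : SideIndex g) = 0 := by
  rw [← Nat.cast_add, show 4 * g - 2 + (4 * g - 2) = 8 * g - 4 by omega, ZMod.natCast_self]

theorem sideParity_half : sideParity g ((4 * g - 2 : ℕ) : SideIndex g) = 0 := by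
  rw [map_natCast]
  exact (ZMod.natCast_eq_zero_iff _ _).2 (by omega)

/-- Written with c = 4g-2, an element with c + c = 0, both cases of σ differ only by c. The index
identities then follow by a parity split and `half_add_half`. -/
theorem sidePairing_eq (hg : 2 ≤ g) (i : SideIndex g) :
    sidePairing g i = if sideParity g i = 1 then ((4 * g - 2 : ℕ) : SideIndex g) + 2 - i
      else 2 - i := by
  have h : ((4 * g : ℕ) : SideIndex g) = ((4 * g - 2 : ℕ) : SideIndex g) + 2 := by
    rw [show 4 * g = (4 * g - 2) + 2 by omega, Nat.cast_add]
    norm_num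
  rw [sidePairing, h]
  simp only [odd_val_iff hg]

theorem sideParity_sidePairing (hg : 2 ≤ g) (i : SideIndex g) :
    sideParity g (sidePairing g i) = sideParity g i := by
  rw [sidePairing_eq hg]
  have h2 : sideParity g 2 = 0 := by rw [map_ofNat]; rfl
  split <;>
    simp only [map_sub, map_add, sideParity_half, h2, zero_add, zero_sub, ZMod.neg_eq_self_mod_two]

theorem sidePairing_of_odd (hg : 2 ≤ g) {i : SideIndex g} (h : sideParity g i = 1) :
    sidePairing g i = ((4 * g - 2 : ℕ) : SideIndex g) + 2 - i := by
  rw [sidePairing_eq hg, if_pos h]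

theorem sidePairing_of_even (hg : 2 ≤ g) {i : SideIndex g} (h : sideParity g i = 0) :
    sidePairing g i = 2 - i := by
  rw [sidePairing_eq hg, if_neg (by rw [h]; decide)]

theorem sideParity_cases (i : SideIndex g) : sideParity g i = 0 ∨ sideParity g i = 1 := by
  generalize sideParity g i = x
  revert x
  decide

theorem sidePairing_sidePairing (hg : 2 ≤ g) (i : SideIndex g) :
    sidePairing g (sidePairing g i) = i := by
  have hp := sideParity_sidePairing hg i
  rcases sideParity_cases i with h | h
  · rw [sidePairing_of_even hg (hp.trans h), sidePairing_of_even hg h]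
    ring
  · rw [sidePairing_of_odd hg (hp.trans h), sidePairing_of_odd hg h]
    ring

theorem sidePairing_oppositeSide_add_one (hg : 2 ≤ g) (i : SideIndex g) :
    sidePairing g (oppositeSide g i + 1) = sidePairing g i - 1 := by
  have hc := half_add_half hg
  have hp : sideParity g (oppositeSide g i + 1) = sideParity g i + 1 := by
    simp only [oppositeSide, map_add, map_one, sideParity_half, add_zero]
  rcases sideParity_cases i with h | h
  · rw [sidePairing_of_odd hg (by rw [hp, h]; rfl), sidePairing_of_even hg h, oppositeSide]
    ring
  · rw [sidePairing_of_even hg (by rw [hp, h]; rfl), sidePairing_of_odd hg h, oppositeSide]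
    linear_combination -hc

theorem sidePairing_oppositeSide (hg : 2 ≤ g) (i : SideIndex g) :
    sidePairing g (oppositeSide g i) + 1 = sidePairing g (i - 1) := by
  have hc := half_add_half hg
  have hp : sideParity g (oppositeSide g i) = sideParity g i := by
    simp only [oppositeSide, map_add, sideParity_half, add_zero]
  have hp' : sideParity g (i - 1) = sideParity g i - 1 := by simp
  rcases sideParity_cases i with h | h
  · rw [sidePairing_of_odd hg (i := i - 1) (by rw [hp', h]; rfl),
      sidePairing_of_even hg (hp.trans h), oppositeSide]
    linear_combination -hc
  · rw [sidePairing_of_even hg (i := i - 1) (by rw [hp', h]; rfl),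
      sidePairing_of_odd hg (hp.trans h), oppositeSide]
    ring

theorem oppositeSide_sidePairing (hg : 2 ≤ g) (i : SideIndex g) :
    oppositeSide g (sidePairing g i) = sidePairing g (i + 1) + 1 := by
  have hc := half_add_half hg
  have hp' : sideParity g (i + 1) = sideParity g i + 1 := by simp
  rcases sideParity_cases i with h | h
  · rw [sidePairing_of_odd hg (i := i + 1) (by rw [hp', h]; rfl),
      sidePairing_of_even hg h, oppositeSide]
    ring
  · rw [sidePairing_of_even hg (i := i + 1) (by rw [hp', h]; rfl),
      sidePairing_of_odd hg h, oppositeSide]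
    linear_combination hc

theorem oppositeSide_oppositeSide (hg : 2 ≤ g) (i : SideIndex g) :
    oppositeSide g (oppositeSide g i) = i := by
  rw [oppositeSide, oppositeSide]
  linear_combination half_add_half hg

theorem vertexMap_sidePairing (hg : 2 ≤ g) (i : SideIndex g) :
    vertexMap g (sidePairing g i) = i + 1 := by
  rw [vertexMap, sidePairing_sidePairing hg]

/-- As τ is an involution, the orbits of ρ have period four, as the cycle relation requires. -/
theorem vertexMap_vertexMap (hg : 2 ≤ g) (i : SideIndex g) :
    vertexMap g (vertexMap g i) = oppositeSide g i := by
  have h := oppositeSide_sidePairing hg (sidePairing g i)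
  rw [sidePairing_sidePairing hg] at h
  rw [vertexMap, vertexMap, h]

theorem vertexMap_iterate_four (hg : 2 ≤ g) (i : SideIndex g) :
    vertexMap g (vertexMap g (vertexMap g (vertexMap g i))) = i := by
  rw [vertexMap_vertexMap hg (vertexMap g (vertexMap g i)), vertexMap_vertexMap hg,
    oppositeSide_oppositeSide hg]

end IndexArithmetic

/-- The bound 12 is the value of 8g-4 at g = 2. -/
theorem SideIndex.natCast_ne_zero {g n : ℕ} (hg : 2 ≤ g) (h0 : 0 < n) (hn : n < 12) :
    (n : SideIndex g) ≠ 0 := by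
  rw [Ne, ZMod.natCast_eq_zero_iff]
  intro h
  have := Nat.le_of_dvd h0 h
  omega

theorem SideIndex.one_ne_zero {g : ℕ} (hg : 2 ≤ g) : (1 : SideIndex g) ≠ 0 := by
  exact_mod_cast SideIndex.natCast_ne_zero hg (n := 1) (by norm_num) (by norm_num)

theorem SideIndex.two_ne_zero {g : ℕ} (hg : 2 ≤ g) : (2 : SideIndex g) ≠ 0 := by
  exact_mod_cast SideIndex.natCast_ne_zero hg (n := 2) (by norm_num) (by norm_num)

theorem SideIndex.three_ne_zero {g : ℕ} (hg : 2 ≤ g) : (3 : SideIndex g) ≠ 0 := by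
  exact_mod_cast SideIndex.natCast_ne_zero hg (n := 3) (by norm_num) (by norm_num)

/-! ### Geometry of the polygon at a vertex -/

section Disk

open ComplexConjugate

/-- The group of Moebius transformations acts transitively on the disk. -/
theorem SU11.exists_mob_eq_zero {c : ℂ} (hc : ‖c‖ < 1) : ∃ X : SU11, X.mob c = 0 := by
  have h : 0 < 1 - ‖c‖ ^ 2 := by nlinarith [norm_nonneg c]
  have hs : (1 / Real.sqrt (1 - ‖c‖ ^ 2)) ^ 2 * (1 - ‖c‖ ^ 2) = 1 := by
    rw [div_pow, Real.sq_sqrt h.le]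
    field_simp
  generalize 1 / Real.sqrt (1 - ‖c‖ ^ 2) = k at hs
  refine ⟨⟨k, -(k * c), ?_⟩, ?_⟩
  · rw [Complex.normSq_neg, Complex.normSq_mul, Complex.normSq_ofReal,
      Complex.normSq_eq_norm_sq c]
    linarith
  · simp [SU11.mob]

theorem SU11.exists_mob_eq_mul {X : SU11} (h : X.mob 0 = 0) :
    ∃ u : ℂ, ‖u‖ = 1 ∧ ∀ z, X.mob z = u * z := by
  have hd : conj X.a ≠ 0 := by simpa [den] using X.den_ne_zero (z := 0) (by simp)
  have hb : X.b = 0 := by simpa [mob, hd] using h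
  refine ⟨X.a / conj X.a, ?_, fun z => ?_⟩
  · rw [norm_div, Complex.norm_conj, div_self]
    simpa using hd
  · simp [mob, hb, div_mul_eq_mul_div]

theorem Circle.conj_mul_self (x : Circle) : conj (x : ℂ) * x = 1 := by
  rw [mul_comm, Complex.mul_conj, Circle.normSq_coe, Complex.ofReal_one]

theorem eq_neg_of_geodesicSide_zero {x y : Circle} (hxy : x ≠ y) (h : geodesicSide x y 0 = 0) :
    (x : ℂ) = -y := by
  have h1 : (conj (x : ℂ) * y).im = 0 := by simpa [geodesicSide] using h
  have h2 : Complex.normSq (conj (x : ℂ) * y) = 1 := by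
    rw [map_mul, Complex.normSq_conj, Circle.normSq_coe, Circle.normSq_coe, one_mul]
  have h3 := Circle.conj_mul_self x
  generalize hw : conj (x : ℂ) * y = w at h1 h2
  have h4 : (y : ℂ) = x * w := by rw [← hw]; linear_combination -(y : ℂ) * h3
  rw [Complex.normSq_apply, h1, mul_zero, add_zero, mul_self_eq_one_iff] at h2
  rcases h2 with h2 | h2
  · have : w = 1 := Complex.ext (by simpa using h2) (by simpa using h1)
    rw [this, mul_one] at h4
    exact absurd (Circle.ext h4.symm) hxy
  · have : w = -1 := Complex.ext (by simpa using h2) (by simpa using h1)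
    rw [h4, this]
    ring

theorem geodesicSide_of_eq_neg {x y : Circle} (h : (x : ℂ) = -y) (z : ℂ) :
    geodesicSide x y z = -4 * (conj z * y).im := by
  rw [geodesicSide, h, map_neg, neg_mul, Circle.conj_mul_self]
  have : conj z * ((y : ℂ) - -y) = 2 * (conj z * y) := by ring
  rw [this]
  simp [Complex.mul_im]
  ring

/-- A geodesic whose ideal endpoints lie to the left of another one lies to its left. -/
theorem geodesicSide_pos_of_mem_geodesic {a b x y : Circle} {z : ℂ} (hxy : x ≠ y)
    (hz : z ∈ geodesic x y) (hx : 0 < geodesicSide a b x) (hy : 0 < geodesicSide a b y) :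
    0 < geodesicSide a b z := by
  obtain ⟨hz1, hz2⟩ := hz
  -- With `z` at the origin the geodesic is a diameter with antipodal endpoints, and the value of
  -- `geodesicSide a b` at the origin is a positive multiple of the sum of its values at these
  -- endpoints.
  obtain ⟨X, hX⟩ := SU11.exists_mob_eq_zero hz1
  rw [← X.geodesicSide_mob_eq_zero x y hz1.le, hX] at hz2
  have h := eq_neg_of_geodesicSide_zero (fun h => hxy (X.onCircle_injective h)) hz2
  rw [← X.geodesicSide_mob_pos a b hz1.le, hX]
  rw [← X.geodesicSide_mob_pos a b (SU11.norm_coe_le _), ← SU11.coe_onCircle] at hx hy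
  rw [h] at hx
  generalize X.onCircle a = a at *
  generalize X.onCircle b = b at *
  generalize X.onCircle y = y at *
  simp only [geodesicSide, norm_neg, Circle.norm_coe, map_neg, neg_mul, Complex.neg_im,
    norm_zero, map_zero, zero_mul, Complex.zero_im] at *
  linarith

theorem eq_real_mul_of_im_eq_zero {z : ℂ} {x : Circle} (h : (conj z * x).im = 0) :
    ∃ t : ℝ, z = t * x := by
  refine ⟨(conj z * x).re, ?_⟩
  have h1 : ((conj z * x).re : ℂ) = conj z * x := Complex.ext (by simp) (by simpa using h.symm)
  have h2 : conj (conj z * x) = conj z * x := by rw [← h1, Complex.conj_ofReal]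
  have h3 := Circle.conj_mul_self x
  rw [h1, ← h2, map_mul, Complex.conj_conj]
  linear_combination -z * h3

end Disk

theorem continuous_geodesicSide (x y : Circle) : Continuous (geodesicSide x y) := by
  unfold geodesicSide
  fun_prop

namespace SurfacePolygon

variable {g : ℕ}

/-- Only adjacent sides have interlaced endpoints: with `k = j + d` and 2 ≤ d ≤ N - 2, N = 8g-4,
both endpoints of side `k` come after `Q (j + 1)` and before the next turn of `P j`. -/
theorem ccw_of_ne (hg : 2 ≤ g) (M : SurfacePolygon g) {j k : SideIndex g} (h1 : k ≠ j - 1)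
    (h2 : k ≠ j) (h3 : k ≠ j + 1) :
    Ccw (M.P j) (M.Q (j + 1)) (M.P k) ∧ Ccw (M.P j) (M.Q (j + 1)) (M.Q (k + 1)) := by
  have : NeZero (8 * g - 4) := ⟨by omega⟩
  have hI := M.isInterlacedLift hg
  obtain ⟨s, rfl⟩ := ZMod.intCast_surjective j
  obtain ⟨d, hd, hdN⟩ : ∃ d : ℕ, d < 8 * g - 4 ∧ k = ((s + d : ℤ) : SideIndex g) :=
    ⟨(k - s).val, ZMod.val_lt _, by simp⟩
  have hd2 : 2 ≤ d := by
    by_contra hlt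
    obtain rfl | rfl : d = 0 ∨ d = 1 := by omega
    · exact h2 (by simpa using hdN)
    · exact h3 (by simpa using hdN)
  have hdN' : d + 2 ≤ 8 * g - 4 := by
    by_contra hlt
    refine h1 ?_
    have h : (d : ℤ) = ((8 * g - 4 : ℕ) : ℤ) - 1 := by omega
    rw [hdN, h]
    push_cast [ZMod.natCast_self]
    ring
  have hN := hI.liftP.add_period s
  rw [hdN]
  have e1 : ((s : SideIndex g) + 1) = ((s + 1 : ℤ) : SideIndex g) := by push_cast; rfl
  have e2 : (((s + d : ℤ) : SideIndex g) + 1) = ((s + d + 1 : ℤ) : SideIndex g) := by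
    push_cast; rfl
  rw [e1, e2, ← hI.liftP.exp_eq, ← hI.liftP.exp_eq, ← hI.liftQ.exp_eq, ← hI.liftQ.exp_eq]
  have l1 := hI.p_lt_q_of_le (show s ≤ s + 1 by omega)
  have l2 := hI.q_lt_p_of_lt (show s + 1 < s + d by omega)
  have l3 := hI.strictMono_p (show s + d < s + (8 * g - 4 : ℕ) by omega)
  have l4 := hI.p_lt_q_of_le (show s + d ≤ s + d + 1 by omega)
  have l5 := hI.q_lt_p_of_lt (show s + d + 1 < s + (8 * g - 4 : ℕ) by omega)
  exact ⟨ccw_exp l1 l2 (by linarith), ccw_exp l1 (by linarith) (by linarith)⟩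

theorem P_ne_Q_add_one (hg : 2 ≤ g) (M : SurfacePolygon g) (j : SideIndex g) :
    M.P j ≠ M.Q (j + 1) := by
  have h1 := SideIndex.one_ne_zero hg
  have h2 := SideIndex.two_ne_zero hg
  have h3 := SideIndex.three_ne_zero hg
  have h := (M.ccw_of_ne hg (j := j) (k := j + 2) (fun h => h3 (by linear_combination h))
    (fun h => h2 (by linear_combination h)) (fun h => h1 (by linear_combination h))).1
  intro h'
  rw [h'] at h
  simp [Ccw] at h

theorem norm_V_lt (M : SurfacePolygon g) (j : SideIndex g) : ‖M.V j‖ < 1 := (M.vertex_left j).1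

/-- A vertex lies strictly to the left of every side that does not contain it. -/
theorem geodesicSide_V_pos (hg : 2 ≤ g) (M : SurfacePolygon g) {j k : SideIndex g}
    (h1 : k ≠ j - 1) (h2 : k ≠ j) : 0 < geodesicSide (M.P k) (M.Q (k + 1)) (M.V j) := by
  have n1 := SideIndex.one_ne_zero hg
  have n2 := SideIndex.two_ne_zero hg
  have n3 := SideIndex.three_ne_zero hg
  -- The vertex lies on sides `j` and `j - 1`. Side `j` is adjacent to side `j + 1`, so in this case
  -- side `j - 1` is used instead.
  by_cases h3 : k = j + 1
  · subst h3
    have hV := M.vertex_right (j - 1)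
    have hc := M.ccw_of_ne hg (j := j + 1) (k := j - 1) (fun h => n1 (by linear_combination -h))
      (fun h => n2 (by linear_combination -h)) (fun h => n3 (by linear_combination -h))
    have hne := M.P_ne_Q_add_one hg (j - 1)
    rw [sub_add_cancel] at hV hne hc
    simp only [ccw_iff_geodesicSide_pos] at hc
    exact geodesicSide_pos_of_mem_geodesic hne hV hc.1 hc.2
  · have hc := M.ccw_of_ne hg (j := k) (k := j) (fun h => h3 (by linear_combination -h))
      (fun h => h2 h.symm) (fun h => h1 (by linear_combination -h))
    simp only [ccw_iff_geodesicSide_pos] at hc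
    exact geodesicSide_pos_of_mem_geodesic (M.P_ne_Q_add_one hg j) (M.vertex_left j) hc.1 hc.2

/-- A Moebius transformation that moves `V j` to the origin. -/
noncomputable def vertexFrame (M : SurfacePolygon g) (j : SideIndex g) : SU11 :=
  (SU11.exists_mob_eq_zero (M.norm_V_lt j)).choose

theorem vertexFrame_V (M : SurfacePolygon g) (j : SideIndex g) :
    (M.vertexFrame j).mob (M.V j) = 0 :=
  (SU11.exists_mob_eq_zero (M.norm_V_lt j)).choose_spec

/-- The forward endpoint of side `j`, seen from `V j`. -/
noncomputable def dirOut (M : SurfacePolygon g) (j : SideIndex g) : Circle :=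
  (M.vertexFrame j).onCircle (M.Q (j + 1))

/-- The forward endpoint of side `j - 1`, seen from `V j`. -/
noncomputable def dirIn (M : SurfacePolygon g) (j : SideIndex g) : Circle :=
  (M.vertexFrame j).onCircle (M.Q j)

/-- A geodesic through the origin is a diameter, so the backward endpoint of a side through `V j` is
opposite to the forward one. -/
theorem vertexFrame_P (hg : 2 ≤ g) (M : SurfacePolygon g) (j : SideIndex g) :
    ((M.vertexFrame j).onCircle (M.P j) : ℂ) = -M.dirOut j := by
  have hV := (M.vertex_left j).2
  rw [← (M.vertexFrame j).geodesicSide_mob_eq_zero _ _ (M.norm_V_lt j).le, vertexFrame_V] at hV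
  exact eq_neg_of_geodesicSide_zero
    (fun h => M.P_ne_Q_add_one hg j (SU11.onCircle_injective _ h)) hV

theorem vertexFrame_P_sub_one (hg : 2 ≤ g) (M : SurfacePolygon g) (j : SideIndex g) :
    ((M.vertexFrame j).onCircle (M.P (j - 1)) : ℂ) = -M.dirIn j := by
  have hV := (M.vertex_right (j - 1)).2
  have hne := M.P_ne_Q_add_one hg (j - 1)
  rw [sub_add_cancel] at hV hne
  rw [← (M.vertexFrame j).geodesicSide_mob_eq_zero _ _ (M.norm_V_lt j).le, vertexFrame_V] at hV
  exact eq_neg_of_geodesicSide_zero (fun h => hne (SU11.onCircle_injective _ h)) hV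

open ComplexConjugate

theorem geodesicSide_pos_iff_dirOut (hg : 2 ≤ g) (M : SurfacePolygon g) (j : SideIndex g) {z : ℂ}
    (hz : ‖z‖ ≤ 1) : 0 < geodesicSide (M.P j) (M.Q (j + 1)) z ↔
      (conj ((M.vertexFrame j).mob z) * M.dirOut j).im < 0 := by
  rw [← (M.vertexFrame j).geodesicSide_mob_pos _ _ hz,
    geodesicSide_of_eq_neg (y := (M.vertexFrame j).onCircle (M.Q (j + 1))) (M.vertexFrame_P hg j)]
  constructor <;> intro h <;> unfold dirOut at * <;> linarith

theorem geodesicSide_pos_iff_dirIn (hg : 2 ≤ g) (M : SurfacePolygon g) (j : SideIndex g) {z : ℂ}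
    (hz : ‖z‖ ≤ 1) : 0 < geodesicSide (M.P (j - 1)) (M.Q j) z ↔
      (conj ((M.vertexFrame j).mob z) * M.dirIn j).im < 0 := by
  rw [← (M.vertexFrame j).geodesicSide_mob_pos _ _ hz,
    geodesicSide_of_eq_neg (y := (M.vertexFrame j).onCircle (M.Q j)) (M.vertexFrame_P_sub_one hg j)]
  constructor <;> intro h <;> unfold dirIn at * <;> linarith

theorem geodesicSide_eq_zero_iff_dirOut (hg : 2 ≤ g) (M : SurfacePolygon g) (j : SideIndex g)
    {z : ℂ} (hz : ‖z‖ ≤ 1) : geodesicSide (M.P j) (M.Q (j + 1)) z = 0 ↔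
      (conj ((M.vertexFrame j).mob z) * M.dirOut j).im = 0 := by
  rw [← (M.vertexFrame j).geodesicSide_mob_eq_zero _ _ hz,
    geodesicSide_of_eq_neg (y := (M.vertexFrame j).onCircle (M.Q (j + 1))) (M.vertexFrame_P hg j)]
  constructor <;> intro h <;> unfold dirOut at * <;> linarith

theorem geodesicSide_eq_zero_iff_dirIn (hg : 2 ≤ g) (M : SurfacePolygon g) (j : SideIndex g)
    {z : ℂ} (hz : ‖z‖ ≤ 1) : geodesicSide (M.P (j - 1)) (M.Q j) z = 0 ↔
      (conj ((M.vertexFrame j).mob z) * M.dirIn j).im = 0 := by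
  rw [← (M.vertexFrame j).geodesicSide_mob_eq_zero _ _ hz,
    geodesicSide_of_eq_neg (y := (M.vertexFrame j).onCircle (M.Q j)) (M.vertexFrame_P_sub_one hg j)]
  constructor <;> intro h <;> unfold dirIn at * <;> linarith

/-- The number `conj (dirOut j) * dirIn j` is -exp(iα), with α the interior angle at `V j`; the
inequality says 0 < α < π. -/
theorem dirOut_dirIn_im_neg (hg : 2 ≤ g) (M : SurfacePolygon g) (j : SideIndex g) :
    (conj (M.dirOut j : ℂ) * M.dirIn j).im < 0 := by
  have hI := M.isInterlacedLift hg
  refine (M.geodesicSide_pos_iff_dirIn hg j (SU11.norm_coe_le (M.Q (j + 1)))).1 ?_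
  rw [← ccw_iff_geodesicSide_pos]
  obtain ⟨s, rfl⟩ := ZMod.intCast_surjective j
  have e1 : ((s : SideIndex g) + 1) = ((s + 1 : ℤ) : SideIndex g) := by push_cast; rfl
  have e2 : ((s : SideIndex g) - 1) = ((s - 1 : ℤ) : SideIndex g) := by push_cast; rfl
  rw [e1, e2, ← hI.liftP.exp_eq, ← hI.liftQ.exp_eq, ← hI.liftQ.exp_eq]
  have hN := hI.liftP.add_period (s - 1)
  have l1 := hI.p_lt_q_of_le (show s - 1 ≤ s by omega)
  have l2 := hI.strictMono_q (show s < s + 1 by omega)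
  have l3 := hI.q_lt_p_of_lt (show s + 1 < s - 1 + (8 * g - 4 : ℕ) by omega)
  exact ccw_exp l1 l2 (by linarith)

theorem exists_vertexFrame_V_add_one (hg : 2 ≤ g) (M : SurfacePolygon g) (j : SideIndex g) :
    ∃ t : ℝ, 0 < t ∧ (M.vertexFrame j).mob (M.V (j + 1)) = t * M.dirOut j := by
  have n1 := SideIndex.one_ne_zero hg
  have n2 := SideIndex.two_ne_zero hg
  obtain ⟨t, ht⟩ := eq_real_mul_of_im_eq_zero
    ((M.geodesicSide_eq_zero_iff_dirOut hg j (M.norm_V_lt _).le).1 (M.vertex_right j).2)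
  refine ⟨t, ?_, ht⟩
  have h := M.geodesicSide_V_pos hg (j := j + 1) (k := j - 1)
    (fun h => n1 (by linear_combination -h)) (fun h => n2 (by linear_combination -h))
  rw [sub_add_cancel, M.geodesicSide_pos_iff_dirIn hg j (M.norm_V_lt _).le, ht, map_mul,
    Complex.conj_ofReal, mul_assoc, Complex.im_ofReal_mul] at h
  nlinarith [M.dirOut_dirIn_im_neg hg j]

theorem exists_vertexFrame_V_sub_one (hg : 2 ≤ g) (M : SurfacePolygon g) (j : SideIndex g) :
    ∃ t : ℝ, t < 0 ∧ (M.vertexFrame j).mob (M.V (j - 1)) = t * M.dirIn j := by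
  have n1 := SideIndex.one_ne_zero hg
  have n2 := SideIndex.two_ne_zero hg
  have h0 := (M.vertex_left (j - 1)).2
  rw [sub_add_cancel] at h0
  obtain ⟨t, ht⟩ := eq_real_mul_of_im_eq_zero
    ((M.geodesicSide_eq_zero_iff_dirIn hg j (M.norm_V_lt _).le).1 h0)
  refine ⟨t, ?_, ht⟩
  have h := M.geodesicSide_V_pos hg (j := j - 1) (k := j)
    (fun h => n2 (by linear_combination h)) (fun h => n1 (by linear_combination h))
  rw [M.geodesicSide_pos_iff_dirOut hg j (M.norm_V_lt _).le, ht, map_mul,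
    Complex.conj_ofReal, mul_assoc, Complex.im_ofReal_mul] at h
  have h1 := M.dirOut_dirIn_im_neg hg j
  have h2 : (conj (M.dirIn j : ℂ) * M.dirOut j).im = -(conj (M.dirOut j : ℂ) * M.dirIn j).im := by
    rw [← Complex.conj_im, map_mul, Complex.conj_conj, mul_comm]
  rw [h2] at h
  nlinarith

theorem T_V_add_one (hg : 2 ≤ g) (M : SurfacePolygon g) (j : SideIndex g) :
    (M.T j).mob (M.V (j + 1)) = M.V (sidePairing g j) := by
  have h1 := M.T_vertex (sidePairing g j)
  have h2 := M.T_pairing (sidePairing g j) _ (M.norm_V_lt (sidePairing g j))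
  rw [SU11.mob_mul _ _ (M.norm_V_lt _).le, h1, sidePairing_sidePairing hg,
    vertexMap_sidePairing hg] at h2
  exact h2

/-- Seen from the vertices `V j` and `V (ρ j)`, the side pairing `T j` is a rotation. -/
theorem exists_rotation (hg : 2 ≤ g) (M : SurfacePolygon g) (j : SideIndex g) :
    ∃ u : ℂ, (∀ z : ℂ, ‖z‖ ≤ 1 → (M.vertexFrame (vertexMap g j)).mob ((M.T j).mob z)
      = u * (M.vertexFrame j).mob z) ∧ u * M.dirOut j = -M.dirIn (vertexMap g j) := by
  have hX : (M.vertexFrame (vertexMap g j) * M.T j * (M.vertexFrame j)⁻¹).mob 0 = 0 := by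
    rw [SU11.mob_mul _ _ (by simp), ← M.vertexFrame_V j, SU11.inv_mob_mob _ (M.norm_V_lt j).le,
      SU11.mob_mul _ _ (M.norm_V_lt j).le, M.T_vertex, vertexFrame_V, vertexFrame_V]
  obtain ⟨u, hu1, hu⟩ := SU11.exists_mob_eq_mul hX
  have hrot : ∀ z : ℂ, ‖z‖ ≤ 1 → (M.vertexFrame (vertexMap g j)).mob ((M.T j).mob z)
      = u * (M.vertexFrame j).mob z := by
    intro z hz
    rw [← SU11.mob_mul _ _ hz, ← hu, ← SU11.mob_mul _ _ hz, mul_assoc, inv_mul_cancel, mul_one]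
  refine ⟨u, hrot, ?_⟩
  obtain ⟨t, ht, ht'⟩ := M.exists_vertexFrame_V_add_one hg j
  obtain ⟨r, hr, hr'⟩ := M.exists_vertexFrame_V_sub_one hg (vertexMap g j)
  -- `T j` maps side `j` to side `σ j` reversed, so `V (j + 1)`, ahead of `V j`, goes to the vertex
  -- behind `V (ρ j)`. Equality of norms then gives r = -t.
  have h := hrot _ (M.norm_V_lt (j + 1)).le
  rw [T_V_add_one hg, show sidePairing g j = vertexMap g j - 1 by simp [vertexMap], hr', ht'] at h
  have hn := congrArg norm h
  rw [norm_mul, norm_mul, norm_mul, hu1, Circle.norm_coe, Circle.norm_coe, Complex.norm_real,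
    Complex.norm_real, Real.norm_eq_abs, Real.norm_eq_abs, abs_of_pos ht, abs_of_neg hr] at hn
  have ht0 : (t : ℂ) ≠ 0 := by exact_mod_cast ht.ne'
  apply mul_left_cancel₀ ht0
  have hrt : (r : ℂ) = -t := by
    rw [← Complex.ofReal_neg]
    congr 1
    linarith
  rw [hrt] at h
  linear_combination -h

theorem mem_interior_sidePolygon (hg : 2 ≤ g) (M : SurfacePolygon g) {z : ℂ} (hz : ‖z‖ < 1)
    (h : ∀ i, 0 < geodesicSide (M.P i) (M.Q (i + 1)) z) :
    z ∈ interior (sidePolygon M.P M.Q) := by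
  have : NeZero (8 * g - 4) := ⟨by omega⟩
  have ho : IsOpen ({z : ℂ | ‖z‖ < 1} ∩
      ⋂ i, {z : ℂ | 0 < geodesicSide (M.P i) (M.Q (i + 1)) z}) :=
    (isOpen_lt continuous_norm continuous_const).inter
      (isOpen_iInter_of_finite fun i => isOpen_lt continuous_const (continuous_geodesicSide _ _))
  refine interior_maximal ?_ ho ⟨hz, mem_iInter.2 h⟩
  rintro w ⟨hw, hw'⟩
  exact ⟨hw, fun i => (mem_iInter.1 hw' i : 0 < geodesicSide (M.P i) (M.Q (i + 1)) w).le⟩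

/-- The extension condition at the vertex `V (ρ j)`: the angles of the polygon and of its image
under `T j` add up to at most `π`. -/
theorem im_dir_nonneg (hg : 2 ≤ g) (M : SurfacePolygon g) (j : SideIndex g) :
    0 ≤ ((conj (M.dirOut j : ℂ) * M.dirIn j) *
      (conj (M.dirOut (vertexMap g j) : ℂ) * M.dirIn (vertexMap g j))).im := by
  have : NeZero (8 * g - 4) := ⟨by omega⟩
  by_contra! hneg
  obtain ⟨u, hu, hup⟩ := M.exists_rotation hg j
  set k := vertexMap g j with hk
  set a : ℂ := conj (M.dirOut k : ℂ) * M.dirIn k with ha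
  have hp := Circle.conj_mul_self (M.dirOut j)
  have hpk := Circle.conj_mul_self (M.dirOut k)
  have hqk := Circle.conj_mul_self (M.dirIn k)
  have ha1 : conj a * a = 1 := by
    rw [ha, map_mul, Complex.conj_conj]
    linear_combination hpk * (conj (M.dirIn k : ℂ) * M.dirIn k) + hqk
  have hadir : a * M.dirOut k = M.dirIn k := by
    rw [ha]
    linear_combination (M.dirIn k : ℂ) * hpk
  have han : ‖a‖ = 1 := by
    rw [ha, norm_mul, Complex.norm_conj, Circle.norm_coe, Circle.norm_coe, one_mul]
  -- The direction at `V j` that `T j` turns into `-dirOut k`, the backward extension of side `k`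
  -- beyond `V k`. If the two angles exceeded π together, it would point into the polygon.
  set w : ℂ := conj a * M.dirOut j with hw
  have hwn : ‖w‖ = 1 := by
    rw [hw, norm_mul, Complex.norm_conj, han, Circle.norm_coe, one_mul]
  set φ := M.vertexFrame j with hφ
  have hcont : Filter.Tendsto (fun ε : ℝ => φ⁻¹.mob (ε * w)) (nhdsWithin 0 (Ioi 0))
      (nhds (M.V j)) := by
    have h0 : φ⁻¹.mob ((0 : ℝ) * w) = M.V j := by
      rw [Complex.ofReal_zero, zero_mul, ← M.vertexFrame_V j, SU11.inv_mob_mob _ (M.norm_V_lt j).le]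
    rw [← h0]
    have hc : ContinuousAt φ⁻¹.mob (((0 : ℝ) : ℂ) * w) := by
      refine (φ⁻¹).continuousOn_mob.continuousAt ?_
      refine Filter.mem_of_superset (Metric.ball_mem_nhds _ one_pos) fun z hz => ?_
      simpa using (mem_ball_zero_iff.1 (by simpa using hz) : ‖z‖ < 1).le
    refine Filter.Tendsto.mono_left ?_ nhdsWithin_le_nhds
    exact hc.tendsto.comp (f := fun ε : ℝ => (ε : ℂ) * w)
      (Continuous.tendsto (by fun_prop) (0 : ℝ))
  -- Sides not through `V j` are at a positive distance from it, so near `V j` only the two adjacent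
  -- sides need checking.
  have hev : ∀ᶠ ε : ℝ in nhdsWithin 0 (Ioi 0), ∀ i, i ≠ j - 1 → i ≠ j →
      0 < geodesicSide (M.P i) (M.Q (i + 1)) (φ⁻¹.mob (ε * w)) := by
    rw [Filter.eventually_all]
    intro i
    by_cases h1 : i = j - 1
    · exact Filter.Eventually.of_forall fun _ h => absurd h1 h
    by_cases h2 : i = j
    · exact Filter.Eventually.of_forall fun _ _ h => absurd h2 h
    have := ((continuous_geodesicSide (M.P i) (M.Q (i + 1))).tendsto _).comp hcont
    filter_upwards [this.eventually (lt_mem_nhds (M.geodesicSide_V_pos hg h1 h2))] with ε hε _ _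
    exact hε
  have hlt : ∀ᶠ ε : ℝ in nhdsWithin 0 (Ioi 0), ε < 1 :=
    Filter.Eventually.filter_mono nhdsWithin_le_nhds (gt_mem_nhds one_pos)
  obtain ⟨ε, ⟨hε, hε1⟩, hε0⟩ := ((hev.and hlt).and self_mem_nhdsWithin).exists
  have hε0 : 0 < ε := hε0
  have hεw : ‖(ε : ℂ) * w‖ < 1 := by
    rw [norm_mul, hwn, mul_one, Complex.norm_real, Real.norm_of_nonneg hε0.le]
    exact hε1
  set z := φ⁻¹.mob (ε * w) with hz
  have hz1 : ‖z‖ < 1 := SU11.norm_mob_lt_one _ hεw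
  have hφz : φ.mob z = ε * w := SU11.mob_inv_mob _ hεw.le
  have hwj : (conj ((ε : ℂ) * w) * M.dirOut j).im = ε * a.im := by
    rw [map_mul, Complex.conj_ofReal, mul_assoc, Complex.im_ofReal_mul]
    congr 2
    rw [hw, map_mul, Complex.conj_conj]
    linear_combination a * hp
  have hwj' : (conj ((ε : ℂ) * w) * M.dirIn j).im
      = ε * (conj (M.dirOut j : ℂ) * M.dirIn j * a).im := by
    rw [map_mul, Complex.conj_ofReal, mul_assoc, Complex.im_ofReal_mul]
    congr 2
    rw [hw, map_mul, Complex.conj_conj]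
    ring
  have hint : z ∈ interior (sidePolygon M.P M.Q) := by
    refine M.mem_interior_sidePolygon hg hz1 fun i => ?_
    by_cases h1 : i = j - 1
    · rw [h1, sub_add_cancel, M.geodesicSide_pos_iff_dirIn hg j hz1.le, ← hφ, hφz, hwj']
      exact mul_neg_of_pos_of_neg hε0 hneg
    by_cases h2 : i = j
    · rw [h2, M.geodesicSide_pos_iff_dirOut hg j hz1.le, ← hφ, hφz, hwj]
      exact mul_neg_of_pos_of_neg hε0 (M.dirOut_dirIn_im_neg hg k)
    exact hε i h1 h2
  refine M.extension k (M.T j) (M.T_mem j) z hint ⟨SU11.norm_mob_lt_one _ hz1, ?_⟩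
  rw [M.geodesicSide_eq_zero_iff_dirOut hg k (SU11.norm_mob_lt_one _ hz1).le, hu z hz1.le, hφz]
  have : u * ((ε : ℂ) * w) = ε * (-M.dirOut k) := by
    rw [hw]
    linear_combination (ε * conj a) * hup + (ε * conj a) * hadir - (ε * M.dirOut k : ℂ) * ha1
  rw [this, map_mul, Complex.conj_ofReal, mul_assoc, Complex.im_ofReal_mul, map_neg, neg_mul, hpk]
  simp

end SurfacePolygon

/-! ### Neighbouring angles add up to π; images of the ideal endpoints -/

open ComplexConjugate in
/-- Four points of the unit circle in the lower half plane, with product `1`, whose cyclically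
consecutive products lie in the closed upper half plane, have consecutive products `-1`. -/
theorem mul_eq_neg_one_of_cycle {a b c d : ℂ} (ha : conj a * a = 1) (hb : conj b * b = 1)
    (ha' : a.im < 0) (hb' : b.im < 0) (hab : 0 ≤ (a * b).im) (hcd : 0 ≤ (c * d).im)
    (h : a * b * (c * d) = 1) : a * b = -1 := by
  have h1 : conj (a * b) * (a * b) = 1 := by
    rw [map_mul]
    linear_combination (conj b * b) * ha + hb
  -- The two products are conjugate to each other and both in the closed upper half plane, hence
  -- real. The value 1 would give b = conj a, impossible with both in the lower half plane.
  have h2 : c * d = conj (a * b) := by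
    linear_combination conj (a * b) * h - (c * d) * h1
  have h3 : (a * b).im = 0 := by
    rw [h2, Complex.conj_im] at hcd
    linarith
  have h4 : Complex.normSq (a * b) = 1 := by
    have h5 := h1
    rw [mul_comm, Complex.mul_conj] at h5
    exact_mod_cast h5
  rw [Complex.normSq_apply, h3, mul_zero, add_zero, mul_self_eq_one_iff] at h4
  rcases h4 with h4 | h4
  · have h5 : a * b = 1 := Complex.ext h4 h3
    have h6 : b = conj a := by linear_combination conj a * h5 - b * ha
    rw [h6, Complex.conj_im] at hb'
    linarith
  · exact Complex.ext (by simpa using h4) (by simpa using h3)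

namespace SurfacePolygon

variable {g : ℕ}

open ComplexConjugate

/-- The left side is exp(i(α + α')) for the interior angles at `V j` and `V (ρ j)`. The sum is at
most π by the extension condition, likewise for the other pair of the cycle, and the cycle relation
turns these inequalities into equalities. -/
theorem dir_mul_dir (hg : 2 ≤ g) (M : SurfacePolygon g) (j : SideIndex g) :
    (conj (M.dirOut j : ℂ) * M.dirIn j) *
      (conj (M.dirOut (vertexMap g j) : ℂ) * M.dirIn (vertexMap g j)) = -1 := by
  have hunit : ∀ k, conj (conj (M.dirOut k : ℂ) * M.dirIn k) * (conj (M.dirOut k : ℂ) * M.dirIn k)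
      = 1 := by
    intro k
    rw [map_mul, Complex.conj_conj]
    linear_combination Circle.conj_mul_self (M.dirOut k) * (conj (M.dirIn k : ℂ) * M.dirIn k)
      + Circle.conj_mul_self (M.dirIn k)
  have hdir : ∀ k, (conj (M.dirOut k : ℂ) * M.dirIn k) * M.dirOut k = M.dirIn k := fun k => by
    linear_combination (M.dirIn k : ℂ) * Circle.conj_mul_self (M.dirOut k)
  have im1 := M.im_dir_nonneg hg j
  have im3 := M.im_dir_nonneg hg (vertexMap g (vertexMap g j))
  have hj := vertexMap_iterate_four hg j
  obtain ⟨u1, hu1, hv1⟩ := M.exists_rotation hg j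
  obtain ⟨u2, hu2, hv2⟩ := M.exists_rotation hg (vertexMap g j)
  obtain ⟨u3, hu3, hv3⟩ := M.exists_rotation hg (vertexMap g (vertexMap g j))
  obtain ⟨u4, hu4, hv4⟩ := M.exists_rotation hg (vertexMap g (vertexMap g (vertexMap g j)))
  rw [hj] at hu4 hv4
  have hcyc := (M.T_cycle j).onCircle (M.Q (j + 1))
  -- Following one ideal point around the cycle, the four rotations compose to the identity. As each
  -- `u` takes `dirOut` to `-dirIn` at the next vertex, this becomes the statement that the product
  -- of the four numbers -exp(iα) is 1, the four signs cancelling.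
  have e : (M.dirOut j : ℂ) = u4 * (u3 * (u2 * (u1 * M.dirOut j))) := by
    simp only [SU11.onCircle_mul] at hcyc
    conv_lhs => rw [dirOut, ← hcyc]
    simp only [SU11.coe_onCircle, dirOut]
    have h0 := SU11.norm_coe_le (M.Q (j + 1))
    have h1 : ‖(M.T j).mob (M.Q (j + 1))‖ ≤ 1 := (SU11.norm_mob_circle _ _).le
    have h2 : ‖(M.T (vertexMap g j)).mob ((M.T j).mob (M.Q (j + 1)))‖ ≤ 1 := by
      rw [← SU11.coe_onCircle]
      exact (SU11.norm_mob_circle _ _).le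
    have h3 : ‖(M.T (vertexMap g (vertexMap g j))).mob ((M.T (vertexMap g j)).mob
        ((M.T j).mob (M.Q (j + 1))))‖ ≤ 1 := by
      rw [← SU11.coe_onCircle, ← SU11.coe_onCircle]
      exact (SU11.norm_mob_circle _ _).le
    rw [hu4 _ h3, hu3 _ h2, hu2 _ h1, hu1 _ h0]
  have w1 := hdir j
  have w2 := hdir (vertexMap g j)
  have w3 := hdir (vertexMap g (vertexMap g j))
  have w4 := hdir (vertexMap g (vertexMap g (vertexMap g j)))
  refine mul_eq_neg_one_of_cycle (hunit _) (hunit _) (M.dirOut_dirIn_im_neg hg _)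
    (M.dirOut_dirIn_im_neg hg _) im1 im3 ?_
  have hne : (M.dirOut j : ℂ) ≠ 0 := Circle.coe_ne_zero _
  apply mul_right_cancel₀ hne
  generalize conj (M.dirOut j : ℂ) * M.dirIn j = a1 at *
  generalize conj (M.dirOut (vertexMap g j) : ℂ) * M.dirIn (vertexMap g j) = a2 at *
  generalize conj (M.dirOut (vertexMap g (vertexMap g j)) : ℂ)
    * M.dirIn (vertexMap g (vertexMap g j)) = a3 at *
  generalize conj (M.dirOut (vertexMap g (vertexMap g (vertexMap g j))) : ℂ)
    * M.dirIn (vertexMap g (vertexMap g (vertexMap g j))) = a4 at *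
  rw [← w2] at hv1
  rw [← w3] at hv2
  rw [← w4] at hv3
  rw [← w1] at hv4
  rw [one_mul]
  conv_rhs => rw [e, hv1]
  linear_combination (u4 * u3 * a2) * hv2 - (u4 * a2 * a3) * hv3 + (a2 * a3 * a4) * hv4

/-- A point of the circle is determined by its direction from `V (ρ j)`. -/
theorem onCircle_T_eq_of_frame (M : SurfacePolygon g) {j : SideIndex g} {x y : Circle}
    (h : ((M.vertexFrame (vertexMap g j)).mob ((M.T j).mob x) : ℂ)
      = (M.vertexFrame (vertexMap g j)).onCircle y) : (M.T j).onCircle x = y := by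
  apply (M.vertexFrame (vertexMap g j)).onCircle_injective
  exact Circle.ext h

theorem T_P (hg : 2 ≤ g) (M : SurfacePolygon g) (j : SideIndex g) :
    (M.T j).onCircle (M.P j) = M.Q (sidePairing g j + 1) := by
  obtain ⟨u, hu, hv⟩ := M.exists_rotation hg j
  apply M.onCircle_T_eq_of_frame
  rw [hu _ (SU11.norm_coe_le _), ← SU11.coe_onCircle, vertexFrame_P hg]
  change _ = (M.dirIn (vertexMap g j) : ℂ)
  linear_combination -hv

theorem T_Q_add_one (hg : 2 ≤ g) (M : SurfacePolygon g) (j : SideIndex g) :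
    (M.T j).onCircle (M.Q (j + 1)) = M.P (sidePairing g j) := by
  obtain ⟨u, hu, hv⟩ := M.exists_rotation hg j
  apply M.onCircle_T_eq_of_frame
  have h := M.vertexFrame_P_sub_one hg (vertexMap g j)
  rw [show vertexMap g j - 1 = sidePairing g j by simp [vertexMap]] at h
  rw [hu _ (SU11.norm_coe_le _), h]
  exact hv

/-- Since the two angles add up to π, side `j - 1` continued past `V j` is carried to the direction
of side `ρ j`. This is what makes `T_Q` and `T_P_sub_one` available beyond the endpoints of side `j`
itself. -/
theorem rotation_dirIn (hg : 2 ≤ g) (M : SurfacePolygon g) {j : SideIndex g} {u : ℂ}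
    (hv : u * M.dirOut j = -M.dirIn (vertexMap g j)) :
    u * M.dirIn j = M.dirOut (vertexMap g j) := by
  have h := M.dir_mul_dir hg j
  have h1 := Circle.conj_mul_self (M.dirOut j)
  have h2 := Circle.conj_mul_self (M.dirOut (vertexMap g j))
  linear_combination (-u * M.dirIn j) * h1 + (conj (M.dirOut j : ℂ) * M.dirIn j) * hv
    - (M.dirOut (vertexMap g j) : ℂ) * h
    + (conj (M.dirOut j : ℂ) * M.dirIn j * M.dirIn (vertexMap g j)) * h2

theorem T_Q (hg : 2 ≤ g) (M : SurfacePolygon g) (j : SideIndex g) :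
    (M.T j).onCircle (M.Q j) = M.Q (sidePairing g j + 2) := by
  obtain ⟨u, hu, hv⟩ := M.exists_rotation hg j
  apply M.onCircle_T_eq_of_frame
  rw [hu _ (SU11.norm_coe_le _)]
  have h := M.rotation_dirIn hg hv
  rw [show sidePairing g j + 2 = vertexMap g j + 1 by rw [vertexMap]; ring]
  exact h

theorem T_P_sub_one (hg : 2 ≤ g) (M : SurfacePolygon g) (j : SideIndex g) :
    (M.T j).onCircle (M.P (j - 1)) = M.P (sidePairing g j + 1) := by
  obtain ⟨u, hu, hv⟩ := M.exists_rotation hg j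
  apply M.onCircle_T_eq_of_frame
  have h := M.rotation_dirIn hg hv
  have h1 := M.vertexFrame_P_sub_one hg j
  rw [hu _ (SU11.norm_coe_le _), ← SU11.coe_onCircle, h1]
  change _ = ((M.vertexFrame (vertexMap g j)).onCircle (M.P (vertexMap g j)) : ℂ)
  rw [vertexFrame_P hg, ← h]
  ring

theorem T_sidePairing_T (M : SurfacePolygon g) (j : SideIndex g) (x : Circle) :
    (M.T (sidePairing g j)).onCircle ((M.T j).onCircle x) = x := by
  rw [← SU11.onCircle_mul]
  exact (M.T_pairing j).onCircle x

theorem T_T_sidePairing (hg : 2 ≤ g) (M : SurfacePolygon g) (j : SideIndex g) (x : Circle) :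
    (M.T j).onCircle ((M.T (sidePairing g j)).onCircle x) = x := by
  have h := M.T_sidePairing_T (sidePairing g j) x
  rwa [sidePairing_sidePairing hg] at h

theorem T_P_add_one (hg : 2 ≤ g) (M : SurfacePolygon g) (j : SideIndex g) :
    (M.T j).onCircle (M.P (j + 1)) = M.P (sidePairing g j - 1) := by
  have h := M.T_P_sub_one hg (sidePairing g j)
  rw [sidePairing_sidePairing hg] at h
  rw [← h, T_T_sidePairing hg]

theorem T_Q_add_two (hg : 2 ≤ g) (M : SurfacePolygon g) (j : SideIndex g) :
    (M.T j).onCircle (M.Q (j + 2)) = M.Q (sidePairing g j) := by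
  have h := M.T_Q hg (sidePairing g j)
  rw [sidePairing_sidePairing hg] at h
  rw [← h, T_T_sidePairing hg]

/-- The cycle relation, solved for the last side pairing. -/
theorem T_cycle_onCircle (M : SurfacePolygon g) (j : SideIndex g) (x : Circle) :
    (M.T (vertexMap g (vertexMap g j))).onCircle ((M.T (vertexMap g j)).onCircle
      ((M.T j).onCircle x)) =
      (M.T (sidePairing g (vertexMap g (vertexMap g (vertexMap g j))))).onCircle x := by
  have h := (M.T_cycle j).onCircle x
  simp only [SU11.onCircle_mul] at h
  conv_rhs => rw [← h]
  rw [T_sidePairing_T]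

end SurfacePolygon

/-! ### Monotonicity and fixed points of Möbius transformations on arcs -/

theorem lift_mem_Icc {a b c : ℝ} {x : Circle} (hca : c ≤ a) (hab : a ≤ b)
    (hbc : b < c + 2 * Real.pi) (hx : x ∈ arcCC (Circle.exp a) (Circle.exp b)) :
    a ≤ lift c x ∧ lift c x ≤ b := by
  rw [arcCC_exp hab (by linarith)] at hx
  obtain ⟨t, ht, rfl⟩ := hx
  rw [lift_exp (hca.trans ht.1) (ht.2.trans_lt hbc)]
  exact ht

theorem arcCC_exp_subset {a b c d : ℝ} (hca : c ≤ a) (hab : a ≤ b) (hbd : b ≤ d)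
    (hdc : d < c + 2 * Real.pi) :
    arcCC (Circle.exp a) (Circle.exp b) ⊆ arcCC (Circle.exp c) (Circle.exp d) := by
  rw [arcCC_exp hab (by linarith), arcCC_exp (by linarith) hdc]
  exact image_mono (Icc_subset_Icc hca hbd)

/-- A Moebius transformation that maps an arc into an arc is monotone there. -/
theorem SU11.lift_onCircle_le (X : SU11) {a b a' b' x y : ℝ} (hba : b < a + 2 * Real.pi)
    (hab' : a' ≤ b') (hba' : b' < a' + 2 * Real.pi)
    (hX : ∀ z ∈ arcCC (Circle.exp a) (Circle.exp b),
      X.onCircle z ∈ arcCC (Circle.exp a') (Circle.exp b'))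
    (hax : a ≤ x) (hxy : x ≤ y) (hyb : y ≤ b) :
    lift a' (X.onCircle (Circle.exp x)) ≤ lift a' (X.onCircle (Circle.exp y)) := by
  by_contra! hlt
  have hx := (mem_arcCC_iff_lift hab' hba').1
    (hX _ (exp_mem_arcCC hba hax (hxy.trans hyb)))
  have hy := le_lift a' (X.onCircle (Circle.exp y))
  -- A point outside the target arc. If the order were reversed, the arc from the image of x to the
  -- image of y would wrap around through it, although that arc is the image of [x, y].
  obtain ⟨m, hm1, hm2⟩ := exists_between hba'
  have hm : Circle.exp m ∈ arcCC (X.onCircle (Circle.exp x)) (X.onCircle (Circle.exp y)) := by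
    rw [← exp_lift a' (X.onCircle (Circle.exp x)), ← exp_lift a' (X.onCircle (Circle.exp y)),
      ← Circle.exp_add_two_pi (lift a' (X.onCircle (Circle.exp y)))]
    exact exp_mem_arcCC (by linarith) (by linarith) (by linarith)
  rw [← X.onCircle_inv_onCircle (Circle.exp m), X.onCircle_mem_arcCC] at hm
  have h := hX _ (arcCC_exp_subset hax hxy hyb hba hm)
  rw [X.onCircle_inv_onCircle, mem_arcCC_iff_lift hab' hba', lift_exp (by linarith) hm2] at h
  linarith

theorem SU11.eq_left_of_onCircle_eq_left (X : SU11) {a b a' b' : ℝ} (hba : b < a + 2 * Real.pi)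
    (hab' : a' ≤ b') (hba' : b' < a' + 2 * Real.pi)
    (hX : ∀ z ∈ arcCC (Circle.exp a) (Circle.exp b),
      X.onCircle z ∈ arcCC (Circle.exp a') (Circle.exp b')) {z : Circle} (hab : a ≤ b)
    (hz : z ∈ arcCC (Circle.exp a) (Circle.exp b)) (h : X.onCircle z = Circle.exp a') :
    z = Circle.exp a := by
  rw [arcCC_exp hab hba] at hz
  obtain ⟨t, ht, rfl⟩ := hz
  have h1 := X.lift_onCircle_le hba hab' hba' hX le_rfl ht.1 ht.2
  rw [h, lift_exp le_rfl (by linarith [Real.pi_pos])] at h1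
  have h2 := exp_lift a' (X.onCircle (Circle.exp a))
  rw [le_antisymm h1 (le_lift _ _), ← h] at h2
  exact X.onCircle_injective h2

theorem SU11.eq_right_of_onCircle_eq_right (X : SU11) {a b a' b' : ℝ}
    (hba : b < a + 2 * Real.pi) (hab' : a' ≤ b') (hba' : b' < a' + 2 * Real.pi)
    (hX : ∀ z ∈ arcCC (Circle.exp a) (Circle.exp b),
      X.onCircle z ∈ arcCC (Circle.exp a') (Circle.exp b')) {z : Circle} (hab : a ≤ b)
    (hz : z ∈ arcCC (Circle.exp a) (Circle.exp b)) (h : X.onCircle z = Circle.exp b') :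
    z = Circle.exp b := by
  have hb := (mem_arcCC_iff_lift hab' hba').1 (hX _ (exp_mem_arcCC hba hab le_rfl))
  rw [arcCC_exp hab hba] at hz
  obtain ⟨t, ht, rfl⟩ := hz
  have h1 := X.lift_onCircle_le hba hab' hba' hX ht.1 ht.2 le_rfl
  rw [h, lift_exp hab' hba'] at h1
  have h2 := exp_lift a' (X.onCircle (Circle.exp b))
  rw [le_antisymm hb h1, ← h] at h2
  exact X.onCircle_injective h2

/-- A system of equations `G j = S j (G (s j))` between points of given arcs, where `S j` maps the
arc number `s j` into the arc number `j`, has a solution. -/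
theorem exists_arc_system_solution {ι : Type*} (a b : ι → ℝ) (hab : ∀ j, a j ≤ b j)
    (hba : ∀ j, b j < a j + 2 * Real.pi) (s : ι → ι) (S : ι → SU11)
    (hS : ∀ j, ∀ z ∈ arcCC (Circle.exp (a (s j))) (Circle.exp (b (s j))),
      (S j).onCircle z ∈ arcCC (Circle.exp (a j)) (Circle.exp (b j))) :
    ∃ G : ι → Circle, ∀ j, G j ∈ arcCC (Circle.exp (a j)) (Circle.exp (b j)) ∧
      G j = (S j).onCircle (G (s j)) := by
  have : ∀ j, Fact (a j ≤ b j) := fun j => ⟨hab j⟩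
  -- In real coordinates the right-hand sides form a monotone self-map of a product of closed
  -- intervals, a complete lattice, so Knaster–Tarski applies.
  let Φ : (∀ j, Icc (a j) (b j)) →o (∀ j, Icc (a j) (b j)) :=
    { toFun := fun x j => ⟨lift (a j) ((S j).onCircle (Circle.exp (x (s j) : ℝ))),
        le_lift _ _, (mem_arcCC_iff_lift (hab j) (hba j)).1
          (hS j _ (exp_mem_arcCC (hba _) (x (s j)).2.1 (x (s j)).2.2))⟩
      monotone' := fun x y hxy j => (S j).lift_onCircle_le (hba _) (hab j) (hba j) (hS j)
        (x (s j)).2.1 (hxy (s j)) (y (s j)).2.2 }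
  have hfix := Φ.map_lfp
  generalize OrderHom.lfp Φ = x at hfix
  refine ⟨fun j => Circle.exp (x j : ℝ), fun j => ⟨exp_mem_arcCC (hba j) (x j).2.1 (x j).2.2, ?_⟩⟩
  conv_lhs => rw [← hfix]
  exact exp_lift _ _

/-- A Moebius transformation that maps an arc into itself has a fixed point there. -/
theorem SU11.exists_fixed_point (X : SU11) {a b : ℝ} (hab : a ≤ b) (hba : b < a + 2 * Real.pi)
    (hX : ∀ z ∈ arcCC (Circle.exp a) (Circle.exp b),
      X.onCircle z ∈ arcCC (Circle.exp a) (Circle.exp b)) :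
    ∃ z ∈ arcCC (Circle.exp a) (Circle.exp b), X.onCircle z = z := by
  obtain ⟨G, hG⟩ := exists_arc_system_solution (fun _ : Unit => a) (fun _ => b) (fun _ => hab)
    (fun _ => hba) id (fun _ => X) (fun _ => hX)
  exact ⟨G (), (hG ()).1, (hG ()).2.symm⟩

/-- If a Moebius transformation maps an arc into its interior, then it has a fixed point outside of
the arc. -/
theorem SU11.exists_fixed_point_notMem (X : SU11) {a b : ℝ} (hab : a < b)
    (hba : b < a + 2 * Real.pi)
    (hX : ∀ z ∈ arcCC (Circle.exp a) (Circle.exp b),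
      X.onCircle z ∈ arcCC (Circle.exp a) (Circle.exp b))
    (hXa : X.onCircle (Circle.exp a) ≠ Circle.exp a)
    (hXb : X.onCircle (Circle.exp b) ≠ Circle.exp b) :
    ∃ z ∉ arcCC (Circle.exp a) (Circle.exp b), X.onCircle z = z := by
  have hcompl : ∀ z, z ∈ arcCC (Circle.exp b) (Circle.exp a) ↔
      z ∉ arcCC (Circle.exp a) (Circle.exp b) ∨ z = Circle.exp a ∨ z = Circle.exp b := by
    intro z
    rw [← Circle.exp_add_two_pi a, mem_arcCC_iff_lift hba.le (by linarith), Circle.exp_add_two_pi,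
      mem_arcCC_iff_lift hab.le hba]
    have h1 := le_lift a z
    have h2 := lift_lt a z
    have h3 := exp_lift a z
    generalize lift a z = t at *
    subst h3
    rcases lt_trichotomy t b with h | h | h
    · rw [← Circle.exp_add_two_pi t, lift_exp (by linarith) (by linarith), Circle.exp_add_two_pi]
      constructor
      · intro h'
        rw [show t = a by linarith]
        simp
      · rintro (h' | h' | h')
        · exact absurd h.le h'
        · rw [eq_of_exp_eq (c := a) h' h1 h2 le_rfl (by linarith)]
        · exact absurd (eq_of_exp_eq (c := a) h' h1 h2 hab.le hba) h.ne
    · subst h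
      rw [lift_exp le_rfl (by linarith)]
      simp [hba.le]
    · rw [lift_exp h.le (by linarith)]
      simp [h, h2.le]
  -- The inverse maps the complementary closed arc off the original arc, hence into itself, and so
  -- has a fixed point there. The endpoints are covered because `X` could reach one of them only
  -- from itself.
  have hX' : ∀ z ∈ arcCC (Circle.exp b) (Circle.exp a),
      X⁻¹.onCircle z ∉ arcCC (Circle.exp a) (Circle.exp b) := by
    intro z hz hz'
    have h := hX _ hz'
    rw [X.onCircle_inv_onCircle] at h
    rcases (hcompl z).1 hz with h' | rfl | rfl
    · exact h' h
    · have := X.eq_left_of_onCircle_eq_left hba hab.le hba hX hab.le hz' (by simp)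
      rw [← this, X.onCircle_inv_onCircle] at hXa
      exact hXa this.symm
    · have := X.eq_right_of_onCircle_eq_right hba hab.le hba hX hab.le hz' (by simp)
      rw [← this, X.onCircle_inv_onCircle] at hXb
      exact hXb this.symm
  obtain ⟨z, hz, hfix⟩ := X⁻¹.exists_fixed_point (a := b) (b := a + 2 * Real.pi) hba.le
    (by linarith) (by
      rw [Circle.exp_add_two_pi]
      exact fun z hz => (hcompl _).2 (Or.inl (hX' z hz)))
  rw [Circle.exp_add_two_pi] at hz
  have h := hX' z hz
  rw [hfix] at h
  refine ⟨z, h, ?_⟩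
  conv_lhs => rw [← hfix]
  rw [X.onCircle_inv_onCircle]

/-! ### Existence and uniqueness of the corner values -/

namespace SurfacePolygon

variable {g : ℕ}

/-- `X` maps `[P i, P (i+1)]` into `[P j, P (j+1)]`, not onto, and if it maps an endpoint of the
first arc to the corresponding endpoint of the second one, then it also maps the other endpoint of
the corresponding side geodesic accordingly. -/
structure ArcStep (M : SurfacePolygon g) (X : SU11) (i j : SideIndex g) : Prop where
  mapsTo : ∀ z ∈ arcCC (M.P i) (M.P (i + 1)), X.onCircle z ∈ arcCC (M.P j) (M.P (j + 1))
  left : X.onCircle (M.P i) = M.P j → X.onCircle (M.Q (i + 1)) = M.Q (j + 1)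
  right : X.onCircle (M.P (i + 1)) = M.P (j + 1) → X.onCircle (M.Q (i + 2)) = M.Q (j + 2)
  strict : X.onCircle (M.P i) ≠ M.P j ∨ X.onCircle (M.P (i + 1)) ≠ M.P (j + 1)

theorem exists_lift_P (hg : 2 ≤ g) (M : SurfacePolygon g) (i : SideIndex g) :
    ∃ a q b c d : ℝ, a < q ∧ q < b ∧ b < c ∧ c < d ∧ d < a + 2 * Real.pi ∧ Circle.exp a = M.P i ∧
      Circle.exp q = M.Q i ∧ Circle.exp b = M.P (i + 1) ∧ Circle.exp c = M.Q (i + 1) ∧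
      Circle.exp d = M.Q (i + 2) := by
  have hI := M.isInterlacedLift hg
  obtain ⟨s, rfl⟩ := ZMod.intCast_surjective i
  refine ⟨_, _, _, _, _, hI.p_lt_q s, hI.q_lt_p s, hI.p_lt_q (s + 1),
    hI.strictMono_q (show s + 1 < s + 2 by omega), ?_, hI.liftP.exp_eq _, hI.liftQ.exp_eq _,
    ?_, ?_, ?_⟩
  · rw [← hI.liftP.add_period]
    exact hI.q_lt_p_of_lt (by omega)
  · rw [hI.liftP.exp_eq]; push_cast; rfl
  · rw [hI.liftQ.exp_eq]; push_cast; rfl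
  · rw [hI.liftQ.exp_eq]; push_cast; rfl

namespace ArcStep

variable {M : SurfacePolygon g} {X Y : SU11} {i j k : SideIndex g}

theorem eq_left (hg : 2 ≤ g) (h : M.ArcStep X i j) {z : Circle}
    (hz : z ∈ arcCC (M.P i) (M.P (i + 1))) (hXz : X.onCircle z = M.P j) : z = M.P i := by
  obtain ⟨a, q, b, c, d, h1, h2, h3, h4, h5, e1, e2, e3, -, -⟩ := M.exists_lift_P hg i
  obtain ⟨a', q', b', c', d', h1', h2', h3', h4', h5', e1', e2', e3', -, -⟩ := M.exists_lift_P hg j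
  have hm := h.mapsTo
  rw [← e1, ← e3, ← e1', ← e3'] at hm
  rw [← e1, ← e3] at hz
  rw [← e1'] at hXz
  rw [← e1]
  exact X.eq_left_of_onCircle_eq_left (by linarith) (by linarith) (by linarith) hm (by linarith)
    hz hXz

theorem eq_right (hg : 2 ≤ g) (h : M.ArcStep X i j) {z : Circle}
    (hz : z ∈ arcCC (M.P i) (M.P (i + 1))) (hXz : X.onCircle z = M.P (j + 1)) :
    z = M.P (i + 1) := by
  obtain ⟨a, q, b, c, d, h1, h2, h3, h4, h5, e1, e2, e3, -, -⟩ := M.exists_lift_P hg i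
  obtain ⟨a', q', b', c', d', h1', h2', h3', h4', h5', e1', e2', e3', -, -⟩ := M.exists_lift_P hg j
  have hm := h.mapsTo
  rw [← e1, ← e3, ← e1', ← e3'] at hm
  rw [← e1, ← e3] at hz
  rw [← e3'] at hXz
  rw [← e3]
  exact X.eq_right_of_onCircle_eq_right (by linarith) (by linarith) (by linarith) hm (by linarith)
    hz hXz

/-- By monotonicity a composition reaches an endpoint at an endpoint only if both factors do, so the
endpoint conditions pass from the factors to the product. -/
theorem mul (hg : 2 ≤ g) (hX : M.ArcStep X i j) (hY : M.ArcStep Y k i) :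
    M.ArcStep (X * Y) k j := by
  have hl : (X * Y).onCircle (M.P k) = M.P j →
      Y.onCircle (M.P k) = M.P i ∧ X.onCircle (M.P i) = M.P j := by
    intro h
    rw [SU11.onCircle_mul] at h
    have h1 := hX.eq_left hg (hY.mapsTo _ (left_mem_arcCC _ _)) h
    exact ⟨h1, by rwa [h1] at h⟩
  have hr : (X * Y).onCircle (M.P (k + 1)) = M.P (j + 1) →
      Y.onCircle (M.P (k + 1)) = M.P (i + 1) ∧ X.onCircle (M.P (i + 1)) = M.P (j + 1) := by
    intro h
    rw [SU11.onCircle_mul] at h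
    have h1 := hX.eq_right hg (hY.mapsTo _ (right_mem_arcCC _ _)) h
    exact ⟨h1, by rwa [h1] at h⟩
  refine ⟨fun z hz => ?_, fun h => ?_, fun h => ?_, ?_⟩
  · rw [SU11.onCircle_mul]
    exact hX.mapsTo _ (hY.mapsTo _ hz)
  · rw [SU11.onCircle_mul, hY.left (hl h).1, hX.left (hl h).2]
  · rw [SU11.onCircle_mul, hY.right (hr h).1, hX.right (hr h).2]
  · rcases hX.strict with h | h
    · exact Or.inl fun h' => h (hl h').2
    · exact Or.inr fun h' => h (hr h').2

/-- A self-map of an arc of this kind has only one fixed point in the arc. -/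
theorem fixed_point_unique (hg : 2 ≤ g) (h : M.ArcStep X i i) {x y : Circle}
    (hx : x ∈ arcCC (M.P i) (M.P (i + 1))) (hy : y ∈ arcCC (M.P i) (M.P (i + 1)))
    (hXx : X.onCircle x = x) (hXy : X.onCircle y = y) : x = y := by
  obtain ⟨a, q, b, c, d, h1, h2, h3, h4, h5, e1, e2, e3, e4, e5⟩ := M.exists_lift_P hg i
  by_contra hxy
  -- A third fixed point would make `X` act as the identity, against `strict`. If an endpoint of the
  -- arc is fixed, so is the other endpoint of the corresponding side geodesic, which lies outside;
  -- otherwise `exists_fixed_point_notMem` applies.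
  suffices hz : ∃ z ∉ arcCC (M.P i) (M.P (i + 1)), X.onCircle z = z by
    obtain ⟨z, hz, hXz⟩ := hz
    have hid := SU11.onCircle_eq_self_of_three hXx hXy hXz hxy
      (fun e => hz (e ▸ hx)) (fun e => hz (e ▸ hy))
    rcases h.strict with h | h <;> exact h (hid _)
  have hout : ∀ t, b < t → t < a + 2 * Real.pi →
      Circle.exp t ∉ arcCC (M.P i) (M.P (i + 1)) := by
    intro t ht1 ht2
    rw [← e1, ← e3, mem_arcCC_iff_lift (by linarith) (by linarith), lift_exp (by linarith) ht2]
    linarith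
  by_cases hl : X.onCircle (M.P i) = M.P i
  · exact ⟨_, e4 ▸ hout c h3 (by linarith), h.left hl⟩
  by_cases hr : X.onCircle (M.P (i + 1)) = M.P (i + 1)
  · exact ⟨_, e5 ▸ hout d (by linarith) (by linarith), h.right hr⟩
  have hm := h.mapsTo
  rw [← e1, ← e3] at *
  exact X.exists_fixed_point_notMem (by linarith) (by linarith) hm hl hr

end ArcStep

/-- A system `G j = S j (G (s j))` along such maps has at most one solution. -/
theorem eq_of_arcStep (hg : 2 ≤ g) (M : SurfacePolygon g) {s : SideIndex g → SideIndex g}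
    {S : SideIndex g → SU11} (hS : ∀ j, M.ArcStep (S j) (s j) j) {G G' : SideIndex g → Circle}
    (hG : ∀ j, G j ∈ arcCC (M.P j) (M.P (j + 1)) ∧ G j = (S j).onCircle (G (s j)))
    (hG' : ∀ j, G' j ∈ arcCC (M.P j) (M.P (j + 1)) ∧ G' j = (S j).onCircle (G' (s j))) :
    G = G' := by
  have : NeZero (8 * g - 4) := ⟨by omega⟩
  have hword : ∀ n j, ∃ X, M.ArcStep X (s^[n + 1] j) j ∧
      G j = X.onCircle (G (s^[n + 1] j)) ∧ G' j = X.onCircle (G' (s^[n + 1] j)) := by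
    intro n
    induction n with
    | zero => exact fun j => ⟨S j, hS j, (hG j).2, (hG' j).2⟩
    | succ n ih =>
      intro j
      obtain ⟨X, hX, h1, h2⟩ := ih j
      have e := Function.iterate_succ_apply' s (n + 1) j
      refine ⟨X * S (s^[n + 1] j), ?_, ?_, ?_⟩
      · rw [e]
        exact hX.mul hg (hS _)
      · rw [e, SU11.onCircle_mul, ← (hG _).2, h1]
      · rw [e, SU11.onCircle_mul, ← (hG' _).2, h2]
  have hper : ∀ n j, s^[n + 1] j = j → G j = G' j := by
    intro n j hn
    obtain ⟨X, hX, h1, h2⟩ := hword n j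
    rw [hn] at hX h1 h2
    exact hX.fixed_point_unique hg (hG j).1 (hG' j).1 h1.symm h2.symm
  funext j
  -- The index set is finite, so the orbit of `j` runs into a cycle. The solutions agree on the
  -- cycle and the equations carry the agreement back to `j`.
  obtain ⟨m, n, hmn, heq⟩ := Finite.exists_ne_map_eq_of_infinite fun n : ℕ => s^[n] j
  wlog hlt : m < n generalizing m n
  · exact this n m hmn.symm heq.symm (by omega)
  obtain ⟨r, rfl⟩ : ∃ r, n = r + 1 + m := ⟨n - m - 1, by omega⟩
  have h1 : G (s^[m] j) = G' (s^[m] j) := by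
    refine hper r _ ?_
    simp only [Function.iterate_add_apply _ (r + 1) m] at heq
    exact heq.symm
  rcases m with _ | m
  · exact h1
  · obtain ⟨X, -, h2, h3⟩ := hword m j
    rw [h2, h3, h1]

theorem exists_of_arcStep (hg : 2 ≤ g) (M : SurfacePolygon g) {s : SideIndex g → SideIndex g}
    {S : SideIndex g → SU11} (hS : ∀ j, M.ArcStep (S j) (s j) j) : ∃ G : SideIndex g → Circle,
    ∀ j, G j ∈ arcCC (M.P j) (M.P (j + 1)) ∧ G j = (S j).onCircle (G (s j)) := by
  choose a q b c d h1 h2 h3 h4 h5 e1 e2 e3 e4 e5 using M.exists_lift_P hg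
  have h := exists_arc_system_solution a b (fun j => ((h1 j).trans (h2 j)).le)
    (fun j => ((h3 j).trans (h4 j)).trans (h5 j)) s S (by
      simp only [e1, e3]
      exact fun j => (hS j).mapsTo)
  simpa only [e1, e3] using h

theorem P_ne_Q (hg : 2 ≤ g) (M : SurfacePolygon g) (i : SideIndex g) : M.P i ≠ M.Q i := by
  obtain ⟨a, q, b, c, d, h1, h2, h3, h4, h5, e1, e2, e3, e4, e5⟩ := M.exists_lift_P hg i
  rw [← e1, ← e2]
  intro h
  have := eq_of_exp_eq (c := a) h le_rfl (by linarith) h1.le (by linarith)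
  linarith

theorem Q_ne_P_add_one (hg : 2 ≤ g) (M : SurfacePolygon g) (i : SideIndex g) :
    M.Q i ≠ M.P (i + 1) := by
  obtain ⟨a, q, b, c, d, h1, h2, h3, h4, h5, e1, e2, e3, e4, e5⟩ := M.exists_lift_P hg i
  rw [← e2, ← e3]
  intro h
  have := eq_of_exp_eq (c := a) h h1.le (by linarith) (by linarith) (by linarith)
  linarith

theorem arcCC_P_Q_subset (hg : 2 ≤ g) (M : SurfacePolygon g) (i : SideIndex g) :
    arcCC (M.P i) (M.Q i) ⊆ arcCC (M.P i) (M.P (i + 1)) := by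
  obtain ⟨a, q, b, c, d, h1, h2, h3, h4, h5, e1, e2, e3, e4, e5⟩ := M.exists_lift_P hg i
  rw [← e1, ← e2, ← e3]
  exact arcCC_exp_subset le_rfl h1.le h2.le (by linarith)

theorem arcCC_Q_P_subset (hg : 2 ≤ g) (M : SurfacePolygon g) (i : SideIndex g) :
    arcCC (M.Q i) (M.P (i + 1)) ⊆ arcCC (M.P i) (M.P (i + 1)) := by
  obtain ⟨a, q, b, c, d, h1, h2, h3, h4, h5, e1, e2, e3, e4, e5⟩ := M.exists_lift_P hg i
  rw [← e1, ← e2, ← e3]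
  exact arcCC_exp_subset h1.le h2.le le_rfl (by linarith)

/-- `T i` maps `[P (i-2), P (i-1)]` and `[Q (i+2), Q (i+3)]` into `[Q (σ i), P (σ i + 1)]`. -/
theorem T_mem_arcCC_Q_P (hg : 2 ≤ g) (M : SurfacePolygon g) (i : SideIndex g) :
    (∀ z ∈ arcCC (M.P (i - 2)) (M.P (i - 1)), (M.T i).onCircle z ∈
      arcCC (M.Q (sidePairing g i)) (M.P (sidePairing g i + 1))) ∧
    (∀ z ∈ arcCC (M.Q (i + 2)) (M.Q (i + 3)), (M.T i).onCircle z ∈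
      arcCC (M.Q (sidePairing g i)) (M.P (sidePairing g i + 1))) := by
  have hI := M.isInterlacedLift hg
  simp only [← M.T_Q_add_two hg, ← M.T_P_sub_one hg, SU11.onCircle_mem_arcCC]
  obtain ⟨s, rfl⟩ := ZMod.intCast_surjective i
  have e1 : Circle.exp (M.cutLift M.P (s - 2 + (8 * g - 4 : ℕ))) = M.P (s - 2) := by
    rw [hI.liftP.exp_eq]; push_cast; simp
  have e2 : Circle.exp (M.cutLift M.P (s - 1 + (8 * g - 4 : ℕ))) = M.P (s - 1) := by
    rw [hI.liftP.exp_eq]; push_cast; simp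
  have e3 : Circle.exp (M.cutLift M.Q (s + 2)) = M.Q (s + 2) := by
    rw [hI.liftQ.exp_eq]; push_cast; rfl
  have e4 : Circle.exp (M.cutLift M.Q (s + 3)) = M.Q (s + 3) := by
    rw [hI.liftQ.exp_eq]; push_cast; rfl
  rw [← e1, ← e2, ← e3, ← e4]
  have l0 := hI.strictMono_q (show s + 2 < s + 3 by omega)
  have l1 := hI.q_lt_p_of_lt (show s + 2 < s - 2 + (8 * g - 4 : ℕ) by omega)
  have l2 := hI.strictMono_p (show s - 2 + (8 * g - 4 : ℕ) < s - 1 + (8 * g - 4 : ℕ) by omega)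
  have l3 := hI.q_lt_p_of_lt (show s + 3 < s - 1 + (8 * g - 4 : ℕ) by omega)
  have l4 := hI.p_lt_q_of_le (show s - 1 + (8 * g - 4 : ℕ) ≤ s + 2 + (8 * g - 4 : ℕ) by omega)
  rw [hI.liftQ.add_period] at l4
  exact ⟨fun z hz => arcCC_exp_subset l1.le l2.le le_rfl l4 hz,
    fun z hz => arcCC_exp_subset le_rfl l0.le l3.le l4 hz⟩

/-- The image lies in [Q_σ, P_{σ+1}], so the left endpoint is never reached; the right one is, and
then `T_Q` gives the condition on the side geodesic. -/
theorem arcStep_of_P (hg : 2 ≤ g) (M : SurfacePolygon g) (i : SideIndex g) :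
    M.ArcStep (M.T i) (i - 2) (sidePairing g i) := by
  have e1 : i - 2 + 1 = i - 1 := by ring
  have hne : (M.T i).onCircle (M.P (i - 2)) ≠ M.P (sidePairing g i) := by
    intro h
    have h' := (M.T_mem_arcCC_Q_P hg i).1 _ (left_mem_arcCC _ _)
    rw [h] at h'
    obtain ⟨a, q, b, c, d, h1, h2, h3, h4, h5, e1, e2, e3, e4, e5⟩ :=
      M.exists_lift_P hg (sidePairing g i)
    rw [← e1, ← e2, ← e3, arcCC_exp h2.le (by linarith)] at h'
    obtain ⟨t, ht, ht'⟩ := h'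
    have := eq_of_exp_eq (c := a) ht' (by linarith [ht.1]) (by linarith [ht.2]) le_rfl (by linarith)
    linarith [ht.1]
  refine ⟨fun z hz => ?_, fun h => absurd h hne, fun _ => ?_, Or.inl hne⟩
  · rw [e1] at hz
    exact M.arcCC_Q_P_subset hg _ ((M.T_mem_arcCC_Q_P hg i).1 z hz)
  · rw [sub_add_cancel, T_Q hg]

theorem T_oppositeSide_mem (hg : 2 ≤ g) (M : SurfacePolygon g) (i : SideIndex g) {z : Circle}
    (hz : z ∈ arcCC (M.P (oppositeSide g i)) (M.P (oppositeSide g i + 1))) :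
    (M.T (oppositeSide g i + 1)).onCircle z
      ∈ arcCC (M.P (sidePairing g i)) (M.Q (sidePairing g i)) := by
  have h1 := M.T_P_sub_one hg (oppositeSide g i + 1)
  have h2 := M.T_P hg (oppositeSide g i + 1)
  rw [sidePairing_oppositeSide_add_one hg, sub_add_cancel] at h1 h2
  rw [add_sub_cancel_right] at h1
  rw [← h1, ← h2, SU11.onCircle_mem_arcCC]
  exact hz

/-- Mirror case of `arcStep_of_P`: the image is exactly [P_σ, Q_σ], so the left endpoint is reached
and the right one is not. -/
theorem arcStep_of_Q (hg : 2 ≤ g) (M : SurfacePolygon g) (i : SideIndex g) :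
    M.ArcStep (M.T (oppositeSide g i + 1)) (oppositeSide g i) (sidePairing g i) := by
  have h2 := M.T_P hg (oppositeSide g i + 1)
  have h3 := M.T_Q hg (oppositeSide g i + 1)
  rw [sidePairing_oppositeSide_add_one hg] at h2 h3
  rw [sub_add_cancel] at h2
  have hne : (M.T (oppositeSide g i + 1)).onCircle (M.P (oppositeSide g i + 1)) ≠
      M.P (sidePairing g i + 1) := by
    rw [h2]
    exact M.Q_ne_P_add_one hg _
  refine ⟨fun z hz => M.arcCC_P_Q_subset hg _ (M.T_oppositeSide_mem hg i hz), fun h => ?_,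
    fun h => absurd h hne, Or.inr hne⟩
  rw [h3]
  congr 1
  ring

open Classical in
/-- The index on which the corner value number `j` depends. -/
noncomputable def cornerSource (M : SurfacePolygon g) (A : SideIndex g → Circle)
    (j : SideIndex g) : SideIndex g :=
  if A (sidePairing g j) = M.P (sidePairing g j) then sidePairing g j - 2
  else oppositeSide g (sidePairing g j)

open Classical in
/-- The transformation by which the corner value number `j` is obtained from another one. -/
noncomputable def cornerStep (M : SurfacePolygon g) (A : SideIndex g → Circle)
    (j : SideIndex g) : SU11 :=
  if A (sidePairing g j) = M.P (sidePairing g j) then M.T (sidePairing g j)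
  else M.T (oppositeSide g (sidePairing g j) + 1)

theorem arcStep_cornerStep (hg : 2 ≤ g) (M : SurfacePolygon g) (A : SideIndex g → Circle)
    (j : SideIndex g) : M.ArcStep (M.cornerStep A j) (M.cornerSource A j) j := by
  unfold cornerStep cornerSource
  split
  · have h := M.arcStep_of_P hg (sidePairing g j)
    rwa [sidePairing_sidePairing hg] at h
  · have h := M.arcStep_of_Q hg (sidePairing g j)
    rwa [sidePairing_sidePairing hg] at h

/-- As σ is an involution and P_i ≠ Q_i, every unknown is the left side of exactly one equation, so
the system is a fixed-point problem of the kind just solved. -/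
theorem isCornerSolution_iff (hg : 2 ≤ g) (M : SurfacePolygon g) {A : SideIndex g → Circle}
    (hA : M.IsExtremal A) (G : SideIndex g → Circle) : M.IsCornerSolution A G ↔
      ∀ j, G j ∈ arcCC (M.P j) (M.P (j + 1)) ∧
        G j = (M.cornerStep A j).onCircle (G (M.cornerSource A j)) := by
  unfold cornerStep cornerSource
  constructor
  · intro h j
    refine ⟨(h j).1, ?_⟩
    obtain ⟨-, h1, h2⟩ := h (sidePairing g j)
    rw [sidePairing_sidePairing hg] at h1 h2
    split
    · exact h1 ‹_›
    · exact h2 ((hA _).resolve_left ‹_›)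
  · intro h i
    refine ⟨(h i).1, fun hP => ?_, fun hQ => ?_⟩
    · have h1 := (h (sidePairing g i)).2
      rwa [sidePairing_sidePairing hg, if_pos hP, if_pos hP] at h1
    · have hP : A i ≠ M.P i := by
        rw [hQ]
        exact (M.P_ne_Q hg i).symm
      have h1 := (h (sidePairing g i)).2
      rwa [sidePairing_sidePairing hg, if_neg hP, if_neg hP] at h1

theorem existsUnique_isCornerSolution (hg : 2 ≤ g) (M : SurfacePolygon g)
    {A : SideIndex g → Circle} (hA : M.IsExtremal A) :
    ∃! G : SideIndex g → Circle, M.IsCornerSolution A G := by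
  obtain ⟨G, hG⟩ := M.exists_of_arcStep hg (M.arcStep_cornerStep hg A)
  refine ⟨G, (M.isCornerSolution_iff hg hA G).2 hG, fun G' hG' => ?_⟩
  exact M.eq_of_arcStep hg (M.arcStep_cornerStep hg A) ((M.isCornerSolution_iff hg hA G').1 hG') hG

end SurfacePolygon

/-! ### Images and cyclic order of the corner values -/

theorem IsCyclicLift.lift {N : ℕ} {P : ZMod N → Circle} {p : ℤ → ℝ} (h : IsCyclicLift P p)
    (X : ZMod N → Circle) : IsCyclicLift X fun s => lift (p s) (X s) where
  exp_eq s := exp_lift _ _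
  add_period s := by
    rw [h.add_period, lift_add_two_pi]
    simp

/-- Real lifts of five interlaced cyclic families, in the order
`P s ≤ B s ≤ Q s ≤ H s ≤ B (s+1)`, `B s ≤ G s ≤ P (s+1)`. -/
structure IsCornerLift {N : ℕ} (P Q B G H : ZMod N → Circle) (p q β γ η : ℤ → ℝ) : Prop
    extends IsInterlacedLift P Q p q where
  twelve_le : 12 ≤ N
  liftB : IsCyclicLift B β
  liftG : IsCyclicLift G γ
  liftH : IsCyclicLift H η
  p_le_β : ∀ s, p s ≤ β s
  β_le_q : ∀ s, β s ≤ q s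
  β_le_γ : ∀ s, β s ≤ γ s
  γ_le_p : ∀ s, γ s ≤ p (s + 1)
  q_le_η : ∀ s, q s ≤ η s
  η_le_β : ∀ s, η s ≤ β (s + 1)

namespace SurfacePolygon

variable {g : ℕ}

theorem oppositeSide_sidePairing_sidePairing_add_one (hg : 2 ≤ g) (i : SideIndex g) :
    oppositeSide g (sidePairing g (sidePairing g i + 1)) = i - 1 := by
  have h := sidePairing_oppositeSide_add_one hg (oppositeSide g (i - 1))
  rw [oppositeSide_oppositeSide hg, sub_add_cancel] at h
  rw [h, sub_add_cancel, sidePairing_sidePairing hg, oppositeSide_oppositeSide hg]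

/-- The left ends `B j` of the vertical strips into which the natural extension cuts its image. -/
noncomputable def stripCorner (M : SurfacePolygon g) (G : SideIndex g → Circle)
    (j : SideIndex g) : Circle :=
  (M.T (oppositeSide g (sidePairing g j) + 1)).onCircle (G (oppositeSide g (sidePairing g j)))

/-- With `T_lowerCorner_add_one` this identifies the image under `T i` of the section [H_{i+1},
G_{i-1}] as the whole base of vertical strip σ(i). -/
theorem T_G_sub_one (hg : 2 ≤ g) (M : SurfacePolygon g) (G : SideIndex g → Circle)
    (i : SideIndex g) :
    (M.T i).onCircle (G (i - 1)) = M.stripCorner G (sidePairing g i + 1) := by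
  rw [stripCorner, oppositeSide_sidePairing_sidePairing_add_one hg, sub_add_cancel]

theorem lowerCorner_eq (hg : 2 ≤ g) (M : SurfacePolygon g) (G : SideIndex g → Circle)
    (j : SideIndex g) : M.lowerCorner G j =
      (M.T (sidePairing g (j - 1))).onCircle (M.stripCorner G (sidePairing g (j - 1))) := by
  have h : oppositeSide g (j - 1) = oppositeSide g j - 1 := by
    rw [oppositeSide, oppositeSide]
    ring
  rw [lowerCorner, cornerMap, SU11.onCircle_mul, stripCorner, sidePairing_sidePairing hg, h,
    sub_add_cancel]

theorem T_lowerCorner_add_one (hg : 2 ≤ g) (M : SurfacePolygon g) (G : SideIndex g → Circle)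
    (i : SideIndex g) :
    (M.T i).onCircle (M.lowerCorner G (i + 1)) = M.stripCorner G (sidePairing g i) := by
  rw [lowerCorner_eq hg, add_sub_cancel_right, T_T_sidePairing hg]

/-- `T i = U (σ i) ∘ T (i + 1)`. -/
theorem cornerMap_T_add_one (hg : 2 ≤ g) (M : SurfacePolygon g) (i : SideIndex g) (x : Circle) :
    (M.cornerMap (sidePairing g i)).onCircle ((M.T (i + 1)).onCircle x)
      = (M.T i).onCircle x := by
  have h := M.T_cycle_onCircle (i + 1) x
  have e1 : vertexMap g (i + 1) = oppositeSide g (sidePairing g i) := by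
    rw [vertexMap, oppositeSide_sidePairing hg]
  have e2 : vertexMap g (oppositeSide g (sidePairing g i))
      = sidePairing g (sidePairing g i - 1) := by
    rw [vertexMap, sidePairing_oppositeSide hg]
  rw [e1, e2, vertexMap_sidePairing hg, sub_add_cancel, sidePairing_sidePairing hg] at h
  rw [cornerMap, SU11.onCircle_mul]
  exact h

theorem lowerCorner_sidePairing (hg : 2 ≤ g) (M : SurfacePolygon g) (G : SideIndex g → Circle)
    (i : SideIndex g) : M.lowerCorner G (sidePairing g i) =
      (M.cornerMap (sidePairing g i)).onCircle (G (sidePairing g (i + 1))) := by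
  rw [lowerCorner, oppositeSide_sidePairing hg, add_sub_cancel_right]

/-- The cycle relation started at τ(i). It serves the exceptional points w = P_i = A_i of the closed
domain, where `T i` acts on the section starting at H_i. -/
theorem T_lowerCorner (hg : 2 ≤ g) (M : SurfacePolygon g) (G : SideIndex g → Circle)
    (i : SideIndex g) : (M.T i).onCircle (M.lowerCorner G i) =
      (M.T (sidePairing g (sidePairing g i + 1))).onCircle
        (G (sidePairing g (sidePairing g i + 1))) := by
  have h := M.T_cycle_onCircle (oppositeSide g i) (G (oppositeSide g i - 1))
  have e1 : vertexMap g (oppositeSide g i) = sidePairing g (i - 1) := by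
    rw [vertexMap, sidePairing_oppositeSide hg]
  have e2 : oppositeSide g i - 1 = sidePairing g (sidePairing g i + 1) := by
    have h1 := oppositeSide_sidePairing_sidePairing_add_one hg i
    rw [← oppositeSide_oppositeSide hg (sidePairing g (sidePairing g i + 1)), h1]
    rw [oppositeSide, oppositeSide]
    ring
  rw [e1, vertexMap_sidePairing hg, sub_add_cancel, vertexMap, e2] at h
  rw [lowerCorner, cornerMap, SU11.onCircle_mul, e2]
  exact h

theorem stripCorner_mem (hg : 2 ≤ g) (M : SurfacePolygon g) {G : SideIndex g → Circle}
    (hG : ∀ i, G i ∈ arcCC (M.P i) (M.P (i + 1))) (j : SideIndex g) :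
    M.stripCorner G j ∈ arcCC (M.P j) (M.Q j) := by
  have h := M.T_oppositeSide_mem hg (sidePairing g j) (hG (oppositeSide g (sidePairing g j)))
  rwa [sidePairing_sidePairing hg] at h

theorem lowerCorner_mem (hg : 2 ≤ g) (M : SurfacePolygon g) {G : SideIndex g → Circle}
    (hG : ∀ i, G i ∈ arcCC (M.P i) (M.P (i + 1))) (j : SideIndex g) :
    M.lowerCorner G j ∈ arcCC (M.Q j) (M.Q (j + 1)) := by
  have h1 := M.T_P hg (sidePairing g (j - 1))
  have h2 := M.T_Q hg (sidePairing g (j - 1))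
  rw [sidePairing_sidePairing hg, sub_add_cancel] at h1
  rw [sidePairing_sidePairing hg, show j - 1 + 2 = j + 1 by ring] at h2
  rw [lowerCorner_eq hg, ← h1, ← h2, SU11.onCircle_mem_arcCC]
  exact M.stripCorner_mem hg hG _

section Solution

variable {M : SurfacePolygon g} {A G : SideIndex g → Circle}

theorem IsCornerSolution.mem (h : M.IsCornerSolution A G) (i : SideIndex g) :
    G i ∈ arcCC (M.P i) (M.P (i + 1)) := (h i).1

theorem IsCornerSolution.eq_of_P (h : M.IsCornerSolution A G) {i : SideIndex g}
    (hi : A i = M.P i) : G (sidePairing g i) = (M.T i).onCircle (G (i - 2)) := (h i).2.1 hi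

theorem IsCornerSolution.eq_of_Q (hg : 2 ≤ g) (h : M.IsCornerSolution A G) {i : SideIndex g}
    (hi : A i = M.Q i) : G (sidePairing g i) = M.stripCorner G (sidePairing g i) := by
  rw [(h i).2.2 hi, stripCorner, sidePairing_sidePairing hg]

/-- In this case horizontal strip `i` has no piece over [P_{i+1}, Q_{i+1}); the equality makes the
matching piece [H_σ, B_{σ+1}) of the vertical strip empty. In the other case `lowerCorner_of_Q`
makes the two pieces correspond. -/
theorem IsCornerSolution.lowerCorner_of_P (hg : 2 ≤ g) (h : M.IsCornerSolution A G)
    {i : SideIndex g} (hi : A (i + 1) = M.P (i + 1)) :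
    M.lowerCorner G (sidePairing g i) = M.stripCorner G (sidePairing g i + 1) := by
  rw [lowerCorner_sidePairing hg, h.eq_of_P hi, cornerMap_T_add_one hg, ← T_G_sub_one hg]
  congr 2
  ring

theorem IsCornerSolution.lowerCorner_of_Q (hg : 2 ≤ g) (h : M.IsCornerSolution A G)
    {i : SideIndex g} (hi : A (i + 1) = M.Q (i + 1)) :
    M.lowerCorner G (sidePairing g i) = (M.T i).onCircle (M.lowerCorner G (i + 2)) := by
  have e := M.T_lowerCorner_add_one hg G (i + 1)
  rw [show i + 1 + 1 = i + 2 by ring] at e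
  rw [lowerCorner_sidePairing hg, h.eq_of_Q hg hi, ← cornerMap_T_add_one hg, e]

/-- Since B_j lies in [P_j, Q_j], either alternative yields the order B_j ≤ G_j. In the same way
`lowerCorner_eq_or_mem` yields H_j ≤ B_{j+1}. -/
theorem IsCornerSolution.stripCorner_eq_or_mem (hg : 2 ≤ g) (hA : M.IsExtremal A)
    (h : M.IsCornerSolution A G) (j : SideIndex g) :
    G j = M.stripCorner G j ∨ G j ∈ arcCC (M.Q j) (M.P (j + 1)) := by
  obtain ⟨i, rfl⟩ : ∃ i, j = sidePairing g i := ⟨_, (sidePairing_sidePairing hg j).symm⟩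
  rcases hA i with hi | hi
  · right
    rw [h.eq_of_P hi]
    refine (M.T_mem_arcCC_Q_P hg i).1 _ ?_
    have := h.mem (i - 2)
    rwa [show i - 2 + 1 = i - 1 by ring] at this
  · exact Or.inl (h.eq_of_Q hg hi)

theorem IsCornerSolution.lowerCorner_eq_or_mem (hg : 2 ≤ g) (hA : M.IsExtremal A)
    (h : M.IsCornerSolution A G) (j : SideIndex g) :
    M.lowerCorner G j = M.stripCorner G (j + 1) ∨
      M.lowerCorner G j ∈ arcCC (M.Q j) (M.P (j + 1)) := by
  obtain ⟨i, rfl⟩ : ∃ i, j = sidePairing g i := ⟨_, (sidePairing_sidePairing hg j).symm⟩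
  rcases hA (i + 1) with hi | hi
  · exact Or.inl (h.lowerCorner_of_P hg hi)
  · right
    rw [h.lowerCorner_of_Q hg hi]
    refine (M.T_mem_arcCC_Q_P hg i).2 _ ?_
    have := M.lowerCorner_mem hg h.mem (i + 2)
    rwa [show i + 2 + 1 = i + 3 by ring] at this

theorem IsCornerSolution.isCornerLift (hg : 2 ≤ g) (hA : M.IsExtremal A)
    (h : M.IsCornerSolution A G) : ∃ p q β γ η,
      IsCornerLift M.P M.Q (M.stripCorner G) G (M.lowerCorner G) p q β γ η := by
  have hI := M.isInterlacedLift hg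
  generalize M.cutLift M.P = p at hI
  generalize M.cutLift M.Q = q at hI
  have hN : ∀ s, p (s + 2) < p s + 2 * Real.pi := fun s => by
    rw [← hI.liftP.add_period]
    exact hI.strictMono_p (by omega)
  have l1 := hI.p_lt_q
  have l2 := hI.q_lt_p
  have l3 : ∀ s, p (s + 1) < q (s + 1) := fun s => hI.p_lt_q _
  have l4 : ∀ s, q (s + 1) < p (s + 2) := fun s => hI.q_lt_p_of_lt (by omega)
  have eP : ∀ s : ℤ, Circle.exp (p (s + 1)) = M.P (s + 1) := fun s => by
    rw [hI.liftP.exp_eq]; push_cast; rfl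
  have eQ : ∀ s : ℤ, Circle.exp (q (s + 1)) = M.Q (s + 1) := fun s => by
    rw [hI.liftQ.exp_eq]; push_cast; rfl
  have hB : ∀ s : ℤ, p s ≤ lift (p s) (M.stripCorner G s) ∧
      lift (p s) (M.stripCorner G s) ≤ q s := fun s =>
    lift_mem_Icc le_rfl (l1 s).le (by linarith [hN s, l2 s, l3 s, l4 s]) (by
      rw [hI.liftP.exp_eq, hI.liftQ.exp_eq]
      exact M.stripCorner_mem hg h.mem s)
  have hB' : ∀ s : ℤ, p (s + 1) ≤ lift (p s) (M.stripCorner G (s + 1)) ∧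
      lift (p s) (M.stripCorner G (s + 1)) ≤ q (s + 1) := fun s =>
    lift_mem_Icc (by linarith [l1 s, l2 s]) (l3 s).le (by linarith [hN s, l2 s, l3 s, l4 s]) (by
      rw [eP, eQ]
      exact M.stripCorner_mem hg h.mem _)
  -- The windows starting at `p s` and `p (s + 1)` give the same lift of B_{s+1}, which allows
  -- neighbouring indices to be compared.
  have hBB : ∀ s : ℤ, lift (p s) (M.stripCorner G (s + 1))
      = lift (p (s + 1)) (M.stripCorner G ((s + 1 : ℤ) : SideIndex g)) := fun s => by
    refine eq_of_exp_eq (c := p (s + 1)) ?_ (hB' s).1 (by linarith [hB' s, l4 s, hN s, l1 s, l2 s])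
      (hB (s + 1)).1 (lift_lt _ _)
    rw [exp_lift, exp_lift]
    push_cast
    rfl
  have hGm : ∀ s : ℤ, p s ≤ lift (p s) (G s) ∧ lift (p s) (G s) ≤ p (s + 1) := fun s =>
    lift_mem_Icc le_rfl (by linarith [l1 s, l2 s]) (by linarith [hN s, l2 s, l3 s, l4 s]) (by
      rw [hI.liftP.exp_eq, eP]
      exact h.mem s)
  have hH : ∀ s : ℤ, q s ≤ lift (p s) (M.lowerCorner G s) ∧
      lift (p s) (M.lowerCorner G s) ≤ q (s + 1) := fun s =>
    lift_mem_Icc (l1 s).le (by linarith [l2 s, l3 s]) (by linarith [hN s, l2 s, l3 s, l4 s]) (by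
      rw [hI.liftQ.exp_eq, eQ]
      exact M.lowerCorner_mem hg h.mem s)
  refine ⟨p, q, _, _, _, hI, by omega, hI.liftP.lift _, hI.liftP.lift _, hI.liftP.lift _,
    fun s => (hB s).1, fun s => (hB s).2, fun s => ?_, fun s => (hGm s).2, fun s => (hH s).1,
    fun s => ?_⟩
  · rcases h.stripCorner_eq_or_mem hg hA s with h1 | h1
    · exact (congrArg (lift (p s)) h1).ge
    · refine (hB s).2.trans (lift_mem_Icc (b := p (s + 1)) (l1 s).le (l2 s).le
        (by linarith [hN s, l2 s, l3 s, l4 s]) ?_).1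
      rwa [hI.liftQ.exp_eq, eP]
  · rw [← hBB]
    rcases h.lowerCorner_eq_or_mem hg hA s with h1 | h1
    · exact (congrArg (lift (p s)) h1).le
    · refine le_trans (lift_mem_Icc (a := q s) (l1 s).le (l2 s).le
        (by linarith [hN s, l2 s, l3 s, l4 s]) ?_).2 (hB' s).1
      rwa [hI.liftQ.exp_eq, eP]

end Solution

end SurfacePolygon

/-! ### The union of rectangles, seen by rows, by vertical strips and at its boundary -/

theorem mem_arcCO_or {a b c : ℝ} (hab : a ≤ b) (hbc : b ≤ c) (hca : c < a + 2 * Real.pi)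
    {z : Circle} : z ∈ arcCO (Circle.exp a) (Circle.exp c) ↔
      z ∈ arcCO (Circle.exp a) (Circle.exp b) ∨ z ∈ arcCO (Circle.exp b) (Circle.exp c) := by
  rw [← exp_lift a z, exp_mem_arcCO_iff le_rfl (by linarith) (by linarith) hca (le_lift _ _)
    (lift_lt _ _), exp_mem_arcCO_iff le_rfl hab (by linarith) (by linarith) (le_lift _ _)
    (lift_lt _ _), exp_mem_arcCO_iff hab hbc (by linarith) (by linarith) (le_lift _ _)
    (lift_lt _ _)]
  have := le_lift a z
  rcases lt_or_ge (lift a z) b with h | h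
  · exact ⟨fun _ => Or.inl ⟨this, h⟩, fun _ => ⟨this, by linarith⟩⟩
  · exact ⟨fun h' => Or.inr ⟨h, h'.2⟩, fun h' => ⟨this, by rcases h' with h' | h' <;> linarith [h'.2]⟩⟩

theorem notMem_arcCO_of_mem {a b c : ℝ} (hab : a ≤ b) (hbc : b ≤ c) (hca : c < a + 2 * Real.pi)
    {z : Circle} (h : z ∈ arcCO (Circle.exp a) (Circle.exp b)) :
    z ∉ arcCO (Circle.exp b) (Circle.exp c) := by
  rw [← exp_lift a z] at *
  rw [exp_mem_arcCO_iff le_rfl hab (by linarith) (by linarith) (le_lift _ _) (lift_lt _ _)] at h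
  rw [exp_mem_arcCO_iff hab hbc (by linarith) (by linarith) (le_lift _ _) (lift_lt _ _)]
  intro h'
  linarith [h.2, h'.1]

theorem exp_ne_exp {a b : ℝ} (hab : a < b) (hba : b < a + 2 * Real.pi) :
    Circle.exp a ≠ Circle.exp b := fun h =>
  hab.ne (eq_of_exp_eq (c := a) h le_rfl (by linarith) hab.le hba)

/-- A point is in a half-open arc if all its small counterclockwise translates are in the arc. -/
theorem mem_arcCO_of_eventually {x y u : Circle}
    (h : ∀ᶠ ε : ℝ in nhdsWithin 0 (Ioi 0), u * Circle.exp ε ∈ arcCC x y) : u ∈ arcCO x y := by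
  obtain ⟨a, b, hab, hba, rfl, rfl⟩ := exists_exp_of_arcCC x y
  have h2 : ∀ᶠ ε : ℝ in nhdsWithin 0 (Ioi 0), ε < a + 2 * Real.pi - lift a u :=
    Filter.Eventually.filter_mono nhdsWithin_le_nhds
      (gt_mem_nhds (by linarith [lift_lt a u]))
  obtain ⟨ε, ⟨h3, h4⟩, h5⟩ := ((h.and h2).and self_mem_nhdsWithin).exists
  have h5 : 0 < ε := h5
  have h6 := le_lift a u
  rw [mem_arcCO_iff_lift hab hba]
  rw [← exp_lift a u, ← Circle.exp_add, mem_arcCC_iff_lift hab hba,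
    lift_exp (by linarith) (by linarith)] at h3
  linarith

/-- The union of the half-open rectangles. -/
def cornerRegionCO {N : ℕ} (P Q G H : ZMod N → Circle) : Set (Circle × Circle) :=
  ⋃ i : ZMod N, (arcCO (H (i + 1)) (G (i - 2)) ×ˢ arcCO (P i) (Q i)) ∪
    (arcCO (H (i + 1)) (G (i - 1)) ×ˢ arcCO (Q i) (P (i + 1)))

/-- The union of the closed rectangles. -/
def cornerRegionCC {N : ℕ} (P Q G H : ZMod N → Circle) : Set (Circle × Circle) :=
  ⋃ i : ZMod N, (arcCC (H (i + 1)) (G (i - 2)) ×ˢ arcCC (P i) (Q i)) ∪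
    (arcCC (H (i + 1)) (G (i - 1)) ×ˢ arcCC (Q i) (P (i + 1)))

namespace IsInterlacedLift

variable {N : ℕ} {P Q : ZMod N → Circle} {p q : ℤ → ℝ}

theorem expP_add_one (h : IsInterlacedLift P Q p q) (s : ℤ) :
    Circle.exp (p (s + 1)) = P (s + 1) := by
  rw [h.liftP.exp_eq]; push_cast; rfl

theorem p_add_two_lt (h : IsInterlacedLift P Q p q) (hN : 12 ≤ N) (s : ℤ) :
    p (s + 2) < p s + 2 * Real.pi := by
  rw [← h.liftP.add_period]
  exact h.strictMono_p (by omega)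

theorem mem_arcCO_P_P (h : IsInterlacedLift P Q p q) (hN : 12 ≤ N) (i : ZMod N) (w : Circle) :
    w ∈ arcCO (P i) (P (i + 1)) ↔ w ∈ arcCO (P i) (Q i) ∨ w ∈ arcCO (Q i) (P (i + 1)) := by
  obtain ⟨s, rfl⟩ := ZMod.intCast_surjective i
  have h1 := h.p_add_two_lt hN s
  have h2 := h.strictMono_p (show s + 1 < s + 2 by omega)
  rw [← h.liftP.exp_eq, ← h.liftQ.exp_eq, ← h.expP_add_one]
  exact mem_arcCO_or (h.p_lt_q s).le (h.q_lt_p s).le (by linarith)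

theorem notMem_arcCO_Q_P (h : IsInterlacedLift P Q p q) (hN : 12 ≤ N) {i : ZMod N} {w : Circle}
    (hw : w ∈ arcCO (P i) (Q i)) : w ∉ arcCO (Q i) (P (i + 1)) := by
  obtain ⟨s, rfl⟩ := ZMod.intCast_surjective i
  have h1 := h.p_add_two_lt hN s
  have h2 := h.strictMono_p (show s + 1 < s + 2 by omega)
  rw [← h.liftP.exp_eq, ← h.liftQ.exp_eq] at hw
  rw [← h.liftQ.exp_eq, ← h.expP_add_one]
  exact notMem_arcCO_of_mem (h.p_lt_q s).le (h.q_lt_p s).le (by linarith) hw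

theorem P_gap (h : IsInterlacedLift P Q p q) (hN : 12 ≤ N) (s : ℤ) :
    p (s + 1) < p s + 2 * Real.pi :=
  (h.strictMono_p (by omega)).trans (h.p_add_two_lt hN s)

theorem exists_cell (h : IsInterlacedLift P Q p q) (hN : 12 ≤ N) (w : Circle) :
    ∃ i, w ∈ arcCO (P i) (Q i) ∨ w ∈ arcCO (Q i) (P (i + 1)) := by
  obtain ⟨i, hi⟩ := h.liftP.exists_mem_arcCO h.strictMono_p.monotone (h.P_gap hN) w
  exact ⟨i, (h.mem_arcCO_P_P hN i w).1 hi⟩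

theorem cell_eq (h : IsInterlacedLift P Q p q) (hN : 12 ≤ N) {i j : ZMod N} {w : Circle}
    (hi : w ∈ arcCO (P i) (Q i) ∨ w ∈ arcCO (Q i) (P (i + 1)))
    (hj : w ∈ arcCO (P j) (Q j) ∨ w ∈ arcCO (Q j) (P (j + 1))) : i = j :=
  h.liftP.eq_of_mem_arcCO h.strictMono_p.monotone (h.P_gap hN)
    ((h.mem_arcCO_P_P hN i w).2 hi) ((h.mem_arcCO_P_P hN j w).2 hj)

theorem P_ne_Q (h : IsInterlacedLift P Q p q) (hN : 12 ≤ N) (i : ZMod N) : P i ≠ Q i := by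
  obtain ⟨s, rfl⟩ := ZMod.intCast_surjective i
  rw [← h.liftP.exp_eq, ← h.liftQ.exp_eq]
  exact exp_ne_exp (h.p_lt_q s) (by linarith [h.q_lt_p s, h.P_gap hN s])

theorem Q_ne_P (h : IsInterlacedLift P Q p q) (hN : 12 ≤ N) (i : ZMod N) : Q i ≠ P (i + 1) := by
  obtain ⟨s, rfl⟩ := ZMod.intCast_surjective i
  rw [← h.expP_add_one, ← h.liftQ.exp_eq]
  exact exp_ne_exp (h.q_lt_p s) (by linarith [h.p_lt_q s, h.P_gap hN s])

variable {G H : ZMod N → Circle} {i : ZMod N} {u w : Circle}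

theorem mem_cornerRegionCO_of_P_Q (h : IsInterlacedLift P Q p q) (hN : 12 ≤ N)
    (hw : w ∈ arcCO (P i) (Q i)) :
    (u, w) ∈ cornerRegionCO P Q G H ↔ u ∈ arcCO (H (i + 1)) (G (i - 2)) := by
  constructor
  · intro hu
    obtain ⟨j, hj | hj⟩ := mem_iUnion.1 hu
    · obtain rfl := h.cell_eq hN (Or.inl hw) (Or.inl hj.2)
      exact hj.1
    · obtain rfl := h.cell_eq hN (Or.inl hw) (Or.inr hj.2)
      exact absurd hj.2 (h.notMem_arcCO_Q_P hN hw)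
  · exact fun hu => mem_iUnion.2 ⟨i, Or.inl ⟨hu, hw⟩⟩

theorem mem_cornerRegionCO_of_Q_P (h : IsInterlacedLift P Q p q) (hN : 12 ≤ N)
    (hw : w ∈ arcCO (Q i) (P (i + 1))) :
    (u, w) ∈ cornerRegionCO P Q G H ↔ u ∈ arcCO (H (i + 1)) (G (i - 1)) := by
  constructor
  · intro hu
    obtain ⟨j, hj | hj⟩ := mem_iUnion.1 hu
    · obtain rfl := h.cell_eq hN (Or.inr hw) (Or.inl hj.2)
      exact absurd hw (h.notMem_arcCO_Q_P hN hj.2)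
    · obtain rfl := h.cell_eq hN (Or.inr hw) (Or.inr hj.2)
      exact hj.1
  · exact fun hu => mem_iUnion.2 ⟨i, Or.inr ⟨hu, hw⟩⟩

end IsInterlacedLift

namespace IsCornerLift

variable {N : ℕ} {P Q B G H : ZMod N → Circle} {p q β γ η : ℤ → ℝ}

theorem monotone_β (h : IsCornerLift P Q B G H p q β γ η) : Monotone β :=
  monotone_int_of_le_succ fun s => by
    linarith [h.β_le_q s, h.q_lt_p s, h.p_le_β (s + 1)]

theorem β_gap (h : IsCornerLift P Q B G H p q β γ η) (s : ℤ) :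
    β (s + 1) < β s + 2 * Real.pi := by
  linarith [h.β_le_q (s + 1), h.q_lt_p_of_lt (show s + 1 < s + 2 by omega), h.p_le_β s,
    h.p_add_two_lt h.twelve_le s]

/-- The sections from H_{j+1} to G_{j-2} or G_{j-1} go almost once around the circle, hence the lift
of G shifted by one period. -/
theorem η_lt_γ (h : IsCornerLift P Q B G H p q β γ η) {j k : ℤ} (hk : k = j - 2 ∨ k = j - 1) :
    η (j + 1) < γ (k + N) ∧ γ (k + N) < η (j + 1) + 2 * Real.pi := by
  have hN := h.twelve_le
  constructor
  · linarith [h.η_le_β (j + 1), h.β_le_q (j + 1 + 1), h.p_le_β (k + N), h.β_le_γ (k + N),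
      h.q_lt_p_of_lt (show j + 1 + 1 < k + N by omega)]
  · rw [h.liftG.add_period]
    linarith [h.γ_le_p k, h.q_le_η (j + 1), h.p_lt_q_of_le (show k + 1 ≤ j + 1 by omega)]

theorem expH_add_one (h : IsCornerLift P Q B G H p q β γ η) (j : ℤ) :
    H (j + 1) = Circle.exp (η (j + 1)) := by
  rw [h.liftH.exp_eq]; push_cast; rfl

theorem expB_add_one (h : IsCornerLift P Q B G H p q β γ η) (j : ℤ) :
    B (j + 1) = Circle.exp (β (j + 1)) := by
  rw [h.liftB.exp_eq]; push_cast; rfl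

theorem expG_sub (h : IsCornerLift P Q B G H p q β γ η) (j : ℤ) :
    G (j - 2) = Circle.exp (γ (j - 2 + N)) ∧ G (j - 1) = Circle.exp (γ (j - 1 + N)) := by
  rw [h.liftG.exp_eq, h.liftG.exp_eq]; push_cast; simp

/-- Membership of a point of the vertical strip number `s` in the horizontal side of a rectangle
over `[P j, Q j)` or `[Q j, P (j+1))`, for `j` between `s + 1` and `s - 2 + N`. -/
theorem exp_mem_arcCO_far (h : IsCornerLift P Q B G H p q β γ η) {s j k : ℤ} {u : ℝ}
    (hu : β s ≤ u) (hu' : u < β (s + 1)) (hsj : s + 1 ≤ j) (hjs : j ≤ s - 2 + N)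
    (hk : k = j - 2 ∨ k = j - 1) :
    Circle.exp u ∈ arcCO (Circle.exp (η (j + 1))) (Circle.exp (γ (k + N))) ↔ u < γ k := by
  have hN := h.twelve_le
  obtain ⟨h1, h2⟩ := h.η_lt_γ hk
  have h3 := h.liftG.add_period k
  have h4 := h.strictMono_q.monotone (show j ≤ j + 1 by omega)
  have h5 := h.p_lt_q_of_le (show k + 1 ≤ j by omega)
  have h6 := h.liftP.add_period s
  have h7 := h.q_lt_p_of_lt (show j < s + N by omega)
  have h8 := h.strictMono_q.monotone (show s + 1 ≤ j by omega)
  have h9 := h.liftB.add_period s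
  have h10 := h.monotone_β (show j + 1 + 1 ≤ s + N by omega)
  -- Seen from `q j` the point is represented by u + 2π. It is then past H_{j+1} automatically, and
  -- only the comparison with G_k remains.
  rw [← Circle.exp_add_two_pi u, exp_mem_arcCO_iff (c := q j) (by linarith [h.q_le_η (j + 1)]) h1.le
    (by linarith [h.γ_le_p k]) h2 (by linarith [h.p_le_β s]) (by linarith [h.β_le_q (s + 1)])]
  constructor
  · intro h'
    linarith [h'.2]
  · intro h'
    exact ⟨by linarith [h.η_le_β (j + 1)], by linarith⟩

/-- The same for `j = s - 1` and `j = s`. -/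
theorem exp_mem_arcCO_near (h : IsCornerLift P Q B G H p q β γ η) {s j k : ℤ} {u : ℝ}
    (hu : β s ≤ u) (hu' : u < β (s + 1)) (hsj : s - 1 ≤ j) (hjs : j ≤ s)
    (hk : k = j - 2 ∨ k = j - 1) :
    Circle.exp u ∈ arcCO (Circle.exp (η (j + 1))) (Circle.exp (γ (k + N))) ↔ η (j + 1) ≤ u := by
  have hN := h.twelve_le
  obtain ⟨h1, h2⟩ := h.η_lt_γ hk
  have h3 := h.p_lt_q_of_le (show s ≤ j + 1 by omega)
  have h4 := h.strictMono_p.monotone (show k + 1 ≤ s by omega)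
  have h5 := h.liftG.add_period k
  have h6 := h.q_lt_p_of_lt (show s + 1 < s + 2 by omega)
  have h7 := h.p_add_two_lt hN s
  have h8 := h.monotone_β (show s + 1 ≤ k + N by omega)
  -- Here `u` itself is the representative and lies below the shifted G_k, so only the comparison
  -- with H_{j+1} remains.
  rw [exp_mem_arcCO_iff (c := p s) (by linarith [h.q_le_η (j + 1)]) h1.le
    (by linarith [h.γ_le_p k]) h2 (by linarith [h.p_le_β s]) (by linarith [h.β_le_q (s + 1)])]
  exact ⟨fun h' => h'.1, fun h' => ⟨h', by linarith [h.β_le_γ (k + N)]⟩⟩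

/-- The part of the half-open region in a vertical strip. -/
theorem exp_mem_cornerRegionCO_iff (h : IsCornerLift P Q B G H p q β γ η) {s : ℤ} {u : ℝ}
    (hu : β s ≤ u) (hu' : u < β (s + 1)) (w : Circle) :
    (Circle.exp u, w) ∈ cornerRegionCO P Q G H ↔
      w ∈ arcCO (Circle.exp (q (s + 2))) (Circle.exp (p (s - 1 + N))) ∨
      (u < γ s ∧ w ∈ arcCO (Circle.exp (q (s + 1))) (Circle.exp (q (s + 2)))) ∨
      (η s ≤ u ∧ w ∈ arcCO (Circle.exp (p (s - 1))) (Circle.exp (p s))) := by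
  have hN := h.twelve_le
  have hpN := h.liftP.add_period (s - 1)
  have m1 := h.strictMono_p (show s - 1 < s by omega)
  have m2 := h.p_lt_q_of_le (show s ≤ s + 1 by omega)
  have m3 := h.strictMono_q (show s + 1 < s + 2 by omega)
  have m4 := h.q_lt_p_of_lt (show s + 2 < s - 1 + N by omega)
  have e := exp_lift (p (s - 1)) w
  have t1 := le_lift (p (s - 1)) w
  have t2 := lift_lt (p (s - 1)) w
  generalize lift (p (s - 1)) w = t at e t1 t2
  subst e
  rw [exp_mem_arcCO_iff (c := p (s - 1)) (by linarith) (by linarith) (by linarith) (by linarith)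
    t1 t2, exp_mem_arcCO_iff (c := p (s - 1)) (by linarith) (by linarith) (by linarith)
    (by linarith) t1 t2, exp_mem_arcCO_iff (c := p (s - 1)) (by linarith) (by linarith)
    (by linarith) (by linarith) t1 t2]
  -- The window starts at `p (s - 1)`, so the cell number runs from s - 1 to s - 2 + N. The
  -- condition on `u` is nontrivial only near the start: it involves H_s for j = s - 1 and G_s for
  -- the cells between Q_{s+1} and Q_{s+2}; from P_s to Q_{s+1} it fails, from Q_{s+2} on it holds.
  obtain ⟨j, j1, j2⟩ := h.liftP.exists_mem_Ico h.strictMono_p.monotone t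
  have hj1 : s - 1 ≤ j := by
    by_contra hlt
    linarith [h.strictMono_p.monotone (show j + 1 ≤ s - 1 by omega)]
  have hj2 : j ≤ s - 2 + N := by
    by_contra hlt
    linarith [h.strictMono_p.monotone (show s - 1 + N ≤ j by omega)]
  have hgap := h.P_gap hN j
  have hpq := h.p_lt_q j
  have hqp := h.q_lt_p j
  have hγ : γ (s - 1) ≤ p s := by
    have := h.γ_le_p (s - 1)
    rwa [sub_add_cancel] at this
  have hfar : ∀ k, s + 1 ≤ k → u < γ k := fun k hk => by
    linarith [h.β_le_γ k, h.monotone_β hk]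
  have hlow : ¬ η (s + 1) ≤ u := by
    linarith [h.q_le_η (s + 1), h.β_le_q (s + 1)]
  have hps := h.p_le_β s
  rcases lt_or_ge t (q j) with hq | hq
  · have hw : Circle.exp t ∈ arcCO (P j) (Q j) := by
      rw [← h.liftP.exp_eq, ← h.liftQ.exp_eq]
      exact exp_mem_arcCO (by linarith) j1 hq
    rw [h.mem_cornerRegionCO_of_P_Q hN hw, h.expH_add_one, (h.expG_sub j).1]
    rcases le_or_gt (s + 1) j with hsj | hsj
    · rw [h.exp_mem_arcCO_far hu hu' hsj hj2 (Or.inl rfl)]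
      obtain rfl | rfl | h3 : j = s + 1 ∨ j = s + 2 ∨ s + 3 ≤ j := by omega
      · rw [show s + 1 - 2 = s - 1 by ring]
        have := h.strictMono_p (show s < s + 1 by omega)
        constructor
        · intro h'
          linarith
        · rintro (h' | h' | h')
          · linarith [h'.1]
          · linarith [h'.2.1]
          · linarith [h'.2.2]
      · rw [show s + 2 - 2 = s by ring]
        have := h.q_lt_p_of_lt (show s + 1 < s + 2 by omega)
        constructor
        · exact fun h' => Or.inr (Or.inl ⟨h', by linarith, hq⟩)
        · rintro (h' | h' | h')
          · linarith [h'.1]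
          · exact h'.1
          · linarith [h'.2.2]
      · have := h.q_lt_p_of_lt (show s + 2 < j by omega)
        exact ⟨fun _ => Or.inl ⟨by linarith, by linarith⟩, fun _ => hfar _ (by omega)⟩
    · rw [h.exp_mem_arcCO_near hu hu' hj1 (by omega) (Or.inl rfl)]
      obtain rfl | rfl : j = s - 1 ∨ j = s := by omega
      · rw [sub_add_cancel] at *
        constructor
        · exact fun h' => Or.inr (Or.inr ⟨h', t1, j2⟩)
        · rintro (h' | h' | h')
          · linarith [h'.1]
          · linarith [h'.2.1]
          · exact h'.1
      · have := h.strictMono_q (show j < j + 1 by omega)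
        constructor
        · exact fun h' => absurd h' hlow
        · rintro (h' | h' | h')
          · linarith [h'.1]
          · linarith [h'.2.1]
          · linarith [h'.2.2]
  · have hw : Circle.exp t ∈ arcCO (Q j) (P (j + 1)) := by
      rw [← h.expP_add_one, ← h.liftQ.exp_eq]
      exact exp_mem_arcCO (by linarith) hq j2
    rw [h.mem_cornerRegionCO_of_Q_P hN hw, h.expH_add_one, (h.expG_sub j).2]
    rcases le_or_gt (s + 1) j with hsj | hsj
    · rw [h.exp_mem_arcCO_far hu hu' hsj hj2 (Or.inr rfl)]
      obtain rfl | h3 : j = s + 1 ∨ s + 2 ≤ j := by omega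
      · rw [show s + 1 - 1 = s by ring]
        rw [show s + 1 + 1 = s + 2 by ring] at *
        have := h.p_lt_q_of_le (show s + 2 ≤ s + 2 by omega)
        constructor
        · exact fun h' => Or.inr (Or.inl ⟨h', hq, by linarith⟩)
        · rintro (h' | h' | h')
          · linarith [h'.1]
          · exact h'.1
          · linarith [h'.2.2]
      · have := h.strictMono_q.monotone (show s + 2 ≤ j by omega)
        exact ⟨fun _ => Or.inl ⟨by linarith, by linarith⟩, fun _ => hfar _ (by omega)⟩
    · rw [h.exp_mem_arcCO_near hu hu' hj1 (by omega) (Or.inr rfl)]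
      obtain rfl | rfl : j = s - 1 ∨ j = s := by omega
      · rw [sub_add_cancel] at *
        constructor
        · exact fun h' => Or.inr (Or.inr ⟨h', t1, j2⟩)
        · rintro (h' | h' | h')
          · linarith [h'.1]
          · linarith [h'.2.1]
          · exact h'.1
      · have := h.p_lt_q_of_le (show j + 1 ≤ j + 1 by omega)
        constructor
        · exact fun h' => absurd h' hlow
        · rintro (h' | h' | h')
          · linarith [h'.1]
          · linarith [h'.2.1]
          · linarith [h'.2.2]

theorem mem_strip_iff (h : IsCornerLift P Q B G H p q β γ η) (i : ZMod N) (u w : Circle) :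
    (u ∈ arcCO (B i) (B (i + 1)) ∧ (u, w) ∈ cornerRegionCO P Q G H) ↔
      (u ∈ arcCO (B i) (B (i + 1)) ∧ w ∈ arcCO (Q (i + 2)) (P (i - 1))) ∨
      (u ∈ arcCO (B i) (G i) ∧ w ∈ arcCO (Q (i + 1)) (Q (i + 2))) ∨
      (u ∈ arcCO (H i) (B (i + 1)) ∧ w ∈ arcCO (P (i - 1)) (P i)) := by
  have hN := h.twelve_le
  obtain ⟨s, rfl⟩ := ZMod.intCast_surjective i
  have e1 : Q (s + 2) = Circle.exp (q (s + 2)) := by rw [h.liftQ.exp_eq]; push_cast; rfl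
  have e2 : Q (s + 1) = Circle.exp (q (s + 1)) := by rw [h.liftQ.exp_eq]; push_cast; rfl
  have e3 : P (s - 1) = Circle.exp (p (s - 1)) := by rw [h.liftP.exp_eq]; push_cast; rfl
  have e4 : Circle.exp (p (s - 1)) = Circle.exp (p (s - 1 + N)) := by
    rw [h.liftP.add_period, Circle.exp_add_two_pi]
  have b1 := h.β_gap s
  have b2 : γ s ≤ β (s + 1) := (h.γ_le_p s).trans (h.p_le_β (s + 1))
  have b3 : β s ≤ η s := (h.β_le_q s).trans (h.q_le_η s)
  have b4 := h.η_le_β s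
  have b5 := h.β_le_γ s
  have hsub : ∀ {a b : ℝ}, β s ≤ a → a ≤ b → b ≤ β (s + 1) →
      (u ∈ arcCO (Circle.exp a) (Circle.exp b) ↔
        ∃ t, Circle.exp t = u ∧ β s ≤ t ∧ t < β (s + 1) ∧ a ≤ t ∧ t < b) := by
    intro a b ha hab hb
    rw [arcCO_exp hab (by linarith)]
    constructor
    · rintro ⟨t, ht, rfl⟩
      exact ⟨t, rfl, by linarith [ht.1], by linarith [ht.2], ht.1, ht.2⟩
    · rintro ⟨t, rfl, -, -, h1, h2⟩
      exact ⟨t, ⟨h1, h2⟩, rfl⟩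
  rw [e1, e2, e3, h.expB_add_one, ← h.liftB.exp_eq, ← h.liftG.exp_eq, ← h.liftH.exp_eq,
    ← h.liftP.exp_eq s, hsub le_rfl (by linarith) le_rfl, hsub le_rfl b5 b2, hsub b3 b4 le_rfl]
  constructor
  · rintro ⟨⟨t, rfl, h1, h2, -⟩, h3⟩
    rw [h.exp_mem_cornerRegionCO_iff h1 h2, ← e4] at h3
    rcases h3 with h3 | h3 | h3
    · exact Or.inl ⟨⟨t, rfl, h1, h2, h1, h2⟩, h3⟩
    · exact Or.inr (Or.inl ⟨⟨t, rfl, h1, h2, h1, h3.1⟩, h3.2⟩)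
    · exact Or.inr (Or.inr ⟨⟨t, rfl, h1, h2, h3.1, h2⟩, h3.2⟩)
  · rintro (⟨⟨t, rfl, h1, h2, h3, h4⟩, h5⟩ | ⟨⟨t, rfl, h1, h2, h3, h4⟩, h5⟩ |
      ⟨⟨t, rfl, h1, h2, h3, h4⟩, h5⟩) <;>
    refine ⟨⟨t, rfl, h1, h2, h1, h2⟩, ?_⟩ <;> rw [h.exp_mem_cornerRegionCO_iff h1 h2, ← e4]
    · exact Or.inl h5
    · exact Or.inr (Or.inl ⟨h4, h5⟩)
    · exact Or.inr (Or.inr ⟨h3, h5⟩)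

theorem H_ne_G (h : IsCornerLift P Q B G H p q β γ η) (i : ZMod N) :
    H (i + 1) ≠ G (i - 2) ∧ H (i + 1) ≠ G (i - 1) := by
  obtain ⟨s, rfl⟩ := ZMod.intCast_surjective i
  rw [h.expH_add_one, (h.expG_sub s).1, (h.expG_sub s).2]
  exact ⟨exp_ne_exp (h.η_lt_γ (Or.inl rfl)).1 (h.η_lt_γ (Or.inl rfl)).2,
    exp_ne_exp (h.η_lt_γ (Or.inr rfl)).1 (h.η_lt_γ (Or.inr rfl)).2⟩

theorem arcCC_H_G_subset (h : IsCornerLift P Q B G H p q β γ η) (i : ZMod N) :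
    arcCC (H (i + 1)) (G (i - 2)) ⊆ arcCC (H (i + 1)) (G (i - 1)) := by
  obtain ⟨s, rfl⟩ := ZMod.intCast_surjective i
  rw [h.expH_add_one, (h.expG_sub s).1, (h.expG_sub s).2]
  refine arcCC_exp_subset le_rfl (h.η_lt_γ (Or.inl rfl)).1.le ?_ (h.η_lt_γ (Or.inr rfl)).2
  have h1 := h.γ_le_p (s - 2 + N)
  rw [show s - 2 + N + 1 = s - 1 + (N : ℤ) by ring] at h1
  linarith [h.p_le_β (s - 1 + N), h.β_le_γ (s - 1 + N)]

theorem closure_cornerRegionCO (h : IsCornerLift P Q B G H p q β γ η) :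
    closure (cornerRegionCO P Q G H) = cornerRegionCC P Q G H := by
  have : NeZero N := ⟨by have := h.twelve_le; omega⟩
  have hN := h.twelve_le
  rw [cornerRegionCO, cornerRegionCC, closure_iUnion_of_finite]
  congr 1
  funext i
  rw [closure_union, closure_prod_eq, closure_prod_eq, closure_arcCO (h.H_ne_G i).1,
    closure_arcCO (h.H_ne_G i).2, closure_arcCO (h.P_ne_Q hN i), closure_arcCO (h.Q_ne_P hN i)]

variable {u w : Circle}

/-- The extra alternative at w = P_i comes from the upper edge of the closed rectangle over
[Q_{i-1}, P_i]. At w = Q_i there is none, because the section below is contained in the one above by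
`arcCC_H_G_subset`. -/
theorem of_mem_cornerRegionCC (h : IsCornerLift P Q B G H p q β γ η)
    (hu : (u, w) ∈ cornerRegionCC P Q G H) :
    (∀ i, w ∈ arcCO (P i) (Q i) → u ∈ arcCC (H (i + 1)) (G (i - 2)) ∨
      w = P i ∧ u ∈ arcCC (H i) (G (i - 2))) ∧
    (∀ i, w ∈ arcCO (Q i) (P (i + 1)) → u ∈ arcCC (H (i + 1)) (G (i - 1))) := by
  have hN := h.twelve_le
  have hPQ : ∀ i, P i ∈ arcCO (P i) (Q i) := fun i => left_mem_arcCO (h.P_ne_Q hN i)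
  have hQP : ∀ i, Q i ∈ arcCO (Q i) (P (i + 1)) := fun i => left_mem_arcCO (h.Q_ne_P hN i)
  obtain ⟨j, ⟨hj1, hj2⟩ | ⟨hj1, hj2⟩⟩ := mem_iUnion.1 hu
  · rcases mem_arcCC_iff_eq_or.1 hj2 with h1 | h1
    · simp only at h1
      subst h1
      refine ⟨fun i hi => ?_, fun i hi => ?_⟩
      · obtain rfl := h.cell_eq hN (Or.inl hi) (Or.inr (hQP j))
        exact absurd (hQP i) (h.notMem_arcCO_Q_P hN hi)
      · obtain rfl := h.cell_eq hN (Or.inr hi) (Or.inr (hQP j))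
        exact h.arcCC_H_G_subset i hj1
    · refine ⟨fun i hi => ?_, fun i hi => ?_⟩
      · obtain rfl := h.cell_eq hN (Or.inl hi) (Or.inl h1)
        exact Or.inl hj1
      · obtain rfl := h.cell_eq hN (Or.inr hi) (Or.inl h1)
        exact absurd hi (h.notMem_arcCO_Q_P hN h1)
  · rcases mem_arcCC_iff_eq_or.1 hj2 with h1 | h1
    · simp only at h1
      subst h1
      refine ⟨fun i hi => ?_, fun i hi => ?_⟩
      · obtain rfl := h.cell_eq hN (Or.inl hi) (Or.inl (hPQ (j + 1)))
        refine Or.inr ⟨rfl, ?_⟩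
        rwa [show j + 1 - 2 = j - 1 by ring]
      · obtain rfl := h.cell_eq hN (Or.inr hi) (Or.inl (hPQ (j + 1)))
        exact absurd hi (h.notMem_arcCO_Q_P hN (hPQ (j + 1)))
    · refine ⟨fun i hi => ?_, fun i hi => ?_⟩
      · obtain rfl := h.cell_eq hN (Or.inl hi) (Or.inr h1)
        exact absurd h1 (h.notMem_arcCO_Q_P hN hi)
      · obtain rfl := h.cell_eq hN (Or.inr hi) (Or.inr h1)
        exact hj1

theorem eventually_mem_arcCO {a b t : ℝ} (hba : b < a + 2 * Real.pi) (hat : a ≤ t) (htb : t < b) :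
    ∀ᶠ ε : ℝ in nhdsWithin 0 (Ioi 0), Circle.exp t * Circle.exp ε ∈
      arcCO (Circle.exp a) (Circle.exp b) ∧ Circle.exp t * Circle.exp ε ≠ Circle.exp a := by
  have h2 : ∀ᶠ ε : ℝ in nhdsWithin 0 (Ioi 0), ε < b - t :=
    Filter.Eventually.filter_mono nhdsWithin_le_nhds (gt_mem_nhds (by linarith))
  filter_upwards [h2, self_mem_nhdsWithin] with ε h3 h4
  have h4 : 0 < ε := h4
  rw [← Circle.exp_add]
  exact ⟨exp_mem_arcCO hba (by linarith) (by linarith),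
    (exp_ne_exp (by linarith) (by linarith)).symm⟩

theorem interior_subset (h : IsCornerLift P Q B G H p q β γ η) :
    interior (cornerRegionCC P Q G H) ⊆ cornerRegionCO P Q G H := by
  have hN := h.twelve_le
  rintro ⟨u, w⟩ huw
  -- Moving both coordinates slightly counterclockwise stays in the closed region, keeps `w` in its
  -- half-open cell and avoids its left end, so the exceptional alternative is excluded. For `u`
  -- this yields membership in the half-open section.
  have hev : ∀ᶠ ε : ℝ in nhdsWithin 0 (Ioi 0),
      (u * Circle.exp ε, w * Circle.exp ε) ∈ cornerRegionCC P Q G H := by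
    refine Filter.Eventually.filter_mono nhdsWithin_le_nhds ?_
    have hc : Continuous fun ε : ℝ => (u * Circle.exp ε, w * Circle.exp ε) := by fun_prop
    have := hc.tendsto 0
    rw [Circle.exp_zero, mul_one, mul_one] at this
    exact this.eventually (mem_interior_iff_mem_nhds.1 huw)
  obtain ⟨i, hi⟩ := h.exists_cell hN w
  obtain ⟨s, rfl⟩ := ZMod.intCast_surjective i
  have h1 := h.p_lt_q s
  have h2 := h.q_lt_p s
  have h3 := h.P_gap hN s
  rcases hi with hi | hi
  · rw [h.mem_cornerRegionCO_of_P_Q hN hi]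
    rw [← h.liftP.exp_eq, ← h.liftQ.exp_eq, arcCO_exp h1.le (by linarith)] at hi
    obtain ⟨t, ht, rfl⟩ := hi
    have hev2 := eventually_mem_arcCO (by linarith) ht.1 ht.2
    rw [h.liftP.exp_eq, h.liftQ.exp_eq] at hev2
    refine mem_arcCO_of_eventually ?_
    filter_upwards [hev, hev2] with ε e1 e2
    exact ((h.of_mem_cornerRegionCC e1).1 s e2.1).resolve_right fun h' => e2.2 h'.1
  · rw [h.mem_cornerRegionCO_of_Q_P hN hi]
    rw [← h.expP_add_one, ← h.liftQ.exp_eq, arcCO_exp h2.le (by linarith)] at hi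
    obtain ⟨t, ht, rfl⟩ := hi
    have hev2 := eventually_mem_arcCO (by linarith) ht.1 ht.2
    rw [h.expP_add_one, h.liftQ.exp_eq] at hev2
    refine mem_arcCO_of_eventually ?_
    filter_upwards [hev, hev2] with ε e1 e2
    exact (h.of_mem_cornerRegionCC e1).2 s e2.1

end IsCornerLift

/-! ### The natural extension on the half-open and the closed domain -/

namespace SurfacePolygon

variable {g : ℕ} {M : SurfacePolygon g} {A G : SideIndex g → Circle}

theorem IsExtremal.mem_arcCO_iff (hg : 2 ≤ g) (hA : M.IsExtremal A) (i : SideIndex g)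
    (w : Circle) : w ∈ arcCO (A i) (A (i + 1)) ↔ w ∈ arcCO (M.Q i) (M.P (i + 1)) ∨
      (A i = M.P i ∧ w ∈ arcCO (M.P i) (M.Q i)) ∨
      (A (i + 1) = M.Q (i + 1) ∧ w ∈ arcCO (M.P (i + 1)) (M.Q (i + 1))) := by
  obtain ⟨a, q, b, c, d, h1, h2, h3, h4, h5, e1, e2, e3, e4, -⟩ := M.exists_lift_P hg i
  have n1 := M.P_ne_Q hg i
  have n2 := M.P_ne_Q hg (i + 1)
  rcases hA i with h | h <;> rcases hA (i + 1) with h' | h' <;> rw [h, h']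
  · simp only [true_and, n2, false_and, or_false]
    rw [← e1, ← e2, ← e3, mem_arcCO_or h1.le h2.le (by linarith), or_comm]
  · simp only [true_and]
    rw [← e1, ← e2, ← e3, ← e4, mem_arcCO_or h1.le (h2.trans h3).le (by linarith),
      mem_arcCO_or h2.le h3.le (by linarith)]
    tauto
  · simp [n1.symm, n2]
  · simp only [true_and, n1.symm, false_and, false_or]
    rw [← e2, ← e3, ← e4, mem_arcCO_or h2.le h3.le (by linarith)]

theorem IsExtremal.isCyclicLift (hg : 2 ≤ g) (hA : M.IsExtremal A) :
    ∃ α : ℤ → ℝ, IsCyclicLift A α ∧ Monotone α ∧ ∀ s, α (s + 1) < α s + 2 * Real.pi := by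
  have hI := M.isInterlacedLift hg
  generalize M.cutLift M.P = p at hI
  generalize M.cutLift M.Q = q at hI
  have hN : ∀ s, p (s + 2) < p s + 2 * Real.pi := hI.p_add_two_lt (by omega)
  have l1 := hI.p_lt_q
  have l2 := hI.q_lt_p
  have l4 : ∀ s, q (s + 1) < p (s + 2) := fun s => hI.q_lt_p_of_lt (by omega)
  have hα : ∀ s : ℤ, p s ≤ lift (p s) (A s) ∧ lift (p s) (A s) ≤ q s := fun s =>
    lift_mem_Icc le_rfl (l1 s).le (by linarith [hN s, l2 s, l1 (s + 1), l4 s]) (by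
      rw [hI.liftP.exp_eq, hI.liftQ.exp_eq]
      rcases hA s with h | h <;> rw [h]
      exacts [left_mem_arcCC _ _, right_mem_arcCC _ _])
  refine ⟨_, hI.liftP.lift A, monotone_int_of_le_succ fun s => ?_, fun s => ?_⟩
  · linarith [(hα s).2, l2 s, (hα (s + 1)).1]
  · linarith [(hα (s + 1)).2, (hα s).1, hN s, l4 s]

theorem IsExtremal.exists_mem_arcCO (hg : 2 ≤ g) (hA : M.IsExtremal A) (w : Circle) :
    ∃ i, w ∈ arcCO (A i) (A (i + 1)) := by
  obtain ⟨α, h1, h2, h3⟩ := hA.isCyclicLift hg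
  exact h1.exists_mem_arcCO h2 h3 w

theorem IsExtremal.arcIndex_eq (hg : 2 ≤ g) (hA : M.IsExtremal A) {w : Circle} {i : SideIndex g}
    (hw : w ∈ arcCO (A i) (A (i + 1))) : arcIndex A w = i := by
  obtain ⟨α, h1, h2, h3⟩ := hA.isCyclicLift hg
  exact h1.eq_of_mem_arcCO h2 h3
    (Classical.epsilon_spec (p := fun i => w ∈ arcCO (A i) (A (i + 1))) ⟨i, hw⟩) hw

/-- The diagonal action of a Moebius transformation. -/
noncomputable def _root_.SU11.onPair (X : SU11) (x : Circle × Circle) : Circle × Circle :=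
  (X.onCircle x.1, X.onCircle x.2)

theorem _root_.SU11.continuous_onPair (X : SU11) : Continuous X.onPair :=
  (X.continuous_onCircle.comp continuous_fst).prodMk (X.continuous_onCircle.comp continuous_snd)

theorem IsExtremal.natExt_eq (hg : 2 ≤ g) (hA : M.IsExtremal A) {x : Circle × Circle}
    {i : SideIndex g} (hx : x.2 ∈ arcCO (A i) (A (i + 1))) : M.natExt A x = (M.T i).onPair x := by
  rw [natExt, hA.arcIndex_eq hg hx]
  rfl

theorem halfOpenDomain_eq (M : SurfacePolygon g) (G : SideIndex g → Circle) :
    M.halfOpenDomain G = cornerRegionCO M.P M.Q G (M.lowerCorner G) := rfl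

/-- `T i` maps the horizontal strip number `i` of the half-open domain onto the vertical strip
number `σ i`. -/
theorem IsCornerSolution.strip_iff (hg : 2 ≤ g) (hA : M.IsExtremal A)
    (h : M.IsCornerSolution A G) (i : SideIndex g) (x : Circle × Circle) :
    (x.2 ∈ arcCO (A i) (A (i + 1)) ∧ x ∈ M.halfOpenDomain G) ↔
      (((M.T i).onPair x).1 ∈ arcCO (M.stripCorner G (sidePairing g i))
          (M.stripCorner G (sidePairing g i + 1)) ∧ (M.T i).onPair x ∈ M.halfOpenDomain G) := by
  obtain ⟨u, w⟩ := x
  obtain ⟨p, q, β, γ, η, hL⟩ := h.isCornerLift hg hA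
  have hN := hL.twelve_le
  have hT := hL.mem_strip_iff (sidePairing g i) ((M.T i).onCircle u) ((M.T i).onCircle w)
  have f1 := M.T_lowerCorner_add_one hg G i
  have f2 := M.T_G_sub_one hg G i
  have f3 := M.T_P hg i
  have f4 := M.T_Q hg i
  have f5 := M.T_P_add_one hg i
  have f6 := M.T_Q_add_one hg i
  have hs : (w ∈ arcCO (A i) (A (i + 1)) ∧ (u, w) ∈ M.halfOpenDomain G) ↔
      (u ∈ arcCO (M.lowerCorner G (i + 1)) (G (i - 1)) ∧ w ∈ arcCO (M.Q i) (M.P (i + 1))) ∨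
      (A i = M.P i ∧ u ∈ arcCO (M.lowerCorner G (i + 1)) (G (i - 2)) ∧
        w ∈ arcCO (M.P i) (M.Q i)) ∨
      (A (i + 1) = M.Q (i + 1) ∧ u ∈ arcCO (M.lowerCorner G (i + 2)) (G (i - 1)) ∧
        w ∈ arcCO (M.P (i + 1)) (M.Q (i + 1))) := by
    rw [hA.mem_arcCO_iff hg, halfOpenDomain_eq]
    have e1 : i + 1 + 1 = i + 2 := by ring
    have e2 : i + 1 - 2 = i - 1 := by ring
    constructor
    · rintro ⟨hw | ⟨ha, hw⟩ | ⟨ha, hw⟩, hu⟩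
      · exact Or.inl ⟨(hL.mem_cornerRegionCO_of_Q_P hN hw).1 hu, hw⟩
      · exact Or.inr (Or.inl ⟨ha, (hL.mem_cornerRegionCO_of_P_Q hN hw).1 hu, hw⟩)
      · have := (hL.mem_cornerRegionCO_of_P_Q hN hw).1 hu
        rw [e1, e2] at this
        exact Or.inr (Or.inr ⟨ha, this, hw⟩)
    · rintro (⟨hu, hw⟩ | ⟨ha, hu, hw⟩ | ⟨ha, hu, hw⟩)
      · exact ⟨Or.inl hw, (hL.mem_cornerRegionCO_of_Q_P hN hw).2 hu⟩
      · exact ⟨Or.inr (Or.inl ⟨ha, hw⟩), (hL.mem_cornerRegionCO_of_P_Q hN hw).2 hu⟩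
      · refine ⟨Or.inr (Or.inr ⟨ha, hw⟩), (hL.mem_cornerRegionCO_of_P_Q hN hw).2 ?_⟩
        rwa [e1, e2]
  rw [hs]
  refine Iff.trans ?_ hT.symm
  -- The three rectangles of the horizontal strip correspond one by one to those of the vertical
  -- strip. The last two depend on A_i and A_{i+1}: when the piece is missing on the left, the arc
  -- on the right has equal endpoints and is empty.
  refine or_congr ?_ (or_congr ?_ ?_)
  · rw [← f1, ← f2, ← f4, ← f5, SU11.onCircle_mem_arcCO, SU11.onCircle_mem_arcCO]
  · rw [← f3, ← f4, SU11.onCircle_mem_arcCO]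
    rcases hA i with ha | ha
    · rw [h.eq_of_P ha, ← f1, SU11.onCircle_mem_arcCO]
      simp [ha]
    · rw [h.eq_of_Q hg ha, arcCO_self]
      simp [ha, (M.P_ne_Q hg i).symm]
  · rw [← f5, ← f6, SU11.onCircle_mem_arcCO]
    rcases hA (i + 1) with ha | ha
    · rw [h.lowerCorner_of_P hg ha, arcCO_self]
      simp [ha, M.P_ne_Q hg (i + 1)]
    · rw [h.lowerCorner_of_Q hg ha, ← f2, SU11.onCircle_mem_arcCO]
      simp [ha]

theorem IsCornerSolution.bijOn_natExt (hg : 2 ≤ g) (hA : M.IsExtremal A)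
    (h : M.IsCornerSolution A G) :
    BijOn (M.natExt A) (M.halfOpenDomain G) (M.halfOpenDomain G) := by
  obtain ⟨p, q, β, γ, η, hL⟩ := h.isCornerLift hg hA
  refine ⟨fun x hx => ?_, fun x hx y hy hxy => ?_, fun y hy => ?_⟩
  · obtain ⟨i, hi⟩ := hA.exists_mem_arcCO hg x.2
    rw [hA.natExt_eq hg hi]
    exact ((h.strip_iff hg hA i x).1 ⟨hi, hx⟩).2
  · obtain ⟨i, hi⟩ := hA.exists_mem_arcCO hg x.2
    obtain ⟨j, hj⟩ := hA.exists_mem_arcCO hg y.2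
    rw [hA.natExt_eq hg hi, hA.natExt_eq hg hj] at hxy
    have h1 := ((h.strip_iff hg hA i x).1 ⟨hi, hx⟩).1
    have h2 := ((h.strip_iff hg hA j y).1 ⟨hj, hy⟩).1
    rw [hxy] at h1
    -- The vertical strips are disjoint and σ is injective, so equal images come from the same
    -- branch.
    have h3 := hL.liftB.eq_of_mem_arcCO hL.monotone_β hL.β_gap h1 h2
    have h4 := congrArg (sidePairing g) h3
    rw [sidePairing_sidePairing hg, sidePairing_sidePairing hg] at h4
    subst h4
    rw [SU11.onPair, SU11.onPair, Prod.mk.injEq, SU11.onCircle_inj, SU11.onCircle_inj] at hxy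
    exact Prod.ext hxy.1 hxy.2
  -- The vertical strips cover the torus, and strip `j` is the image of horizontal strip `σ j`.
  · obtain ⟨j, hj⟩ := hL.liftB.exists_mem_arcCO hL.monotone_β hL.β_gap y.1
    have hs := sidePairing_sidePairing hg j
    have hy' : (M.T (sidePairing g j)).onPair ((M.T (sidePairing g j))⁻¹.onPair y) = y := by
      simp [SU11.onPair]
    obtain ⟨h1, h2⟩ := (h.strip_iff hg hA (sidePairing g j) ((M.T (sidePairing g j))⁻¹.onPair y)).2
      (by rw [hy', hs]; exact ⟨hj, hy⟩)
    exact ⟨_, h2, by rw [hA.natExt_eq hg h1, hy']⟩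

theorem IsCornerSolution.closure_halfOpenDomain (hg : 2 ≤ g) (hA : M.IsExtremal A)
    (h : M.IsCornerSolution A G) : closure (M.halfOpenDomain G) = M.domain G := by
  obtain ⟨p, q, β, γ, η, hL⟩ := h.isCornerLift hg hA
  exact hL.closure_cornerRegionCO

theorem IsCornerSolution.interior_domain_subset (hg : 2 ≤ g) (hA : M.IsExtremal A)
    (h : M.IsCornerSolution A G) : interior (M.domain G) ⊆ M.halfOpenDomain G := by
  obtain ⟨p, q, β, γ, η, hL⟩ := h.isCornerLift hg hA
  exact hL.interior_subset

/-- If `T i` acts on a half-open rectangle as part of the natural extension, then it maps the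
closed rectangle into the domain. -/
theorem IsCornerSolution.onPair_mem_domain (hg : 2 ≤ g) (hA : M.IsExtremal A)
    (h : M.IsCornerSolution A G) (i : SideIndex g) {a b c d : Circle} (hab : a ≠ b) (hcd : c ≠ d)
    (hsub : arcCO a b ×ˢ arcCO c d ⊆ M.halfOpenDomain G)
    (hi : arcCO c d ⊆ arcCO (A i) (A (i + 1))) {x : Circle × Circle}
    (hx : x ∈ arcCC a b ×ˢ arcCC c d) : (M.T i).onPair x ∈ M.domain G := by
  have hm : MapsTo (M.T i).onPair (arcCO a b ×ˢ arcCO c d) (M.halfOpenDomain G) :=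
    fun y hy => ((h.strip_iff hg hA i y).1 ⟨hi hy.2, hsub hy⟩).2
  have hc := hm.closure (M.T i).continuous_onPair
  rw [closure_prod_eq, closure_arcCO hab, closure_arcCO hcd, h.closure_halfOpenDomain hg hA] at hc
  exact hc hx

theorem IsCornerSolution.mapsTo_natExt_domain (hg : 2 ≤ g) (hA : M.IsExtremal A)
    (h : M.IsCornerSolution A G) : MapsTo (M.natExt A) (M.domain G) (M.domain G) := by
  obtain ⟨p, q, β, γ, η, hL⟩ := h.isCornerLift hg hA
  have hN := hL.twelve_le
  rintro ⟨u, w⟩ hx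
  obtain ⟨i, hi⟩ := hA.exists_mem_arcCO hg w
  rw [hA.natExt_eq hg (x := (u, w)) hi]
  have hAi := hA.mem_arcCO_iff hg i
  obtain ⟨hc1, hc2⟩ := hL.of_mem_cornerRegionCC hx
  have hX : ∀ j, arcCO (M.lowerCorner G (j + 1)) (G (j - 2)) ×ˢ arcCO (M.P j) (M.Q j)
      ⊆ M.halfOpenDomain G := fun j y hy => mem_iUnion.2 ⟨j, Or.inl hy⟩
  have hY : ∀ j, arcCO (M.lowerCorner G (j + 1)) (G (j - 1)) ×ˢ arcCO (M.Q j) (M.P (j + 1))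
      ⊆ M.halfOpenDomain G := fun j y hy => mem_iUnion.2 ⟨j, Or.inr hy⟩
  have hYi : arcCO (M.Q i) (M.P (i + 1)) ⊆ arcCO (A i) (A (i + 1)) :=
    fun z hz => (hAi z).2 (Or.inl hz)
  rcases (hAi w).1 hi with hw | ⟨ha, hw⟩ | ⟨ha, hw⟩
  · exact h.onPair_mem_domain hg hA i (hL.H_ne_G i).2 (M.Q_ne_P_add_one hg i) (hY i) hYi
      ⟨hc2 i hw, hw.1⟩
  · rcases hc1 i hw with hu | ⟨rfl, hu⟩
    · exact h.onPair_mem_domain hg hA i (hL.H_ne_G i).1 (M.P_ne_Q hg i) (hX i)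
        (fun z hz => (hAi z).2 (Or.inr (Or.inl ⟨ha, hz⟩))) ⟨hu, hw.1⟩
    -- The point lies on the upper edge of the rectangle over [Q_{i-1}, P_i], but branch `i` acts on
    -- it, so continuity gives nothing. Its image has second coordinate T_i P_i = Q_{σ+1}, and the
    -- first must be shown to lie in [H_{σ+2}, G_σ].
    · refine mem_iUnion.2 ⟨sidePairing g i + 1, Or.inr ⟨?_, ?_⟩⟩
      · rw [← SU11.onCircle_mem_arcCC (M.T i), ← h.eq_of_P ha, T_lowerCorner hg] at hu
        have e1 : sidePairing g i + 1 + 1 - 1 = sidePairing g i + 1 := by ring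
        have hH := M.lowerCorner_eq hg G (sidePairing g i + 1 + 1)
        have hP := M.T_P_add_one hg (sidePairing g (sidePairing g i + 1))
        rw [e1] at hH
        rw [sidePairing_sidePairing hg, add_sub_cancel_right] at hP
        -- With k = σ(σ(i)+1), the image of H_i is T_k G_k. Since B_k ≤ G_k ≤ P_{k+1}, it lies
        -- between T_k B_k = H_{σ+2} and T_k P_{k+1} = P_σ, and P_σ precedes G_σ; so the image
        -- section is contained in the required one.
        have hk : (M.T (sidePairing g (sidePairing g i + 1))).onCircle
            (G (sidePairing g (sidePairing g i + 1))) ∈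
            arcCC (M.lowerCorner G (sidePairing g i + 1 + 1)) (M.P (sidePairing g i)) := by
          rw [hH, ← hP, SU11.onCircle_mem_arcCC]
          generalize sidePairing g (sidePairing g i + 1) = k
          obtain ⟨r, rfl⟩ := ZMod.intCast_surjective k
          rw [← hL.liftB.exp_eq, ← hL.liftG.exp_eq, ← hL.expP_add_one]
          exact exp_mem_arcCC (by linarith [hL.p_le_β r, hL.P_gap hN r, hL.β_le_q r, hL.q_lt_p r])
            (hL.β_le_γ r) (hL.γ_le_p r)
        generalize (M.T (sidePairing g (sidePairing g i + 1))).onCircle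
            (G (sidePairing g (sidePairing g i + 1))) = v at hu hk
        have hG' : sidePairing g i + 1 - 1 = sidePairing g i := by ring
        rw [hG']
        change (M.T i).onCircle u ∈ _
        generalize sidePairing g i = j at *
        obtain ⟨s, rfl⟩ := ZMod.intCast_surjective j
        have eH : M.lowerCorner G ((s : SideIndex g) + 1 + 1) = Circle.exp (η (s + 1 + 1)) := by
          rw [hL.liftH.exp_eq]; push_cast; rfl
        obtain ⟨l1, l2⟩ := hL.η_lt_γ (j := s + 1) (k := s) (Or.inr (by ring))
        have l3 := hL.liftG.add_period s
        have l4 := hL.liftP.add_period s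
        have l5 := hL.p_le_β s
        have l6 := hL.β_le_γ s
        have l7 := hL.η_le_β (s + 1 + 1)
        have l8 := hL.β_le_q (s + 1 + 1 + 1)
        have l9 := hL.q_lt_p_of_lt (show s + 1 + 1 + 1 < s + (8 * g - 4 : ℕ) by omega)
        have eP : M.P s = Circle.exp (p (s + (8 * g - 4 : ℕ))) := by
          rw [l4, Circle.exp_add_two_pi, hL.liftP.exp_eq]
        have eG : G s = Circle.exp (γ (s + (8 * g - 4 : ℕ))) := by
          rw [l3, Circle.exp_add_two_pi, hL.liftG.exp_eq]
        rw [eH, eP, arcCC_exp (by linarith) (by linarith)] at hk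
        obtain ⟨t, ht, rfl⟩ := hk
        rw [eG] at hu
        rw [eH, eG]
        exact arcCC_exp_subset ht.1 (by linarith [ht.2]) le_rfl (by linarith) hu
      · change (M.T i).onCircle (M.P i) ∈ _
        rw [T_P hg]
        exact left_mem_arcCC _ _
  · rcases hc1 (i + 1) hw with hu | ⟨rfl, hu⟩
    · exact h.onPair_mem_domain hg hA i (hL.H_ne_G (i + 1)).1 (M.P_ne_Q hg (i + 1)) (hX (i + 1))
        (fun z hz => (hAi z).2 (Or.inr (Or.inr ⟨ha, hz⟩))) ⟨hu, hw.1⟩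
    -- Here branch `i` also acts on the rectangle over [Q_i, P_{i+1}], whose upper edge contains the
    -- point, so continuity suffices.
    · rw [show i + 1 - 2 = i - 1 by ring] at hu
      exact h.onPair_mem_domain hg hA i (hL.H_ne_G i).2 (M.Q_ne_P_add_one hg i) (hY i) hYi
        ⟨hu, right_mem_arcCC _ _⟩

theorem domain_diff_subset_gridLines (M : SurfacePolygon g) (G : SideIndex g → Circle) :
    M.domain G \ M.halfOpenDomain G ⊆ M.gridLines G := by
  rintro ⟨u, w⟩ ⟨hx, hx'⟩
  by_contra hgrid
  have hG : ∀ i, u ≠ G i := fun i hi => hgrid (Or.inl ⟨i, hi⟩)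
  have hPQ : ∀ i, w ≠ M.P i ∧ w ≠ M.Q i := fun i =>
    ⟨fun hi => hgrid (Or.inr ⟨i, Or.inl hi⟩), fun hi => hgrid (Or.inr ⟨i, Or.inr hi⟩)⟩
  obtain ⟨i, ⟨h1, h2⟩ | ⟨h1, h2⟩⟩ := mem_iUnion.1 hx
  · exact hx' (mem_iUnion.2 ⟨i, Or.inl ⟨⟨h1, hG _⟩, ⟨h2, (hPQ _).2⟩⟩⟩)
  · exact hx' (mem_iUnion.2 ⟨i, Or.inr ⟨⟨h1, hG _⟩, ⟨h2, (hPQ _).1⟩⟩⟩)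

end SurfacePolygon

theorem mainTheorem1 (g : ℕ) (hg : 2 ≤ g) (M : SurfacePolygon g) (A : SideIndex g → Circle)
    (hA : M.IsExtremal A) :
    (∃! G : SideIndex g → Circle, M.IsCornerSolution A G) ∧
    ∀ G : SideIndex g → Circle, M.IsCornerSolution A G →
      -- the closed domain is mapped into itself, onto a dense subset that misses only part of
      -- its boundary, and the map is injective on its interior
      M.natExt A '' M.domain G ⊆ M.domain G ∧
      closure (M.natExt A '' M.domain G) = M.domain G ∧
      interior (M.domain G) ⊆ M.natExt A '' M.domain G ∧
      Set.InjOn (M.natExt A) (interior (M.domain G)) ∧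
      -- the half-open domain is mapped bijectively onto itself
      Set.BijOn (M.natExt A) (M.halfOpenDomain G) (M.halfOpenDomain G) ∧
      -- the two domains agree up to part of the boundary
      interior (M.domain G) ⊆ M.halfOpenDomain G ∧
      closure (M.halfOpenDomain G) = M.domain G ∧
      M.domain G \ M.halfOpenDomain G ⊆ frontier (M.domain G) ∩ M.gridLines G := by
  refine ⟨M.existsUnique_isCornerSolution hg hA, fun G hG => ?_⟩
  have hcl := hG.closure_halfOpenDomain hg hA
  have hint := hG.interior_domain_subset hg hA
  have hbij := hG.bijOn_natExt hg hA
  have hmaps := (hG.mapsTo_natExt_domain hg hA).image_subset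
  have hsub : M.halfOpenDomain G ⊆ M.domain G := hcl ▸ subset_closure
  -- The image of the closed domain contains the half-open domain, which is dense in it and contains
  -- its interior; density of the image and the covering of the interior follow at once.
  have himg : M.halfOpenDomain G ⊆ M.natExt A '' M.domain G :=
    hbij.image_eq.symm.subset.trans (image_mono hsub)
  have hclosed : IsClosed (M.domain G) := hcl ▸ isClosed_closure
  refine ⟨hmaps, ?_, hint.trans himg, hbij.injOn.mono hint, hbij, hint, hcl, fun x hx => ⟨?_, ?_⟩⟩
  · exact (hclosed.closure_subset_iff.2 hmaps).antisymm (hcl.symm.subset.trans (closure_mono himg))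
  · rw [hclosed.frontier_eq]
    exact ⟨hx.1, fun h => hx.2 (hint h)⟩
  · exact M.domain_diff_subset_gridLines G hx
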